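/- **Setting.** Let $d\ge 1$, $\nu_0\in(0,1]$, $\eta\in(0,1)$, and let $\psi_1,\dots,\psi_n:\mathbb R^d\to\mathbb R^d$ be diffeomorphisms of class $C^{1,\nu_0}$ with Lipschitz constants at most $\eta$. Let $G$ be the unique non-empty compact set with $G=\bigcup_i\psi_i(G)$; assume $\mathrm{diam}(G)\le 1$ (a normalisation). Let $\Sigma=\{1,\dots,n\}^{\mathbb N}$ with the product topology, $\sigma(x_0x_1\dots)=(x_1x_2\dots)$, and let $\Phi(x_0x_1\dots)\in G$ be the unique point of $\bigcap_l\psi_{x_0}\circ\dots\circ\psi_{x_l}(G)$. Let $\mathcal F=\bigcup_{i\ne j}\psi_i(G)\cap\psi_j(G)$. Assume: * $\psi_i(G)\cap\psi_j(G)$ is finite for $i\neq j$; * $\bigcup_{j\ge1}\sigma^j(\Phi^{-1}(\mathcal F))$ is finite; * there are disjoint open sets $\mathcal O_1,\dots,\mathcal O_n\subset\mathbb R^d$ with $G\cap\mathcal O_i=\psi_i(G)\setminus\bigcup_{j\ne i}(\psi_i(G)\cap\psi_j(G))$; * (ND) there is $b>0$ such that for all $x\in G$ and $v,v_0\in\mathbb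 R^d$ there is $i$ with $|(D\psi_i(x)v,v_0)|\ge b\|v\|\,\|v_0\|$. Let $F:G\to G$ be given by $F(x)=\psi_i^{-1}(x)$ if $x\in\psi_i(G)\setminus\mathcal F$, while for each $x\in\mathcal F$ the value $F(x)$ is an arbitrarily chosen one of the fixed points $a_j$ of the maps $\psi_j$. Let $M^d$ be the space of symmetric real $d\times d$ matrices and $(A,B)_{HS}=\mathrm{tr}({}^tAB)$. For an $M^d$-valued Borel measure $\tau$ and $A:E\to M^d$ bounded Borel, $\int_E(A,d\tau)_{HS}$ is the corresponding real-valued integral. Let $$(\mathcal L_GA)(x)=\sum_i{}^tD\psi_i(x)\,A(\psi_i(x))\,D\psi_i(x)\ \ (x\in G),\qquad (\mathcal L_\Sigma A)(x)=\sum_i{}^tD\psi_i(\Phi(x))\,A(ix)\,D\psi_i(\Phi(x))\ \ (x\in\Sigma).$$ For $(E,\mathcal L)$ equal to $(G,\mathcal L_G)$ or $(\Sigma,\mathcal L_\Sigma)$, a *Gibbs triple* consists of $\beta>0$, a continuous $Q:E\to M^d$ with positive definite values and an $M^d$-valued Borel measure $\tau$ with positive semidefinite values such that $\mathcal LQ=\beta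 Q$, $\int_E(Q,d\tau)_{HS}=1$ and $\int_E(\mathcal LA,d\tau)_{HS}=\beta\int_E(A,d\tau)_{HS}$ for all $A\in C(E,M^d)$. Its Kusuoka measure is the scalar measure $\kappa(B)=\int_B(Q,d\tau)_{HS}$. **Statement (Lemma 4.8).** There is $\omega>0$, depending only on $d,n,\nu_0,\eta,b$, such that, in the setting above, if every $D\psi_i$ has $\nu_0$-Hölder constant at most $\omega$ on $G$, then the following holds both for $(E,\mathcal L,S)=(G,\mathcal L_G,F)$ and for $(E,\mathcal L,S)=(\Sigma,\mathcal L_\Sigma,\sigma)$. A Gibbs triple $(\beta,Q,\tau)$ exists, and for every Gibbs triple: 1. for all $g\in C(E,\mathbb R)$ and $A\in C(E,M^d)$, $$\int_E(g\circ S^l\cdot A,d\tau)_{HS}\longrightarrow\int_E(gQ,d\tau)_{HS}\cdot\int_E(A,d\tau)_{HS}\qquad(l\to+\infty);$$ 2. $\kappa$ is a (non-negative) probability measure on $E$; it is $S$-invariant, strongly mixing, i.e. $\kappa(B\cap S^{-l}(B'))\to\kappa(B)\kappa(B')$ for all Borel $B,B'\subset E$, and ergodic. -/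

import Mathlib

open MeasureTheory Filter Topology
open scoped NNReal ENNReal Matrix

attribute [local instance] Matrix.frobeniusNormedAddCommGroup Matrix.frobeniusNormedSpace

noncomputable section

namespace Kusuoka

/-- The Euclidean space `ℝ^d`. -/
abbrev E (d : ℕ) : Type := EuclideanSpace ℝ (Fin d)

/-- Real `d × d` matrices, normed by the Hilbert-Schmidt (Frobenius) norm. The space `M^d` of the
symmetric ones is singled out by `Matrix.IsSymm`. -/
abbrev Mat (d : ℕ) : Type := Matrix (Fin d) (Fin d) ℝ

/-! ### Matrix-valued measures -/

/-- Vector measures with values in a normed space. -/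
abbrev NormedMeasure (X V : Type*) [MeasurableSpace X] [NormedAddCommGroup V] : Type _ :=
  VectorMeasure X V

/-- `d × d` matrix-valued measures, for the topology of the Hilbert-Schmidt norm. -/
abbrev MatMeasure (X : Type*) [MeasurableSpace X] (d : ℕ) : Type _ := NormedMeasure X (Mat d)

/-- Continuous bilinear forms on a normed space. -/
abbrev BilinForm (V : Type*) [NormedAddCommGroup V] [NormedSpace ℝ V] : Type _ := V →L[ℝ] V →L[ℝ] ℝ

/-- The Hilbert-Schmidt pairing `(A, B) ↦ tr (ᵗA B)`. -/
def hs (d : ℕ) : BilinForm (Mat d) :=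
  LinearMap.toContinuousBilinearMap
    (LinearMap.mk₂ ℝ (fun A B : Mat d => (Aᵀ * B).trace)
      (fun A A' B => by simp [add_mul])
      (fun r A B => by simp)
      (fun A B B' => by simp [mul_add])
      (fun r A B => by simp))

lemma hs_apply {d : ℕ} (A B : Mat d) : hs d A B = (Aᵀ * B).trace := rfl

variable {X : Type*} [MeasurableSpace X] {d : ℕ}

/-- The scalar integral `∫_X (A, dτ)_HS` of a matrix field against a matrix-valued measure. -/
def hsIntegral (τ : MatMeasure X d) (A : X → Mat d) : ℝ :=
  τ.integral A (hs d)

/-- The scalar measure `(Q, τ)_HS`, `B ↦ ∫_B (Q, dτ)_HS`, as a positive measure. In general this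
is the positive part of that signed measure, and it is the measure itself when the latter is
non-negative, as it is for positive semidefinite `Q` and `τ`. -/
def kusuokaMeasure (Q : X → Mat d) (τ : MatMeasure X d) : Measure X :=
  (SignedMeasure.toJordanDecomposition (τ.withDensity Q (hs d))).posPart

/-- `β`, `Q`, `τ` are the eigenvalue, the eigenfunction and the Gibbs measure of the operator `L`:
`Q` is a continuous field of positive definite symmetric matrices with `L Q = β Q`, while `τ` is a
positive semidefinite matrix-valued measure with `∫ (Q, dτ)_HS = 1` and `L* τ = β τ`, where `L*`
is the adjoint of `L` for the pairing of `C(X, M^d)` with the `M^d`-valued measures. -/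
structure IsGibbs [TopologicalSpace X] (L : (X → Mat d) → X → Mat d)
    (β : ℝ) (Q : X → Mat d) (τ : MatMeasure X d) : Prop where
  pos : 0 < β
  continuous : Continuous Q
  posDef : ∀ x, (Q x).PosDef
  eigen : L Q = β • Q
  posSemidef : ∀ B, MeasurableSet B → (τ B).PosSemidef
  normalized : hsIntegral τ Q = 1
  adjoint : ∀ A : X → Mat d, Continuous A → (∀ x, (A x).IsSymm) →
    hsIntegral τ (L A) = β * hsIntegral τ A

/-- `T` preserves `μ` and is strongly mixing for it (`μ` being a probability measure). -/
structure StronglyMixing (T : X → X) (μ : Measure X) : Prop extends MeasurePreserving T μ μ where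
  mixing : ∀ A B : Set X, MeasurableSet A → MeasurableSet B →
    Tendsto (fun l : ℕ => μ (A ∩ T^[l] ⁻¹' B)) atTop (𝓝 (μ A * μ B))

/-- The properties claimed for the dynamics `T`, the eigenfunction `Q` and the Gibbs measure `τ`. -/
structure GibbsDynamics [TopologicalSpace X] (T : X → X) (Q : X → Mat d)
    (τ : MatMeasure X d) : Prop where
  /-- The asymptotic decorrelation of a scalar field and a matrix field. -/
  decorrelation : ∀ (g : X → ℝ) (A : X → Mat d), Continuous g → Continuous A →
    (∀ x, (A x).IsSymm) →
    Tendsto (fun l : ℕ => hsIntegral τ (fun x => g (T^[l] x) • A x)) atTop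
      (𝓝 (hsIntegral τ (fun x => g x • Q x) * hsIntegral τ A))
  isProbabilityMeasure : IsProbabilityMeasure (kusuokaMeasure Q τ)
  /-- The positive measure `kusuokaMeasure Q τ` is `(Q, τ)_HS`. -/
  kusuokaMeasure_apply : ∀ B, MeasurableSet B →
    (kusuokaMeasure Q τ).real B = hsIntegral (τ.restrict B) Q
  invariant : MeasurePreserving T (kusuokaMeasure Q τ) (kusuokaMeasure Q τ)
  stronglyMixing : StronglyMixing T (kusuokaMeasure Q τ)
  ergodic : Ergodic T (kusuokaMeasure Q τ)

/-! ### The fractal -/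

/-- A family `ψ` of `n` diffeomorphisms of `ℝ^d` of class `C^{1,ν₀}`, all of them `η`-Lipschitz for
some `η < 1`, together with its fractal `G`: the (unique) non-empty compact set that is the union of
its images; its diameter is normalised to be at most `1`. -/
structure IFS (d n : ℕ) (ν₀ η : ℝ≥0) where
  ψ : Fin n → E d ≃ E d
  contDiff : ∀ i, ContDiff ℝ 1 (ψ i)
  contDiff_symm : ∀ i, ContDiff ℝ 1 (ψ i).symm
  holder : ∀ i (K : Set (E d)), IsCompact K → ∃ C : ℝ≥0, HolderOnWith C ν₀ (fderiv ℝ (ψ i)) K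
  η_lt_one : η < 1
  lipschitz : ∀ i, LipschitzWith η (ψ i)
  G : Set (E d)
  isCompact : IsCompact G
  nonempty : G.Nonempty
  self_similar : G = ⋃ i, ψ i '' G
  diam_le : Metric.diam G ≤ 1

namespace IFS

variable {n : ℕ} {ν₀ η : ℝ≥0} (S : IFS d n ν₀ η)

lemma mem_G (i : Fin n) {x : E d} (hx : x ∈ S.G) : S.ψ i x ∈ S.G := by
  rw [S.self_similar]
  exact Set.mem_iUnion.2 ⟨i, x, hx, rfl⟩

/-- The map `ψ i` restricted to the fractal. -/
def ψG (i : Fin n) (x : S.G) : S.G := ⟨S.ψ i x, S.mem_G i x.2⟩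

lemma contracting (i : Fin n) : ContractingWith η (S.ψG i) :=
  ⟨S.η_lt_one, fun x y => S.lipschitz i x y⟩

/-- The unique fixed point `a_i` of `ψ i`; it belongs to the fractal. -/
def fixedPt (i : Fin n) : S.G :=
  haveI : CompleteSpace S.G := S.isCompact.isComplete.completeSpace_coe
  haveI : Nonempty S.G := S.nonempty.to_subtype
  ContractingWith.fixedPoint (S.ψG i) (S.contracting i)

/-- `ψ_{x_0} ∘ … ∘ ψ_{x_{l-1}}`. -/
def word (x : ℕ → Fin n) : ℕ → E d → E d
  | 0 => id
  | l + 1 => word x l ∘ S.ψ (x l)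

lemma word_lipschitz (x : ℕ → Fin n) (l : ℕ) : LipschitzWith (η ^ l) (S.word x l) := by
  induction l with
  | zero => simpa [word] using LipschitzWith.id
  | succ l ih => simpa [word, pow_succ] using ih.comp (S.lipschitz (x l))

/-- The intersection of the cells `ψ_{x_0} ∘ … ∘ ψ_{x_{l-1}}(G)` is not empty. -/
lemma coding_nonempty (x : ℕ → Fin n) : (⋂ l, S.word x l '' S.G).Nonempty := by
  have hc : ∀ l, IsCompact (S.word x l '' S.G) := fun l =>
    S.isCompact.image (S.word_lipschitz x l).continuous
  refine IsCompact.nonempty_iInter_of_sequence_nonempty_isCompact_isClosed _ (fun l => ?_)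
    (fun l => S.nonempty.image _) (hc 0) (fun l => (hc l).isClosed)
  rintro _ ⟨y, hy, rfl⟩
  exact ⟨S.ψ (x l) y, S.mem_G _ hy, rfl⟩

/-- The coding map `Φ : Σ → G`, sending `x` to the unique point of the intersection of the cells
`ψ_{x_0} ∘ … ∘ ψ_{x_l}(G)`. -/
def Φ (x : ℕ → Fin n) : S.G :=
  ⟨(S.coding_nonempty x).some, by
    simpa [word] using Set.mem_iInter.1 (S.coding_nonempty x).some_mem 0⟩

lemma coding_eq (x : ℕ → Fin n) : (⋂ l, S.word x l '' S.G) = {(S.Φ x : E d)} := by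
  refine Set.eq_singleton_iff_unique_mem.2 ⟨(S.coding_nonempty x).some_mem, fun y hy => ?_⟩
  have hz : (S.Φ x : E d) ∈ ⋂ l, S.word x l '' S.G := (S.coding_nonempty x).some_mem
  have key : ∀ l : ℕ, dist y (S.Φ x) ≤ (η : ℝ) ^ l := by
    intro l
    obtain ⟨u, hu, hu'⟩ := Set.mem_iInter.1 hy l
    obtain ⟨v, hv, hv'⟩ := Set.mem_iInter.1 hz l
    rw [← hu', ← hv']
    calc _ ≤ ((η ^ l : ℝ≥0) : ℝ) * dist u v := (S.word_lipschitz x l).dist_le_mul u v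
      _ ≤ (η : ℝ) ^ l * 1 := by
        push_cast
        gcongr
        exact (Metric.dist_le_diam_of_mem S.isCompact.isBounded hu hv).trans S.diam_le
      _ = _ := mul_one _
  have h0 : Tendsto (fun l : ℕ => (η : ℝ) ^ l) atTop (𝓝 0) :=
    tendsto_pow_atTop_nhds_zero_of_lt_one η.2 (by exact_mod_cast S.η_lt_one)
  exact dist_le_zero.1 (ge_of_tendsto' h0 key)

/-- The shift on the space of sequences. -/
def shift (x : ℕ → Fin n) : ℕ → Fin n := fun k => x (k + 1)

/-- The sequence `(i, x_0, x_1, …)`. -/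
def cons (i : Fin n) (x : ℕ → Fin n) : ℕ → Fin n
  | 0 => i
  | k + 1 => x k

/-- The set of the points that belong to two different cells `ψ i (G)`. -/
def overlap : Set (E d) := ⋃ (i) (j) (_ : i ≠ j), (S.ψ i '' S.G) ∩ (S.ψ j '' S.G)

/-- The standing assumptions on the fractal: two different cells meet in a finite set, `G` is
post-critically finite, and the cells are separated off the overlaps by disjoint open sets. -/
structure IsPCF : Prop where
  finite_inter : ∀ i j, i ≠ j → ((S.ψ i '' S.G) ∩ (S.ψ j '' S.G)).Finite
  postcritical : (⋃ (j : ℕ) (_ : 1 ≤ j), shift^[j] '' (S.Φ ⁻¹' (Subtype.val ⁻¹' S.overlap))).Finite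
  separated : ∃ O : Fin n → Set (E d), (∀ i, IsOpen (O i)) ∧ Pairwise (Function.onFun Disjoint O) ∧
    ∀ i, S.G ∩ O i = (S.ψ i '' S.G) \ ⋃ (j) (_ : i ≠ j), (S.ψ i '' S.G) ∩ (S.ψ j '' S.G)

lemma exists_branch (x : S.G) : ∃ i, (x : E d) ∈ S.ψ i '' S.G := by
  exact Set.mem_iUnion.1 (S.self_similar.subset x.2)

/-- An index `i` with `x ∈ ψ i (G)`; there is just one if `x` is not in an overlap. -/
def branch (x : S.G) : Fin n := (S.exists_branch x).choose

lemma symm_branch_mem (x : S.G) : (S.ψ (S.branch x)).symm x ∈ S.G := by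
  obtain ⟨y, hy, hyx⟩ := (S.exists_branch x).choose_spec
  have : (S.ψ (S.branch x)).symm x = y := by
    rw [Equiv.symm_apply_eq]; exact hyx.symm
  rwa [this]

open scoped Classical in
/-- The expanding map `F : G → G`: it is `ψ_i⁻¹` on the points that belong to the cell `ψ i (G)`
alone, and on the overlaps it takes as values arbitrarily chosen fixed points `a_j`, the choice being
`c`. -/
def F (c : S.G → Fin n) (x : S.G) : S.G :=
  if (x : E d) ∈ S.overlap then S.fixedPt (c x)
  else ⟨(S.ψ (S.branch x)).symm x, S.symm_branch_mem x⟩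

lemma F_apply (c : S.G → Fin n) {x : S.G} (hx : (x : E d) ∉ S.overlap) {i : Fin n}
    (hi : (x : E d) ∈ S.ψ i '' S.G) : (S.F c x : E d) = (S.ψ i).symm x := by
  have hb : S.branch x = i := by
    by_contra hne
    exact hx (Set.mem_iUnion.2 ⟨_, Set.mem_iUnion.2 ⟨_, Set.mem_iUnion.2
      ⟨hne, (S.exists_branch x).choose_spec, hi⟩⟩⟩)
  simp [F, hx, hb]

/-- The Jacobian matrix of `ψ i` at `x`. -/
def jac (i : Fin n) (x : E d) : Mat d :=
  Matrix.of fun k l => fderiv ℝ (S.ψ i) x (EuclideanSpace.single l 1) k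

/-- The Ruelle operator on `G`. -/
def ruelleG (A : S.G → Mat d) (x : S.G) : Mat d :=
  ∑ i, (S.jac i x)ᵀ * A (S.ψG i x) * S.jac i x

/-- The Ruelle operator on the space of sequences. -/
def ruelleSigma (A : (ℕ → Fin n) → Mat d) (x : ℕ → Fin n) : Mat d :=
  ∑ i, (S.jac i (S.Φ x))ᵀ * A (cons i x) * S.jac i (S.Φ x)

/-- The quantitative non-degeneracy condition, with constant `b`. -/
def Nondegenerate (b : ℝ) : Prop :=
  ∀ x ∈ S.G, ∀ v w : E d, ∃ i, b * (‖v‖ * ‖w‖) ≤ |inner ℝ (fderiv ℝ (S.ψ i) x v) w|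

end IFS

end Kusuoka

end

/-! The spectral gap of the Ruelle operator L comes from Birkhoff's cone method. The cone of
aperture K consists of the continuous positive semidefinite fields A with A(x) ≤ exp(K ρ(x,y)) A(y)
as quadratic forms. The gauge ρ is the distance to the power ν₀ on the fractal, and θ to the first
index of difference on sequences; the inverse branches contract ρ by θ < 1. Composing with the
branches improves K to Kθ, while the variation of the Jacobians costs an error controlled by ω² and
tr A. Nondegeneracy absorbs this error: applied to v and to the rows of a Gram factor of A, it
bounds L A below by a multiple of (tr A) Id, even when A is singular. For small ω the new aperture
is Kθ + 2 < K (`inCone_op`). Hilbert's projective metric is not needed: by `exists_comparison` a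
fixed proportion of L B can be subtracted from L A without leaving the cone, so the multiples of Lˡ1
that enclose LˡA approach each other like (1 - σ)ˡ (`exists_sandwich`).

This yields an average ℓ(A), first on the cone, then by density on all continuous symmetric fields.
With β = ℓ(L1), the fields β⁻ᵏLᵏ1 converge uniformly to an eigenfield Q₀, and β⁻ᵏLᵏA to ℓ(A) Q₀
(`exists_isPerron`). The functional ℓ is positive and linear; the scalar Riesz theorem on the fields
f·vvᵗ, with polarisation, represents it by a positive semidefinite matrix measure
(`exists_matMeasure`). Integrating the convergence against the measure of any other Gibbs triple
shows that this triple has the same β and gives the same projection (`tendsto_of_isPerron`).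

If the dynamics T inverts every branch τ-almost everywhere, then L(f∘T · A) = f · LA, hence ∫ f∘Tˡ A
dτ = β⁻ˡ ∫ f LˡA dτ, and the gap gives decorrelation, even for bounded Borel f. Mixing follows by
approximating only one of the two indicators by a continuous function; ergodicity follows from κ(B)
= κ(B)² for invariant B.

The shift inverts the branches everywhere. On the fractal, F(ψ_i x) = x can fail only if ψ_i x lies
in an overlap, so that x belongs to the finite set of postcritical points. The atoms of τ there
would form a finite set stable under every ψ_i (`apply_singleton_eq_zero`). Injective contractions
permute such a set only if it is a single point, a common fixed point; then every sequence would be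
postcritical, against finiteness (`eq_empty_of_mapsTo`). -/

noncomputable section

namespace Kusuoka

/-! ### Scalar integrals against vector measures -/

section VectorIntegral

variable {X V W : Type*} [MeasurableSpace X] [NormedAddCommGroup V] [NormedSpace ℝ V]
  [NormedAddCommGroup W] [NormedSpace ℝ W]

omit [NormedSpace ℝ V] [NormedSpace ℝ W] in
lemma integrable_of_bounded (μ : NormedMeasure X W) [IsFiniteMeasure μ.variation] {f : X → V}
    (hf : StronglyMeasurable f) {C : ℝ} (hC : ∀ x, ‖f x‖ ≤ C) : μ.Integrable f :=
  MeasureTheory.Integrable.of_bound hf.aestronglyMeasurable C (Eventually.of_forall hC)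

lemma integral_simpleFunc (μ : NormedMeasure X W) [IsFiniteMeasure μ.variation]
    (B : V →L[ℝ] W →L[ℝ] ℝ) (g : SimpleFunc X V) :
    μ.integral g B = ∑ y ∈ g.range, B y (μ (g ⁻¹' {y})) := by
  have hg : (g : X → V) = fun x => ∑ y ∈ g.range, (g ⁻¹' {y}).indicator (fun _ => y) x := by
    funext x
    rw [Finset.sum_eq_single (g x)]
    · simp
    · intro y _ hy
      simp [Set.indicator_of_notMem, Ne.symm hy]
    · intro h
      exact absurd (g.mem_range_self x) h
  conv_lhs => rw [hg]
  rw [VectorMeasure.integral_finsetSum]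
  · refine Finset.sum_congr rfl fun y _ => ?_
    rw [VectorMeasure.integral_indicator_const _ (g.measurableSet_fiber y)]
  · intro y _
    refine integrable_of_bounded μ (C := ‖y‖)
      (stronglyMeasurable_const.indicator (g.measurableSet_fiber y)) fun x => ?_
    exact norm_indicator_le_norm_self (fun _ : X => y) x

/-- The approximating simple functions take their values in `s` itself, and their integrals are
finite sums of non-negative pairings. Of `s` one needs only that it contains 0, the base point of
the approximation. -/
lemma integral_nonneg_of_mem (μ : NormedMeasure X W) [IsFiniteMeasure μ.variation]
    (B : V →L[ℝ] W →L[ℝ] ℝ) {f : X → V} (hf : StronglyMeasurable f) {C : ℝ}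
    (hC : ∀ x, ‖f x‖ ≤ C) [SecondCountableTopology V] {s : Set V} (h0 : (0 : V) ∈ s)
    (hfs : ∀ x, f x ∈ s) (hs : ∀ c ∈ s, ∀ t, MeasurableSet t → 0 ≤ B c (μ t)) :
    0 ≤ μ.integral f B := by
  borelize V
  let g : ℕ → SimpleFunc X V := fun n => SimpleFunc.approxOn f hf.measurable s 0 h0 n
  have hlim : Tendsto (fun n => μ.integral (g n) B) atTop (𝓝 (μ.integral f B)) := by
    refine VectorMeasure.tendsto_integral_filter_of_norm_le_const
      (Eventually.of_forall fun n => (g n).aestronglyMeasurable)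
      ⟨C + C, Eventually.of_forall fun n => Eventually.of_forall fun x => ?_⟩
      (Eventually.of_forall fun x => ?_)
    · exact (SimpleFunc.norm_approxOn_zero_le hf.measurable h0 x n).trans
        (add_le_add (hC x) (hC x))
    · exact SimpleFunc.tendsto_approxOn hf.measurable h0 (subset_closure (hfs x))
  refine ge_of_tendsto' hlim fun n => ?_
  rw [integral_simpleFunc]
  refine Finset.sum_nonneg fun y hy => hs y ?_ _ ((g n).measurableSet_fiber y)
  obtain ⟨x, rfl⟩ := SimpleFunc.mem_range.1 hy
  exact SimpleFunc.approxOn_mem hf.measurable h0 n x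

end VectorIntegral

/-! ### Quadratic forms, Gram factors and polarisation -/

section Quad

variable {d : ℕ}

/-- The quadratic form of a matrix. -/
def quad (A : Mat d) (v : Fin d → ℝ) : ℝ := v ⬝ᵥ A *ᵥ v

lemma quad_add (A B : Mat d) (v : Fin d → ℝ) : quad (A + B) v = quad A v + quad B v := by
  simp [quad, Matrix.add_mulVec]

lemma quad_sub (A B : Mat d) (v : Fin d → ℝ) : quad (A - B) v = quad A v - quad B v := by
  simp [quad, Matrix.sub_mulVec]

lemma quad_smul (c : ℝ) (A : Mat d) (v : Fin d → ℝ) : quad (c • A) v = c * quad A v := by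
  simp [quad, Matrix.smul_mulVec]

lemma quad_zero (v : Fin d → ℝ) : quad (0 : Mat d) v = 0 := by simp [quad]

lemma quad_sum {ι : Type*} (s : Finset ι) (A : ι → Mat d) (v : Fin d → ℝ) :
    quad (∑ i ∈ s, A i) v = ∑ i ∈ s, quad (A i) v := by
  classical
  induction s using Finset.induction_on with
  | empty => simp [quad_zero]
  | insert i s hi ih => rw [Finset.sum_insert hi, Finset.sum_insert hi, quad_add, ih]

lemma quad_one (v : Fin d → ℝ) : quad (1 : Mat d) v = v ⬝ᵥ v := by simp [quad]

lemma quad_conj (A D : Mat d) (v : Fin d → ℝ) : quad (Dᵀ * A * D) v = quad A (D *ᵥ v) := by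
  simp only [quad, ← Matrix.mulVec_mulVec, Matrix.dotProduct_mulVec, Matrix.vecMul_transpose]

lemma dotProduct_self_nonneg' (v : Fin d → ℝ) : 0 ≤ v ⬝ᵥ v :=
  Finset.sum_nonneg fun i _ => mul_self_nonneg (v i)

lemma posSemidef_iff_quad (A : Mat d) : A.PosSemidef ↔ A.IsSymm ∧ ∀ v, 0 ≤ quad A v := by
  rw [Matrix.posSemidef_iff_dotProduct_mulVec]
  simp [Matrix.IsHermitian, Matrix.IsSymm, quad, Matrix.conjTranspose_eq_transpose_of_trivial]

lemma posDef_iff_quad (A : Mat d) : A.PosDef ↔ A.IsSymm ∧ ∀ v, v ≠ 0 → 0 < quad A v := by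
  rw [Matrix.posDef_iff_dotProduct_mulVec]
  simp [Matrix.IsHermitian, Matrix.IsSymm, quad, Matrix.conjTranspose_eq_transpose_of_trivial]

lemma quad_gram (C : Mat d) (v : Fin d → ℝ) : quad (Cᵀ * C) v = ∑ k, (C k ⬝ᵥ v) ^ 2 := by
  have := quad_conj (1 : Mat d) C v
  rw [Matrix.mul_one, quad_one] at this
  rw [this]
  simp [dotProduct, Matrix.mulVec, sq]

lemma trace_gram (C : Mat d) : (Cᵀ * C).trace = ∑ k, C k ⬝ᵥ C k := by
  simp only [Matrix.trace, Matrix.diag, Matrix.mul_apply, Matrix.transpose_apply, dotProduct]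
  exact Finset.sum_comm

/-- Once one factor is a Gram matrix, positivity and vanishing of the pairing are read off term by
term on the rows `C k`. -/
lemma hs_gram (M C : Mat d) : hs d M (Cᵀ * C) = ∑ k, quad M (C k) := by
  rw [hs_apply, ← Matrix.mul_assoc, Matrix.trace_mul_comm, ← Matrix.mul_assoc, Matrix.trace]
  refine Finset.sum_congr rfl fun k _ => ?_
  simp only [Matrix.diag, quad, Matrix.mul_apply, Matrix.transpose_apply, dotProduct,
    Matrix.mulVec, Finset.sum_mul, Finset.mul_sum]
  refine Finset.sum_congr rfl fun i _ => Finset.sum_congr rfl fun j _ => ?_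
  ring

lemma hs_vecMulVec (v : Fin d → ℝ) (M : Mat d) :
    hs d (Matrix.vecMulVec v v) M = quad M v := by
  simp only [hs_apply, Matrix.trace, Matrix.diag, quad, Matrix.mul_apply, Matrix.transpose_apply,
    dotProduct, Matrix.mulVec, Matrix.vecMulVec_apply, Finset.mul_sum]
  rw [Finset.sum_comm]
  refine Finset.sum_congr rfl fun i _ => Finset.sum_congr rfl fun j _ => ?_
  ring

lemma trace_eq_sum_quad (A : Mat d) : A.trace = ∑ k, quad A (Pi.single k 1) := by
  simp [Matrix.trace, quad]

lemma trace_one_eq : (1 : Mat d).trace = d := by simp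

lemma trace_le_of_quad_le {A B : Mat d} (h : ∀ v, quad A v ≤ quad B v) : A.trace ≤ B.trace := by
  rw [trace_eq_sum_quad, trace_eq_sum_quad]
  exact Finset.sum_le_sum fun k _ => h _

lemma entry_eq_quad {A : Mat d} (hA : A.IsSymm) (i j : Fin d) :
    A i j = (quad A (Pi.single i 1 + Pi.single j 1) - quad A (Pi.single i 1)
      - quad A (Pi.single j 1)) / 2 := by
  have := hA.apply i j
  simp [quad, Matrix.mulVec_add, add_dotProduct, dotProduct_add]
  linarith

/-- Polarisation: the vector e_i + e_j has square norm at most 4, so the entry is at most (4c + c +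
c)/2. -/
lemma abs_entry_le_of_quad {A : Mat d} (hA : A.IsSymm) {c : ℝ}
    (h : ∀ v, |quad A v| ≤ c * (v ⬝ᵥ v)) (i j : Fin d) : |A i j| ≤ 3 * c := by
  have hi := abs_le.1 (h (Pi.single i 1))
  have hj := abs_le.1 (h (Pi.single j 1))
  have hij := abs_le.1 (h (Pi.single i 1 + Pi.single j 1))
  simp only [single_dotProduct, Pi.single_eq_same, mul_one, dotProduct_add, add_dotProduct,
    one_mul] at hi hj hij
  have hc : 0 ≤ c := by linarith [hi.1, hi.2]
  have h1 : (Pi.single j 1 : Fin d → ℝ) i ≤ 1 := by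
    by_cases e : i = j <;> simp [e]
  have h2 : (Pi.single i 1 : Fin d → ℝ) j ≤ 1 := by
    by_cases e : j = i <;> simp [e]
  have h3 := mul_le_mul_of_nonneg_left h1 hc
  have h4 := mul_le_mul_of_nonneg_left h2 hc
  rw [entry_eq_quad hA, abs_le]
  constructor <;> nlinarith

lemma abs_quad_le_of_entry {A : Mat d} {c : ℝ} (hc : 0 ≤ c) (h : ∀ i j, |A i j| ≤ c)
    (v : Fin d → ℝ) : |quad A v| ≤ c * d * (v ⬝ᵥ v) := by
  have h1 : |quad A v| ≤ ∑ i, ∑ j, c * ((v i * v i + v j * v j) / 2) := by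
    simp only [quad, dotProduct, Matrix.mulVec, Finset.mul_sum]
    refine (Finset.abs_sum_le_sum_abs _ _).trans (Finset.sum_le_sum fun i _ => ?_)
    refine (Finset.abs_sum_le_sum_abs _ _).trans (Finset.sum_le_sum fun j _ => ?_)
    have : |v i * (A i j * v j)| = |A i j| * (|v i| * |v j|) := by
      rw [abs_mul, abs_mul]; ring
    rw [this]
    have hv : |v i| * |v j| ≤ (v i * v i + v j * v j) / 2 := by
      have := sq_nonneg (|v i| - |v j|)
      nlinarith [abs_mul_abs_self (v i), abs_mul_abs_self (v j)]
    exact mul_le_mul (h i j) hv (by positivity) hc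
  refine h1.trans (le_of_eq ?_)
  simp only [← Finset.mul_sum, ← Finset.sum_div, Finset.sum_add_distrib, Finset.sum_const,
    Finset.card_univ, Fintype.card_fin, nsmul_eq_mul, dotProduct]
  have e : ∑ x, v x * ((d : ℝ) * v x) = d * ∑ x, v x * v x := by
    rw [Finset.mul_sum]
    exact Finset.sum_congr rfl fun x _ => by ring
  rw [e]
  ring

lemma sq_dotProduct_le (u v : Fin d → ℝ) : (u ⬝ᵥ v) ^ 2 ≤ (u ⬝ᵥ u) * (v ⬝ᵥ v) := by
  simpa [dotProduct, sq] using Finset.sum_mul_sq_le_sq_mul_sq Finset.univ u v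

end Quad

section Order
open scoped MatrixOrder

lemma exists_gram {d : ℕ} {A : Mat d} (hA : A.PosSemidef) : ∃ C : Mat d, A = Cᵀ * C := by
  obtain ⟨C, hC⟩ := CStarAlgebra.nonneg_iff_eq_star_mul_self.mp hA.nonneg
  exact ⟨C, by rw [hC, Matrix.star_eq_conjTranspose,
    Matrix.conjTranspose_eq_transpose_of_trivial]⟩

end Order

section Quad

variable {d : ℕ}

lemma quad_le_trace {A : Mat d} (hA : A.PosSemidef) (v : Fin d → ℝ) :
    quad A v ≤ A.trace * (v ⬝ᵥ v) := by
  obtain ⟨C, rfl⟩ := exists_gram hA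
  rw [quad_gram, trace_gram, Finset.sum_mul]
  exact Finset.sum_le_sum fun k _ => sq_dotProduct_le _ _

/-- Young's inequality on each row of a Gram factor. It is used with ε equal to the gauge ρ: an
increment u of size O(ρ) then costs only O(ρ). -/
lemma quad_add_vec_le {A : Mat d} (hA : A.PosSemidef) {ε : ℝ} (hε : 0 < ε) (p u : Fin d → ℝ) :
    quad A (p + u) ≤ (1 + ε) * quad A p + (1 + ε⁻¹) * (A.trace * (u ⬝ᵥ u)) := by
  have h : quad A (p + u) ≤ (1 + ε) * quad A p + (1 + ε⁻¹) * quad A u := by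
    obtain ⟨C, rfl⟩ := exists_gram hA
    rw [quad_gram, quad_gram, quad_gram, Finset.mul_sum, Finset.mul_sum, ← Finset.sum_add_distrib]
    refine Finset.sum_le_sum fun k _ => ?_
    rw [dotProduct_add]
    set x := C k ⬝ᵥ p
    set y := C k ⬝ᵥ u
    have key : (1 + ε) * x ^ 2 + (1 + ε⁻¹) * y ^ 2 - (x + y) ^ 2 = ε * (x - ε⁻¹ * y) ^ 2 := by
      field_simp
      ring
    nlinarith [mul_nonneg hε.le (sq_nonneg (x - ε⁻¹ * y))]
  have h2 : (1 + ε⁻¹) * quad A u ≤ (1 + ε⁻¹) * (A.trace * (u ⬝ᵥ u)) :=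
    mul_le_mul_of_nonneg_left (quad_le_trace hA u) (by positivity)
  linarith

/-- Nondegeneracy is applied to v and to each row of a Gram factor of A. The good index may depend
on the row, but all terms are non-negative and the sum over all indices dominates each choice. -/
lemma sum_quad_ge_of_nondegenerate {ι : Type*} [Fintype ι] {D : ι → Mat d} {c : ℝ}
    (hD : ∀ v w : Fin d → ℝ, ∃ i, c * ((v ⬝ᵥ v) * (w ⬝ᵥ w)) ≤ ((D i *ᵥ v) ⬝ᵥ w) ^ 2)
    {A : Mat d} (hA : A.PosSemidef) (v : Fin d → ℝ) :
    c * A.trace * (v ⬝ᵥ v) ≤ ∑ i, quad A (D i *ᵥ v) := by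
  obtain ⟨C, rfl⟩ := exists_gram hA
  simp only [quad_gram]
  rw [Finset.sum_comm, trace_gram, Finset.mul_sum, Finset.sum_mul]
  refine Finset.sum_le_sum fun k _ => ?_
  obtain ⟨i, hi⟩ := hD v (C k)
  calc c * (C k ⬝ᵥ C k) * (v ⬝ᵥ v) ≤ (C k ⬝ᵥ D i *ᵥ v) ^ 2 := by
        rw [dotProduct_comm (C k) (D i *ᵥ v)]
        linarith
    _ ≤ _ := Finset.single_le_sum (f := fun i => (C k ⬝ᵥ D i *ᵥ v) ^ 2)
        (fun i _ => sq_nonneg _) (Finset.mem_univ i)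

lemma hs_nonneg {M T : Mat d} (hM : M.PosSemidef) (hT : T.PosSemidef) : 0 ≤ hs d M T := by
  obtain ⟨C, rfl⟩ := exists_gram hT
  rw [hs_gram]
  exact Finset.sum_nonneg fun k _ => ((posSemidef_iff_quad M).1 hM).2 _

lemma eq_zero_of_hs_eq_zero {M T : Mat d} (hM : M.PosDef) (hT : T.PosSemidef)
    (h : hs d M T = 0) : T = 0 := by
  obtain ⟨C, rfl⟩ := exists_gram hT
  rw [hs_gram] at h
  replace h := (Finset.sum_eq_zero_iff_of_nonneg
    fun k _ => ((posSemidef_iff_quad M).1 hM.posSemidef).2 _).1 h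
  have hC : C = 0 := by
    ext k l
    by_contra hne
    have : C k ≠ 0 := fun h0 => hne (by simp [h0])
    exact (((posDef_iff_quad M).1 hM).2 _ this).ne' (h k (Finset.mem_univ k))
  simp [hC]

lemma entry_mul_self_le {A : Mat d} (hA : A.PosSemidef) (i j : Fin d) : |A i j| ≤ A.trace := by
  obtain ⟨C, rfl⟩ := exists_gram hA
  rw [trace_gram, Matrix.mul_apply]
  refine (Finset.abs_sum_le_sum_abs _ _).trans (Finset.sum_le_sum fun k _ => ?_)
  rw [Matrix.transpose_apply]
  have hi : C k i * C k i ≤ C k ⬝ᵥ C k :=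
    Finset.single_le_sum (f := fun i => C k i * C k i) (fun i _ => mul_self_nonneg _)
      (Finset.mem_univ i)
  have hj : C k j * C k j ≤ C k ⬝ᵥ C k :=
    Finset.single_le_sum (f := fun i => C k i * C k i) (fun i _ => mul_self_nonneg _)
      (Finset.mem_univ j)
  rw [abs_le]
  constructor <;> nlinarith [sq_nonneg (C k i + C k j), sq_nonneg (C k i - C k j)]

lemma eq_sum_vecMulVec {M : Mat d} (hM : M.IsSymm) :
    M = ∑ i, ∑ j, (M i j / 2) • (Matrix.vecMulVec (Pi.single i 1 + Pi.single j 1)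
        (Pi.single i 1 + Pi.single j 1) - Matrix.vecMulVec (Pi.single i 1) (Pi.single i 1)
        - Matrix.vecMulVec (Pi.single j 1) (Pi.single j 1)) := by
  ext k l
  simp only [Matrix.sum_apply, Matrix.smul_apply, Matrix.sub_apply, Matrix.vecMulVec_apply,
    Pi.add_apply, smul_eq_mul]
  have h : ∀ i j : Fin d, M i j / 2 * (((Pi.single i 1 : Fin d → ℝ) k + (Pi.single j 1 : Fin d → ℝ) k)
      * ((Pi.single i 1 : Fin d → ℝ) l + (Pi.single j 1 : Fin d → ℝ) l)
      - (Pi.single i 1 : Fin d → ℝ) k * (Pi.single i 1 : Fin d → ℝ) l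
      - (Pi.single j 1 : Fin d → ℝ) k * (Pi.single j 1 : Fin d → ℝ) l)
      = (if k = i then (if l = j then M i j / 2 else 0) else 0)
        + (if k = j then (if l = i then M i j / 2 else 0) else 0) := by
    intro i j
    simp only [Pi.single_apply]
    split_ifs <;> simp_all
    ring
  simp only [h, Finset.sum_add_distrib, Finset.sum_ite_eq, Finset.mem_univ, if_true,
    Finset.sum_ite_irrel, Finset.sum_const_zero]
  rw [hM.apply k l]
  ring

end Quad

/-- A continuous field of symmetric matrices. -/
structure IsField {X : Type*} [TopologicalSpace X] {d : ℕ} (A : X → Mat d) : Prop where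
  continuous : Continuous A
  isSymm : ∀ x, (A x).IsSymm

/-! ### Continuous fields of symmetric matrices -/

section Field

variable {X : Type*} [TopologicalSpace X] {d : ℕ} {A B : X → Mat d}

lemma IsField.add (hA : IsField A) (hB : IsField B) : IsField (A + B) :=
  ⟨hA.1.add hB.1, fun x => (hA.2 x).add (hB.2 x)⟩

lemma IsField.sub (hA : IsField A) (hB : IsField B) : IsField (A - B) :=
  ⟨hA.1.sub hB.1, fun x => (hA.2 x).sub (hB.2 x)⟩

lemma IsField.smul (c : ℝ) (hA : IsField A) : IsField (c • A) :=
  ⟨hA.1.const_smul c, fun x => (hA.2 x).smul c⟩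

lemma IsField.smul_fun {g : X → ℝ} (hg : Continuous g) (hA : IsField A) :
    IsField (fun x => g x • A x) :=
  ⟨hg.smul hA.1, fun x => (hA.2 x).smul (g x)⟩

lemma isField_const {M : Mat d} (hM : M.IsSymm) : IsField (fun _ : X => M) :=
  ⟨continuous_const, fun _ => hM⟩

lemma isField_one : IsField (1 : X → Mat d) := isField_const Matrix.isSymm_one

lemma IsField.continuous_entry (hA : IsField A) (i j : Fin d) : Continuous fun x => A x i j :=
  (continuous_apply_apply i j).comp hA.1

lemma IsField.exists_bound [CompactSpace X] (hA : IsField A) :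
    ∃ c : ℝ, 0 ≤ c ∧ ∀ x v, |quad (A x) v| ≤ c * (v ⬝ᵥ v) := by
  have h : ∀ i j, ∃ c : ℝ, ∀ x, |A x i j| ≤ c := fun i j => by
    obtain ⟨c, hc⟩ := isCompact_univ.exists_bound_of_continuousOn
      (hA.continuous_entry i j).continuousOn
    exact ⟨c, fun x => hc x trivial⟩
  choose c hc using h
  have hC : ∀ i j, |c i j| ≤ ∑ i, ∑ j, |c i j| := fun i j =>
    (Finset.single_le_sum (f := fun j => |c i j|) (fun _ _ => abs_nonneg _)
      (Finset.mem_univ j)).trans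
    (Finset.single_le_sum (f := fun i => ∑ j, |c i j|)
      (fun _ _ => Finset.sum_nonneg fun _ _ => abs_nonneg _) (Finset.mem_univ i))
  have h0 : 0 ≤ ∑ i, ∑ j, |c i j| :=
    Finset.sum_nonneg fun _ _ => Finset.sum_nonneg fun _ _ => abs_nonneg _
  exact ⟨(∑ i, ∑ j, |c i j|) * d, by positivity, fun x v =>
    abs_quad_le_of_entry h0 (fun i j => ((hc i j x).trans (le_abs_self _)).trans (hC i j)) v⟩

end Field

/-- The cone of the fields of positive semidefinite matrices whose logarithm is `K`-Lipschitz, in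
the sense of quadratic forms, for the gauge `ρ`. -/
structure InCone {X : Type*} [TopologicalSpace X] {d : ℕ} (ρ : X → X → ℝ) (K : ℝ)
    (A : X → Mat d) : Prop extends IsField A where
  nonneg : ∀ x v, 0 ≤ quad (A x) v
  le_exp : ∀ x y v, quad (A x) v ≤ Real.exp (K * ρ x y) * quad (A y) v

/-! ### Cones of log-Lipschitz positive fields -/

section Cone

variable {X : Type*} [TopologicalSpace X] {d : ℕ} {ρ : X → X → ℝ} {K : ℝ} {A B : X → Mat d}

lemma InCone.posSemidef (hA : InCone ρ K A) (x : X) : (A x).PosSemidef :=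
  (posSemidef_iff_quad _).2 ⟨hA.isSymm x, hA.nonneg x⟩

lemma InCone.trace_nonneg (hA : InCone ρ K A) (x : X) : 0 ≤ (A x).trace :=
  (hA.posSemidef x).trace_nonneg

lemma InCone.mono (hρ : ∀ x y, 0 ≤ ρ x y) {K' : ℝ} (hK : K' ≤ K) (hA : InCone ρ K' A) :
    InCone ρ K A :=
  ⟨hA.toIsField, hA.nonneg, fun x y v => (hA.le_exp x y v).trans
    (mul_le_mul_of_nonneg_right (Real.exp_le_exp.2 (mul_le_mul_of_nonneg_right hK (hρ x y)))
      (hA.nonneg y v))⟩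

lemma InCone.smul {c : ℝ} (hc : 0 ≤ c) (hA : InCone ρ K A) : InCone ρ K (c • A) :=
  ⟨hA.toIsField.smul c,
    fun x v => by rw [Pi.smul_apply, quad_smul]; exact mul_nonneg hc (hA.nonneg x v),
    fun x y v => by
      rw [Pi.smul_apply, Pi.smul_apply, quad_smul, quad_smul]
      calc c * quad (A x) v ≤ c * (Real.exp (K * ρ x y) * quad (A y) v) :=
            mul_le_mul_of_nonneg_left (hA.le_exp x y v) hc
        _ = _ := by ring⟩

lemma inCone_one (hρ : ∀ x y, 0 ≤ ρ x y) (hK : 0 ≤ K) : InCone ρ K (1 : X → Mat d) := by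
  refine ⟨isField_one, fun x v => ?_, fun x y v => ?_⟩
  · rw [Pi.one_apply, quad_one]; exact dotProduct_self_nonneg' v
  · rw [Pi.one_apply, Pi.one_apply, quad_one]
    exact le_mul_of_one_le_left (dotProduct_self_nonneg' v)
      (Real.one_le_exp (mul_nonneg hK (hρ x y)))

lemma InCone.le_exp_const (hρ1 : ∀ x y, ρ x y ≤ 1) (hK : 0 ≤ K) (hA : InCone ρ K A) (x y : X)
    (v : Fin d → ℝ) : quad (A x) v ≤ Real.exp K * quad (A y) v :=
  (hA.le_exp x y v).trans (mul_le_mul_of_nonneg_right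
    (Real.exp_le_exp.2 (mul_le_of_le_one_right hK (hρ1 x y))) (hA.nonneg y v))

/-- The smaller aperture K' leaves A a margin of at least (K - K')t A(y) in the inequality for K,
with t = ρ(x,y). Subtracting σB uses up at most σ(K + K')eᴷ t B(y), and B ≤ rA. Both are linear in
t, so one σ serves all pairs of points. -/
lemma InCone.sub_smul (hρ : ∀ x y, 0 ≤ ρ x y) (hρ1 : ∀ x y, ρ x y ≤ 1)
    (hρs : ∀ x y, ρ x y = ρ y x) {K' r σ : ℝ}
    (hK' : 0 ≤ K') (hK : K' ≤ K) (hσ : 0 ≤ σ) (hA : InCone ρ K' A) (hB : InCone ρ K' B)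
    (hr : ∀ x v, quad (B x) v ≤ r * quad (A x) v) (hσr : σ * r ≤ 1)
    (hσK : σ * ((K + K') * Real.exp K * r) ≤ K - K') : InCone ρ K (A - σ • B) := by
  refine ⟨hA.toIsField.sub (hB.toIsField.smul σ), fun x v => ?_, fun x y v => ?_⟩
  · rw [Pi.sub_apply, Pi.smul_apply, quad_sub, quad_smul]
    nlinarith [mul_le_mul_of_nonneg_left (hr x v) hσ, hA.nonneg x v]
  · simp only [Pi.sub_apply, Pi.smul_apply, quad_sub, quad_smul]
    set t := ρ x y with ht
    have ht0 : 0 ≤ t := hρ x y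
    have ht1 : t ≤ 1 := hρ1 x y
    have h1 : (K - K') * t ≤ Real.exp (K * t) - Real.exp (K' * t) := by
      have e1 : Real.exp (K * t) = Real.exp (K' * t) * Real.exp ((K - K') * t) := by
        rw [← Real.exp_add]; ring_nf
      have e2 := Real.add_one_le_exp ((K - K') * t)
      have e3 := Real.one_le_exp (mul_nonneg hK' ht0)
      have e4 : 0 ≤ (K - K') * t := mul_nonneg (sub_nonneg.2 hK) ht0
      rw [e1]
      nlinarith
    have h2 : Real.exp (K * t) - Real.exp (-(K' * t)) ≤ (K + K') * Real.exp K * t := by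
      have e1 : Real.exp (-(K' * t)) = Real.exp (K * t) * Real.exp (-((K + K') * t)) := by
        rw [← Real.exp_add]; ring_nf
      have e2 := Real.add_one_le_exp (-((K + K') * t))
      have e3 : Real.exp (K * t) ≤ Real.exp K :=
        Real.exp_le_exp.2 (mul_le_of_le_one_right (hK'.trans hK) ht1)
      have e4 : 0 ≤ (K + K') * t := mul_nonneg (by linarith) ht0
      have e5 := Real.exp_pos (K * t)
      rw [e1]
      nlinarith [mul_le_mul_of_nonneg_right e3 e4]
    have hBx : Real.exp (-(K' * t)) * quad (B y) v ≤ quad (B x) v := by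
      have := hB.le_exp y x v
      rw [hρs y x, ← ht] at this
      calc Real.exp (-(K' * t)) * quad (B y) v
          ≤ Real.exp (-(K' * t)) * (Real.exp (K' * t) * quad (B x) v) :=
            mul_le_mul_of_nonneg_left this (Real.exp_pos _).le
        _ = quad (B x) v := by rw [← mul_assoc, ← Real.exp_add]; simp
    have hAx := hA.le_exp x y v
    rw [← ht] at hAx
    have hA0 := hA.nonneg y v
    have hB0 := hB.nonneg y v
    have hr' := hr y v
    have c1 : (K - K') * t * quad (A y) v ≤ (Real.exp (K * t) - Real.exp (K' * t)) * quad (A y) v :=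
      mul_le_mul_of_nonneg_right h1 hA0
    have c2 : (Real.exp (K * t) - Real.exp (-(K' * t))) * quad (B y) v
        ≤ (K + K') * Real.exp K * t * (r * quad (A y) v) := by
      have : 0 ≤ (K + K') * Real.exp K * t :=
        mul_nonneg (mul_nonneg (by linarith) (Real.exp_pos _).le) ht0
      exact (mul_le_mul_of_nonneg_right h2 hB0).trans (mul_le_mul_of_nonneg_left hr' this)
    have c3 := mul_le_mul_of_nonneg_right hσK (mul_nonneg ht0 hA0)
    have c4 := mul_le_mul_of_nonneg_left c2 hσ
    have c5 := mul_le_mul_of_nonneg_left hBx hσ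
    nlinarith

end Cone

/-- A family of maps `s i` together with a matrix cocycle `D i` over it. -/
structure Cocycle (X : Type*) [TopologicalSpace X] (ι : Type*) (d : ℕ) where
  s : ι → X → X
  D : ι → X → Mat d
  continuous_s : ∀ i, Continuous (s i)
  continuous_D : ∀ i, Continuous (D i)

/-! ### The Ruelle operator and its contraction of the cones -/

namespace Cocycle

variable {X : Type*} [TopologicalSpace X] {ι : Type*} [Fintype ι] {d : ℕ} (C : Cocycle X ι d)

/-- The Ruelle operator of a matrix cocycle. -/
def op (A : X → Mat d) (x : X) : Mat d := ∑ i, (C.D i x)ᵀ * A (C.s i x) * C.D i x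

lemma quad_op (A : X → Mat d) (x : X) (v : Fin d → ℝ) :
    quad (C.op A x) v = ∑ i, quad (A (C.s i x)) (C.D i x *ᵥ v) := by
  simp only [op, quad_sum, quad_conj]

lemma op_add (A B : X → Mat d) : C.op (A + B) = C.op A + C.op B := by
  funext x
  simp [op, Matrix.mul_add, Matrix.add_mul, Finset.sum_add_distrib]

lemma op_sub (A B : X → Mat d) : C.op (A - B) = C.op A - C.op B := by
  funext x
  simp [op, Matrix.mul_sub, Matrix.sub_mul, Finset.sum_sub_distrib]

lemma op_smul (c : ℝ) (A : X → Mat d) : C.op (c • A) = c • C.op A := by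
  funext x
  simp [op, Finset.smul_sum]

lemma iterate_op_add (k : ℕ) (A B : X → Mat d) : C.op^[k] (A + B) = C.op^[k] A + C.op^[k] B := by
  induction k generalizing A B with
  | zero => rfl
  | succ k ih => simp only [Function.iterate_succ_apply, op_add, ih]

lemma iterate_op_sub (k : ℕ) (A B : X → Mat d) : C.op^[k] (A - B) = C.op^[k] A - C.op^[k] B := by
  induction k generalizing A B with
  | zero => rfl
  | succ k ih => simp only [Function.iterate_succ_apply, op_sub, ih]

lemma iterate_op_smul (k : ℕ) (c : ℝ) (A : X → Mat d) : C.op^[k] (c • A) = c • C.op^[k] A := by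
  induction k generalizing A with
  | zero => rfl
  | succ k ih => simp only [Function.iterate_succ_apply, op_smul, ih]

lemma isField_op {A : X → Mat d} (hA : IsField A) : IsField (C.op A) := by
  constructor
  · exact continuous_finsetSum _ fun i _ =>
      (((C.continuous_D i).matrix_transpose.matrix_mul (hA.1.comp (C.continuous_s i))).matrix_mul
        (C.continuous_D i))
  · intro x
    simp only [Matrix.IsSymm, op, Matrix.transpose_sum, Matrix.transpose_mul,
      Matrix.transpose_transpose, (hA.2 _).eq, Matrix.mul_assoc]

lemma isField_iterate_op {A : X → Mat d} (hA : IsField A) (k : ℕ) : IsField (C.op^[k] A) := by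
  induction k with
  | zero => exact hA
  | succ k ih => rw [Function.iterate_succ_apply']; exact C.isField_op ih

lemma quad_op_mono {A B : X → Mat d} (h : ∀ x v, quad (A x) v ≤ quad (B x) v) (x : X)
    (v : Fin d → ℝ) : quad (C.op A x) v ≤ quad (C.op B x) v := by
  rw [quad_op, quad_op]
  exact Finset.sum_le_sum fun i _ => h _ _

lemma quad_iterate_op_mono (k : ℕ) {A B : X → Mat d} (h : ∀ x v, quad (A x) v ≤ quad (B x) v)
    (x : X) (v : Fin d → ℝ) : quad (C.op^[k] A x) v ≤ quad (C.op^[k] B x) v := by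
  induction k generalizing A B with
  | zero => exact h x v
  | succ k ih =>
    rw [Function.iterate_succ_apply, Function.iterate_succ_apply]
    exact ih (C.quad_op_mono h)

/-- The conditions under which the Ruelle operator strictly contracts the cones `InCone ρ K`. -/
structure IsContracting (ρ : X → X → ℝ) (θ b ω K : ℝ) : Prop where
  pos_dim : 0 < d
  nonempty : Nonempty X
  nonneg : ∀ x y, 0 ≤ ρ x y
  le_one : ∀ x y, ρ x y ≤ 1
  symm : ∀ x y, ρ x y = ρ y x
  contract : ∀ i x y, ρ (C.s i x) (C.s i y) ≤ θ * ρ x y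
  theta_nonneg : 0 ≤ θ
  b_pos : 0 < b
  nondegenerate : ∀ x (v w : Fin d → ℝ), ∃ i,
    b ^ 2 * ((v ⬝ᵥ v) * (w ⬝ᵥ w)) ≤ ((C.D i x *ᵥ v) ⬝ᵥ w) ^ 2
  bound : ∀ i x v, (C.D i x *ᵥ v) ⬝ᵥ (C.D i x *ᵥ v) ≤ v ⬝ᵥ v
  holder : ∀ i x y v, ((C.D i x - C.D i y) *ᵥ v) ⬝ᵥ ((C.D i x - C.D i y) *ᵥ v)
    ≤ ω ^ 2 * ρ x y ^ 2 * (v ⬝ᵥ v)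
  K_nonneg : 0 ≤ K
  gap : K * θ + 2 < K
  small : 2 * ω ^ 2 * Fintype.card ι * Real.exp K ≤ b ^ 2

namespace IsContracting

variable {C} {ρ : X → X → ℝ} {θ b ω K : ℝ} (h : C.IsContracting ρ θ b ω K)
include h

/-- Nondegeneracy makes L A uniformly positive definite in terms of the trace of A at any point z:
since ρ ≤ 1, moving from z to the images of x costs at most a factor eᴷ. -/
lemma op_lower {A : X → Mat d} (hA : InCone ρ K A) (x z : X) (v : Fin d → ℝ) :
    b ^ 2 * (A z).trace * (v ⬝ᵥ v) ≤ Real.exp K * quad (C.op A x) v := by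
  refine (sum_quad_ge_of_nondegenerate (h.nondegenerate x) (hA.posSemidef z) v).trans ?_
  rw [quad_op, Finset.mul_sum]
  exact Finset.sum_le_sum fun i _ => hA.le_exp_const h.le_one h.K_nonneg _ _ _

lemma op_upper {A : X → Mat d} (hA : InCone ρ K A) (x z : X) (v : Fin d → ℝ) :
    quad (C.op A x) v ≤ Fintype.card ι * Real.exp K * (A z).trace * (v ⬝ᵥ v) := by
  rw [quad_op]
  have : ∀ i ∈ Finset.univ, quad (A (C.s i x)) (C.D i x *ᵥ v)
      ≤ Real.exp K * ((A z).trace * (v ⬝ᵥ v)) := fun i _ => by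
    refine (hA.le_exp_const h.le_one h.K_nonneg _ z _).trans
      (mul_le_mul_of_nonneg_left ?_ (Real.exp_pos _).le)
    exact (quad_le_trace (hA.posSemidef z) _).trans
      (mul_le_mul_of_nonneg_left (h.bound i x v) (hA.trace_nonneg z))
  refine (Finset.sum_le_sum this).trans (le_of_eq ?_)
  rw [Finset.sum_const, Finset.card_univ, nsmul_eq_mul]
  ring

/-- Contraction of the branches gives the factor exp(Kθρ). Replacing the Jacobian at x by the one at
y gives 1 + ρ from Young's inequality and a further ρ from the absorbed error, and 1 + 2ρ ≤ exp(2ρ).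
-/
lemma inCone_op {A : X → Mat d} (hA : InCone ρ K A) : InCone ρ (K * θ + 2) (C.op A) := by
  refine ⟨C.isField_op hA.toIsField, fun x v => ?_, fun x y v => ?_⟩
  · rw [quad_op]
    exact Finset.sum_nonneg fun i _ => hA.nonneg _ _
  set r := ρ x y with hr
  have hr0 : 0 ≤ r := h.nonneg x y
  have hr1 : r ≤ 1 := h.le_one x y
  have hv := dotProduct_self_nonneg' v
  -- Young's inequality with ε = r, where (1 + r⁻¹)r² = r² + r ≤ 2r. For r = 0 the two Jacobians
  -- agree on v and there is no error.
  have h1 : ∀ i, quad (A (C.s i y)) (C.D i x *ᵥ v) ≤ (1 + r) * quad (A (C.s i y)) (C.D i y *ᵥ v)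
      + 2 * r * ω ^ 2 * ((A (C.s i y)).trace * (v ⬝ᵥ v)) := by
    intro i
    set p := C.D i y *ᵥ v
    set u := (C.D i x - C.D i y) *ᵥ v with hu
    have hpu : C.D i x *ᵥ v = p + u := by rw [hu, Matrix.sub_mulVec]; abel
    have hu2 : u ⬝ᵥ u ≤ ω ^ 2 * r ^ 2 * (v ⬝ᵥ v) := h.holder i x y v
    rw [hpu]
    rcases hr0.eq_or_lt with h0 | h0
    · rw [← h0] at hu2 ⊢
      have : u = 0 := by
        rw [← dotProduct_self_eq_zero (R := ℝ)]
        exact le_antisymm (by simpa using hu2) (dotProduct_self_nonneg' u)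
      simp [this]
    · refine (quad_add_vec_le (hA.posSemidef _) h0 p u).trans (add_le_add le_rfl ?_)
      have ht := hA.trace_nonneg (C.s i y)
      have e : (1 + r⁻¹) * r ^ 2 = r ^ 2 + r := by field_simp
      have e0 : 0 < 1 + r⁻¹ := by positivity
      calc (1 + r⁻¹) * ((A (C.s i y)).trace * (u ⬝ᵥ u))
          ≤ (1 + r⁻¹) * ((A (C.s i y)).trace * (ω ^ 2 * r ^ 2 * (v ⬝ᵥ v))) := by gcongr
        _ = ((1 + r⁻¹) * r ^ 2) * (ω ^ 2 * ((A (C.s i y)).trace * (v ⬝ᵥ v))) := by ring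
        _ ≤ (2 * r) * (ω ^ 2 * ((A (C.s i y)).trace * (v ⬝ᵥ v))) := by
            rw [e]
            gcongr
            nlinarith
        _ = _ := by ring
  -- The lower bound `op_lower` at z = s_i y turns each trace into L A(y); the smallness of ω then
  -- makes the whole error at most r times L A(y).
  have h2 : b ^ 2 * ∑ i, 2 * r * ω ^ 2 * ((A (C.s i y)).trace * (v ⬝ᵥ v))
      ≤ b ^ 2 * (r * quad (C.op A y) v) := by
    have : ∀ i ∈ Finset.univ, b ^ 2 * (2 * r * ω ^ 2 * ((A (C.s i y)).trace * (v ⬝ᵥ v)))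
        ≤ 2 * r * ω ^ 2 * (Real.exp K * quad (C.op A y) v) := fun i _ => by
      have := mul_le_mul_of_nonneg_left (h.op_lower hA y (C.s i y) v)
        (show 0 ≤ 2 * r * ω ^ 2 by positivity)
      linarith
    rw [Finset.mul_sum]
    refine (Finset.sum_le_sum this).trans ?_
    rw [Finset.sum_const, Finset.card_univ, nsmul_eq_mul]
    have hq : 0 ≤ quad (C.op A y) v := by
      rw [quad_op]
      exact Finset.sum_nonneg fun i _ => hA.nonneg _ _
    have := mul_le_mul_of_nonneg_right h.small (mul_nonneg hr0 hq)
    linarith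
  have h3 := le_of_mul_le_mul_left h2 (pow_pos h.b_pos 2)
  have hq : 0 ≤ quad (C.op A y) v := by
    rw [quad_op]
    exact Finset.sum_nonneg fun i _ => hA.nonneg _ _
  calc quad (C.op A x) v = ∑ i, quad (A (C.s i x)) (C.D i x *ᵥ v) := C.quad_op A x v
    _ ≤ ∑ i, Real.exp (K * θ * r) * ((1 + r) * quad (A (C.s i y)) (C.D i y *ᵥ v)
        + 2 * r * ω ^ 2 * ((A (C.s i y)).trace * (v ⬝ᵥ v))) := by
        refine Finset.sum_le_sum fun i _ => ?_
        refine (hA.le_exp (C.s i x) (C.s i y) _).trans ?_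
        refine mul_le_mul (Real.exp_le_exp.2 ?_) (h1 i) (hA.nonneg _ _) (Real.exp_pos _).le
        rw [mul_assoc]
        exact mul_le_mul_of_nonneg_left (h.contract i x y) h.K_nonneg
    _ = Real.exp (K * θ * r) * ((1 + r) * quad (C.op A y) v
        + ∑ i, 2 * r * ω ^ 2 * ((A (C.s i y)).trace * (v ⬝ᵥ v))) := by
        rw [← Finset.mul_sum, Finset.sum_add_distrib, ← Finset.mul_sum, quad_op]
    _ ≤ Real.exp (K * θ * r) * (Real.exp (2 * r) * quad (C.op A y) v) := by
        refine mul_le_mul_of_nonneg_left ?_ (Real.exp_pos _).le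
        have := mul_le_mul_of_nonneg_right (Real.add_one_le_exp (2 * r)) hq
        linarith
    _ = _ := by
        rw [← mul_assoc, ← Real.exp_add]
        ring_nf

lemma inCone_op' {A : X → Mat d} (hA : InCone ρ K A) : InCone ρ K (C.op A) :=
  (h.inCone_op hA).mono h.nonneg h.gap.le

lemma inCone_iterate_op {A : X → Mat d} (hA : InCone ρ K A) (k : ℕ) :
    InCone ρ K (C.op^[k] A) := by
  induction k with
  | zero => exact hA
  | succ k ih => rw [Function.iterate_succ_apply']; exact h.inCone_op' ih

lemma inCone_one : InCone ρ K (1 : X → Mat d) := Kusuoka.inCone_one h.nonneg h.K_nonneg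

lemma card_pos : 0 < Fintype.card ι := by
  obtain ⟨x⟩ := h.nonempty
  obtain ⟨i, -⟩ := h.nondegenerate x 0 0
  exact Fintype.card_pos_iff.2 ⟨i⟩

/-- After normalisation by the traces at z, L A and L B are comparable by `op_lower` and `op_upper`,
and both lie in the smaller cone. Hence `InCone.sub_smul` applies, with σ independent of A, B and z:
this is Birkhoff's contraction in additive form. -/
lemma exists_comparison : ∃ σ : ℝ, 0 < σ ∧ σ < 1 ∧ ∀ (A B : X → Mat d), InCone ρ K A →
    InCone ρ K B → ∀ z, InCone ρ K ((B z).trace • C.op A - σ • ((A z).trace • C.op B)) := by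
  have hn : (0 : ℝ) < Fintype.card ι := by exact_mod_cast h.card_pos
  have hb := pow_pos h.b_pos 2
  have hK0 := h.K_nonneg
  have hKθ : 0 ≤ K * θ := mul_nonneg hK0 h.theta_nonneg
  -- One factor eᴷ comes from the upper bound for L B, the other from the lower bound for L A.
  set r : ℝ := Fintype.card ι * Real.exp K * Real.exp K / b ^ 2 with hr
  have hr0 : 0 < r := by positivity
  set c : ℝ := (K + (K * θ + 2)) * Real.exp K * r with hc
  have hc0 : 0 < c := by positivity
  have hgap := sub_pos.2 h.gap
  refine ⟨min (min (1 / 2) r⁻¹) ((K - (K * θ + 2)) / c), by positivity,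
    (min_le_left _ _).trans_lt ((min_le_left _ _).trans_lt (by norm_num)), fun A B hA hB z => ?_⟩
  refine ((h.inCone_op hA).smul (hB.trace_nonneg z)).sub_smul h.nonneg h.le_one h.symm (r := r)
    (by positivity) h.gap.le (by positivity) ((h.inCone_op hB).smul (hA.trace_nonneg z))
    (fun x v => ?_) ?_ ?_
  · rw [Pi.smul_apply, Pi.smul_apply, quad_smul, quad_smul]
    have h1 := mul_le_mul_of_nonneg_left (h.op_upper hB x z v) (hA.trace_nonneg z)
    have h2 := mul_le_mul_of_nonneg_left (h.op_lower hA x z v)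
      (show 0 ≤ Fintype.card ι * Real.exp K * (B z).trace from
        mul_nonneg (by positivity) (hB.trace_nonneg z))
    rw [hr, div_mul_eq_mul_div, le_div_iff₀ hb]
    nlinarith
  · calc _ ≤ r⁻¹ * r :=
        mul_le_mul_of_nonneg_right ((min_le_left _ _).trans (min_le_right _ _)) hr0.le
      _ = 1 := inv_mul_cancel₀ hr0.ne'
  · calc _ ≤ (K - (K * θ + 2)) / c * c := mul_le_mul_of_nonneg_right (min_le_right _ _) hc0.le
      _ = _ := div_mul_cancel₀ _ hc0.ne'

end IsContracting

end Cocycle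

/-! ### Averages: comparison with the iterates of the identity -/

namespace Cocycle

variable {X : Type*} [TopologicalSpace X] {ι : Type*} [Fintype ι] {d : ℕ} (C : Cocycle X ι d)

/-- The iterates of `A` under the Ruelle operator are uniformly asymptotic to `c` times those of
the identity. -/
def HasAvg (A : X → Mat d) (c : ℝ) : Prop :=
  ∀ ε > 0, ∀ᶠ k in atTop, ∀ x v,
    |quad (C.op^[k] A x) v - c * quad (C.op^[k] 1 x) v| ≤ ε * quad (C.op^[k] 1 x) v

variable {C}

lemma HasAvg.add {A B : X → Mat d} {a b : ℝ} (hA : C.HasAvg A a) (hB : C.HasAvg B b) :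
    C.HasAvg (A + B) (a + b) := by
  intro ε hε
  filter_upwards [hA (ε / 2) (by positivity), hB (ε / 2) (by positivity)] with k h1 h2 x v
  rw [iterate_op_add, Pi.add_apply, quad_add]
  have := abs_add_le (quad (C.op^[k] A x) v - a * quad (C.op^[k] 1 x) v)
    (quad (C.op^[k] B x) v - b * quad (C.op^[k] 1 x) v)
  have e : quad (C.op^[k] A x) v + quad (C.op^[k] B x) v - (a + b) * quad (C.op^[k] 1 x) v
    = (quad (C.op^[k] A x) v - a * quad (C.op^[k] 1 x) v)
      + (quad (C.op^[k] B x) v - b * quad (C.op^[k] 1 x) v) := by ring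
  rw [e]
  linarith [h1 x v, h2 x v]

lemma HasAvg.smul {A : X → Mat d} {a : ℝ} (c : ℝ) (hA : C.HasAvg A a) :
    C.HasAvg (c • A) (c * a) := by
  intro ε hε
  filter_upwards [hA (ε / (|c| + 1)) (by positivity)] with k h1 x v
  rw [iterate_op_smul, Pi.smul_apply, quad_smul]
  have e : c * quad (C.op^[k] A x) v - c * a * quad (C.op^[k] 1 x) v
    = c * (quad (C.op^[k] A x) v - a * quad (C.op^[k] 1 x) v) := by ring
  rw [e, abs_mul]
  have h2 := h1 x v
  have h3 : 0 ≤ ε / (|c| + 1) * quad (C.op^[k] 1 x) v := (abs_nonneg _).trans h2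
  calc _ ≤ |c| * (ε / (|c| + 1) * quad (C.op^[k] 1 x) v) :=
        mul_le_mul_of_nonneg_left h2 (abs_nonneg _)
    _ ≤ (|c| + 1) * (ε / (|c| + 1) * quad (C.op^[k] 1 x) v) :=
        mul_le_mul_of_nonneg_right (by linarith) h3
    _ = ε * quad (C.op^[k] 1 x) v := by field_simp

lemma HasAvg.sub {A B : X → Mat d} {a b : ℝ} (hA : C.HasAvg A a) (hB : C.HasAvg B b) :
    C.HasAvg (A - B) (a - b) := by
  have := hA.add (hB.smul (-1))
  rwa [neg_one_smul, ← sub_eq_add_neg, neg_one_mul, ← sub_eq_add_neg] at this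

lemma hasAvg_one : C.HasAvg 1 1 := fun ε hε => by
  refine Eventually.of_forall fun k x v => ?_
  have : 0 ≤ quad (C.op^[k] 1 x) v := by
    have h0 : ∀ (x : X) v, quad ((0 : X → Mat d) x) v ≤ quad ((1 : X → Mat d) x) v := fun x v => by
      simpa [quad_zero, quad_one] using dotProduct_self_nonneg' v
    have h1 := C.quad_iterate_op_mono k h0 x v
    have h2 : C.op^[k] (0 : X → Mat d) = 0 := by
      have := C.iterate_op_smul k 0 0
      simpa using this
    rwa [h2, Pi.zero_apply, quad_zero] at h1
  simpa using mul_nonneg hε.le this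

lemma smul_inv_smul_sub {V : Type*} [AddCommGroup V] [Module ℝ V] {t : ℝ} (ht : t ≠ 0)
    (m σ w : ℝ) (R P : V) :
    t⁻¹ • (t • (R - m • P) - σ • w • P) = R - (m + σ * (w / t)) • P := by
  match_scalars <;> field_simp
  ring

lemma smul_inv_smul_sub' {V : Type*} [AddCommGroup V] [Module ℝ V] {t : ℝ} (ht : t ≠ 0)
    (M σ w : ℝ) (R P : V) :
    t⁻¹ • (t • (M • P - R) - σ • w • P) = (M - σ * (w / t)) • P - R := by
  match_scalars <;> field_simp

namespace IsContracting

variable {ρ : X → X → ℝ} {θ b ω K : ℝ} (h : C.IsContracting ρ θ b ω K)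
include h

lemma trace_one_pos (k : ℕ) (z : X) : 0 < (C.op^[k] 1 z).trace := by
  induction k generalizing z with
  | zero =>
    have : (0 : ℝ) < d := by exact_mod_cast h.pos_dim
    simpa using this
  | succ k ih =>
    have hd : (0 : ℝ) < d := by exact_mod_cast h.pos_dim
    rw [Function.iterate_succ_apply']
    have h1 : ∀ v : Fin d → ℝ, quad ((b ^ 2 * (C.op^[k] 1 z).trace) • (1 : Mat d)) v
        ≤ quad (Real.exp K • C.op (C.op^[k] 1) z) v := fun v => by
      rw [quad_smul, quad_smul, quad_one]
      exact h.op_lower (h.inCone_iterate_op h.inCone_one k) z z v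
    have h2 := trace_le_of_quad_le h1
    simp only [Matrix.trace_smul, trace_one_eq, smul_eq_mul] at h2
    have h3 : 0 < b ^ 2 * (C.op^[k] 1 z).trace * d :=
      mul_pos (mul_pos (pow_pos h.b_pos 2) (ih z)) hd
    exact pos_of_mul_pos_right (h3.trans_le h2) (Real.exp_pos K).le

/-- The two remainders R - mP and MP - R stay in the cone, so `exists_comparison` can be applied to
each of them against P. This raises m and lowers M by σ times the trace ratios at z, which add up to
M - m. -/
lemma exists_sandwich : ∃ σ c : ℝ, 0 < σ ∧ σ < 1 ∧ 0 < c ∧ ∀ (A : X → Mat d), InCone ρ K A →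
    ∀ (z : X) (l : ℕ), ∃ m M : ℝ,
      InCone ρ K (C.op^[l + 1] A - m • C.op^[l + 1] 1) ∧
      InCone ρ K (M • C.op^[l + 1] 1 - C.op^[l + 1] A) ∧
      M - m ≤ (1 - σ) ^ l * (c * (A z).trace) := by
  obtain ⟨σ, hσ0, hσ1, hσ⟩ := h.exists_comparison
  have hd : (0 : ℝ) < d := by exact_mod_cast h.pos_dim
  refine ⟨σ, (σ * d)⁻¹, hσ0, hσ1, by positivity, fun A hA z l => ?_⟩
  induction l with
  | zero =>
    have h1 := (hσ A 1 hA h.inCone_one z).smul (inv_nonneg.2 hd.le)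
    have h2 := (hσ 1 A h.inCone_one hA z).smul (inv_nonneg.2 (mul_pos hσ0 hd).le)
    -- The comparison of A with the identity, whose trace is d, in both orders.
    refine ⟨σ * (A z).trace / d, (A z).trace / (σ * d), ?_, ?_, ?_⟩
    · convert h1 using 1
      simp only [Pi.one_apply, trace_one_eq, zero_add, Function.iterate_one, smul_sub, smul_smul]
      rw [inv_mul_cancel₀ hd.ne', one_smul]
      congr 2
      field_simp
    · convert h2 using 1
      simp only [Pi.one_apply, trace_one_eq, zero_add, Function.iterate_one, smul_sub, smul_smul]
      rw [inv_mul_cancel₀ (mul_pos hσ0 hd).ne', one_smul]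
      congr 2
      field_simp
    · have : 0 ≤ σ * (A z).trace / d := by
        have := hA.trace_nonneg z
        positivity
      rw [pow_zero, one_mul, div_eq_inv_mul]
      linarith
  | succ l ih =>
    obtain ⟨m, M, hm, hM, hgap⟩ := ih
    set P := C.op^[l + 1] (1 : X → Mat d) with hP
    set R := C.op^[l + 1] A with hR
    have hPc : InCone ρ K P := h.inCone_iterate_op h.inCone_one (l + 1)
    have hPt : 0 < (P z).trace := h.trace_one_pos (l + 1) z
    have h1 := (hσ _ _ hm hPc z).smul (inv_nonneg.2 hPt.le)
    have h2 := (hσ _ _ hM hPc z).smul (inv_nonneg.2 hPt.le)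
    rw [Function.iterate_succ_apply' C.op (l + 1), Function.iterate_succ_apply' C.op (l + 1),
      ← hP, ← hR]
    refine ⟨m + σ * (((R - m • P) z).trace / (P z).trace),
      M - σ * (((M • P - R) z).trace / (P z).trace), ?_, ?_, ?_⟩
    · rwa [C.op_sub, C.op_smul, smul_inv_smul_sub hPt.ne'] at h1
    · rwa [C.op_sub, C.op_smul, smul_inv_smul_sub' hPt.ne'] at h2
    · have e : M - σ * (((M • P - R) z).trace / (P z).trace)
          - (m + σ * (((R - m • P) z).trace / (P z).trace)) = (1 - σ) * (M - m) := by
        simp only [Pi.sub_apply, Pi.smul_apply, Matrix.trace_sub, Matrix.trace_smul, smul_eq_mul]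
        field_simp
        ring
      rw [e, pow_succ', mul_assoc]
      exact mul_le_mul_of_nonneg_left hgap (by linarith)

/-- Invariance of the cone traps all later trace ratios at a base point between m and M, so they
converge to a common value in all these intervals. The rate is linear in tr A(z), with constants
independent of A: this uniformity is used for the fields Lʲ1 in the construction of the eigenfield.
-/
lemma exists_avg : ∃ σ c : ℝ, 0 < σ ∧ σ < 1 ∧ 0 < c ∧ ∀ (A : X → Mat d), InCone ρ K A →
    ∃ a : ℝ, C.HasAvg A a ∧ ∀ (z : X) (l : ℕ) x v,
      |quad (C.op^[l + 1] A x) v - a * quad (C.op^[l + 1] 1 x) v|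
        ≤ (1 - σ) ^ l * (c * (A z).trace) * quad (C.op^[l + 1] 1 x) v := by
  obtain ⟨σ, c, hσ0, hσ1, hc, hs⟩ := h.exists_sandwich
  refine ⟨σ, c, hσ0, hσ1, hc, fun A hA => ?_⟩
  obtain ⟨z₀⟩ := h.nonempty
  set a : ℕ → ℝ := fun k => (C.op^[k] A z₀).trace / (C.op^[k] 1 z₀).trace with ha
  have hmem : ∀ l m M, InCone ρ K (C.op^[l + 1] A - m • C.op^[l + 1] 1) →
      InCone ρ K (M • C.op^[l + 1] 1 - C.op^[l + 1] A) → ∀ k ≥ l + 1, a k ∈ Set.Icc m M := by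
    intro l m M hm hM k hk
    obtain ⟨j, rfl⟩ := Nat.exists_eq_add_of_le' hk
    have hP := h.trace_one_pos (j + (l + 1)) z₀
    have e1 := (h.inCone_iterate_op hm j).trace_nonneg z₀
    have e2 := (h.inCone_iterate_op hM j).trace_nonneg z₀
    rw [iterate_op_sub, iterate_op_smul, ← Function.iterate_add_apply,
      ← Function.iterate_add_apply] at e1 e2
    simp only [Pi.sub_apply, Pi.smul_apply, Matrix.trace_sub, Matrix.trace_smul,
      smul_eq_mul, sub_nonneg] at e1 e2
    exact ⟨(le_div_iff₀ hP).2 e1, (div_le_iff₀ hP).2 e2⟩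
  have hlim : ∀ z, Tendsto (fun l : ℕ => (1 - σ) ^ l * (c * (A z).trace)) atTop (𝓝 0) := fun z => by
    simpa using (tendsto_pow_atTop_nhds_zero_of_lt_one (by linarith)
      (by linarith : 1 - σ < 1)).mul_const (c * (A z).trace)
  have hcauchy : CauchySeq a := by
    refine Metric.cauchySeq_iff'.2 fun ε hε => ?_
    obtain ⟨l, hl⟩ := ((hlim z₀).eventually (gt_mem_nhds hε)).exists
    obtain ⟨m, M, hm, hM, hgap⟩ := hs A hA z₀ l
    refine ⟨l + 1, fun k hk => ?_⟩
    exact (Real.dist_le_of_mem_Icc (hmem l m M hm hM k hk)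
      (hmem l m M hm hM (l + 1) le_rfl)).trans_lt (hgap.trans_lt hl)
  obtain ⟨a', ha'⟩ := cauchySeq_tendsto_of_complete hcauchy
  have hbound : ∀ (z : X) (l : ℕ) x v,
      |quad (C.op^[l + 1] A x) v - a' * quad (C.op^[l + 1] 1 x) v|
        ≤ (1 - σ) ^ l * (c * (A z).trace) * quad (C.op^[l + 1] 1 x) v := by
    intro z l x v
    obtain ⟨m, M, hm, hM, hgap⟩ := hs A hA z l
    have hq := (h.inCone_iterate_op h.inCone_one (l + 1)).nonneg x v
    have hmM : a' ∈ Set.Icc m M := isClosed_Icc.mem_of_tendsto ha'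
      ((eventually_ge_atTop (l + 1)).mono (hmem l m M hm hM))
    have e1 := hm.nonneg x v
    have e2 := hM.nonneg x v
    rw [Pi.sub_apply, Pi.smul_apply, quad_sub, quad_smul] at e1 e2
    refine le_trans ?_ (mul_le_mul_of_nonneg_right hgap hq)
    rw [abs_le]
    constructor <;> nlinarith [mul_le_mul_of_nonneg_right hmM.1 hq,
      mul_le_mul_of_nonneg_right hmM.2 hq]
  refine ⟨a', fun ε hε => ?_, hbound⟩
  obtain ⟨N, hN⟩ := eventually_atTop.1 ((hlim z₀).eventually (gt_mem_nhds hε))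
  refine eventually_atTop.2 ⟨N + 1, fun k hk x v => ?_⟩
  obtain ⟨l, rfl⟩ := Nat.exists_eq_add_of_le' (Nat.le_of_add_left_le hk)
  exact (hbound z₀ l x v).trans (mul_le_mul_of_nonneg_right (hN l (by omega)).le
    ((h.inCone_iterate_op h.inCone_one (l + 1)).nonneg x v))

lemma exists_hasAvg_of_inCone {A : X → Mat d} (hA : InCone ρ K A) : ∃ a, C.HasAvg A a := by
  obtain ⟨σ, c, -, -, -, hs⟩ := h.exists_avg
  exact ⟨_, (hs A hA).choose_spec.1⟩

lemma quad_iterate_one_nonneg (k : ℕ) (x : X) (v : Fin d → ℝ) : 0 ≤ quad (C.op^[k] 1 x) v :=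
  (h.inCone_iterate_op h.inCone_one k).nonneg x v

lemma abs_trace_ratio_sub_le {A : Mat d} {a ε : ℝ} {k : ℕ} {z : X}
    (hA : ∀ v, |quad A v - a * quad (C.op^[k] 1 z) v| ≤ ε * quad (C.op^[k] 1 z) v) :
    |A.trace / (C.op^[k] 1 z).trace - a| ≤ ε := by
  have hP := h.trace_one_pos k z
  have h1 := trace_le_of_quad_le (A := A) (B := (a + ε) • C.op^[k] 1 z) fun v => by
    rw [quad_smul]
    linarith [(abs_le.1 (hA v)).2]
  have h2 := trace_le_of_quad_le (A := (a - ε) • C.op^[k] 1 z) (B := A) fun v => by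
    rw [quad_smul]
    linarith [(abs_le.1 (hA v)).1]
  rw [Matrix.trace_smul, smul_eq_mul] at h1 h2
  rw [abs_le]
  constructor
  · linarith [(le_div_iff₀ hP).2 h2]
  · linarith [(div_le_iff₀ hP).2 h1]

lemma hasAvg_tendsto {A : X → Mat d} {a : ℝ} (hA : C.HasAvg A a) (z : X) :
    Tendsto (fun k => (C.op^[k] A z).trace / (C.op^[k] 1 z).trace) atTop (𝓝 a) := by
  refine Metric.tendsto_atTop.2 fun ε hε => ?_
  obtain ⟨N, hN⟩ := eventually_atTop.1 (hA (ε / 2) (by positivity))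
  refine ⟨N, fun k hk => ?_⟩
  rw [Real.dist_eq]
  exact (h.abs_trace_ratio_sub_le (hN k hk z)).trans_lt (by linarith)

lemma hasAvg_unique {A : X → Mat d} {a a' : ℝ} (hA : C.HasAvg A a) (hA' : C.HasAvg A a') :
    a = a' := by
  obtain ⟨z⟩ := h.nonempty
  exact tendsto_nhds_unique (h.hasAvg_tendsto hA z) (h.hasAvg_tendsto hA' z)

lemma hasAvg_mono {A B : X → Mat d} {a a' : ℝ} (hA : C.HasAvg A a) (hB : C.HasAvg B a')
    (hAB : ∀ x v, quad (A x) v ≤ quad (B x) v) : a ≤ a' := by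
  obtain ⟨z⟩ := h.nonempty
  refine le_of_tendsto_of_tendsto' (h.hasAvg_tendsto hA z) (h.hasAvg_tendsto hB z) fun k => ?_
  exact div_le_div_of_nonneg_right (trace_le_of_quad_le fun v => C.quad_iterate_op_mono k hAB z v)
    (h.trace_one_pos k z).le

/-- The trace ratio of LᵏLA to Lᵏ1 is that of LᵏL1 to Lᵏ1 times that of Lᵏ⁺¹A to Lᵏ⁺¹1. -/
lemma hasAvg_op {A : X → Mat d} {a a' β : ℝ} (hA : C.HasAvg A a) (hA' : C.HasAvg (C.op A) a')
    (hβ : C.HasAvg (C.op 1) β) : a' = β * a := by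
  obtain ⟨z⟩ := h.nonempty
  refine tendsto_nhds_unique (h.hasAvg_tendsto hA' z) ?_
  refine ((h.hasAvg_tendsto hβ z).mul
    ((h.hasAvg_tendsto hA z).comp (tendsto_add_atTop_nat 1))).congr fun k => ?_
  have h1 := (h.trace_one_pos k z).ne'
  have h2 := (h.trace_one_pos (k + 1) z).ne'
  simp only [Function.comp_apply, Function.iterate_succ_apply] at h2 ⊢
  field_simp

/-- Since L is positive, a bound |A - B| ≤ ε Id propagates to |LᵏA - LᵏB| ≤ ε Lᵏ1 for all k, which
is exactly the scale in which averages are measured. -/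
lemma exists_hasAvg_of_approx {A : X → Mat d}
    (hA : ∀ ε > 0, ∃ B : X → Mat d, (∃ a, C.HasAvg B a) ∧
      ∀ x v, |quad (A x) v - quad (B x) v| ≤ ε * (v ⬝ᵥ v)) : ∃ a, C.HasAvg A a := by
  have key : ∀ ε > 0, ∃ a N, ∀ k ≥ N, ∀ x v,
      |quad (C.op^[k] A x) v - a * quad (C.op^[k] 1 x) v| ≤ ε * quad (C.op^[k] 1 x) v := by
    intro ε hε
    obtain ⟨B, ⟨a, ha⟩, hB⟩ := hA (ε / 2) (by positivity)
    obtain ⟨N, hN⟩ := eventually_atTop.1 (ha (ε / 2) (by positivity))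
    refine ⟨a, N, fun k hk x v => ?_⟩
    have h1 := C.quad_iterate_op_mono k (A := A - B) (B := (ε / 2) • 1) (fun x v => by
      rw [Pi.sub_apply, Pi.smul_apply, quad_sub, quad_smul, Pi.one_apply, quad_one]
      exact (le_abs_self _).trans (hB x v)) x v
    have h2 := C.quad_iterate_op_mono k (A := (-(ε / 2)) • 1) (B := A - B) (fun x v => by
      rw [Pi.sub_apply, Pi.smul_apply, quad_sub, quad_smul, Pi.one_apply, quad_one, neg_mul]
      exact neg_le_of_abs_le (hB x v)) x v
    rw [iterate_op_sub, iterate_op_smul, Pi.sub_apply, Pi.smul_apply, quad_sub, quad_smul] at h1 h2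
    have h3 := abs_le.1 (hN k hk x v)
    rw [abs_le]
    constructor <;> linarith [h3.1, h3.2]
  obtain ⟨z⟩ := h.nonempty
  have hcauchy : CauchySeq fun k => (C.op^[k] A z).trace / (C.op^[k] 1 z).trace := by
    refine Metric.cauchySeq_iff'.2 fun ε hε => ?_
    obtain ⟨a, N, hN⟩ := key (ε / 3) (by positivity)
    refine ⟨N, fun k hk => ?_⟩
    have h1 := abs_le.1 (h.abs_trace_ratio_sub_le (hN k hk z))
    have h2 := abs_le.1 (h.abs_trace_ratio_sub_le (hN N le_rfl z))
    rw [Real.dist_eq, abs_lt]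
    constructor <;> linarith [h1.1, h1.2, h2.1, h2.2]
  obtain ⟨a', ha'⟩ := cauchySeq_tendsto_of_complete hcauchy
  refine ⟨a', fun ε hε => ?_⟩
  obtain ⟨a, N, hN⟩ := key (ε / 2) (by positivity)
  have haa : |a' - a| ≤ ε / 2 :=
    le_of_tendsto ((ha'.sub_const a).abs)
      (eventually_atTop.2 ⟨N, fun k hk => h.abs_trace_ratio_sub_le (hN k hk z)⟩)
  refine eventually_atTop.2 ⟨N, fun k hk x v => ?_⟩
  have h1 := abs_le.1 (hN k hk x v)
  have h2 := abs_le.1 haa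
  have hq := h.quad_iterate_one_nonneg k x v
  rw [abs_le]
  constructor <;> nlinarith [mul_le_mul_of_nonneg_right h2.1 hq,
    mul_le_mul_of_nonneg_right h2.2 hq]

end IsContracting
end Cocycle

/-! ### Density of the Lipschitz fields -/

section Approx

variable {X : Type*} [TopologicalSpace X]

/-- The algebra of the continuous functions that are Lipschitz for a gauge. -/
def gaugeLipschitz [CompactSpace X] (ρ : X → X → ℝ) :
    Subalgebra ℝ C(X, ℝ) where
  carrier := {f | ∃ c : ℝ, ∀ x y, |f x - f y| ≤ c * ρ x y}
  mul_mem' := by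
    rintro f g ⟨c, hc⟩ ⟨c', hc'⟩
    refine ⟨‖f‖ * c' + ‖g‖ * c, fun x y => ?_⟩
    have e : (f * g) x - (f * g) y = f x * (g x - g y) + g y * (f x - f y) := by
      simp only [ContinuousMap.mul_apply]; ring
    have h1 : |f x| ≤ ‖f‖ := f.norm_coe_le_norm x
    have h2 : |g y| ≤ ‖g‖ := g.norm_coe_le_norm y
    rw [e]
    refine (abs_add_le _ _).trans ?_
    rw [abs_mul, abs_mul]
    have h3 := mul_le_mul h1 (hc' x y) (abs_nonneg _) (norm_nonneg f)
    have h4 := mul_le_mul h2 (hc x y) (abs_nonneg _) (norm_nonneg g)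
    linarith
  add_mem' := by
    rintro f g ⟨c, hc⟩ ⟨c', hc'⟩
    refine ⟨c + c', fun x y => ?_⟩
    have e : (f + g) x - (f + g) y = (f x - f y) + (g x - g y) := by
      simp only [ContinuousMap.add_apply]; ring
    rw [e]
    linarith [abs_add_le (f x - f y) (g x - g y), hc x y, hc' x y]
  algebraMap_mem' r := ⟨0, fun x y => by simp⟩

lemma exists_gaugeLipschitz_near [CompactSpace X] {ρ : X → X → ℝ} (hρ : ∀ x y, 0 ≤ ρ x y)
    (hsep : ∀ x y, x ≠ y → ∃ g : X → ℝ, Continuous g ∧ (∃ c : ℝ, ∀ x y, |g x - g y| ≤ c * ρ x y) ∧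
      g x ≠ g y) {f : X → ℝ} (hf : Continuous f) {ε : ℝ} (hε : 0 < ε) :
    ∃ g : X → ℝ, Continuous g ∧ (∃ c : ℝ, 0 ≤ c ∧ ∀ x y, |g x - g y| ≤ c * ρ x y) ∧
      ∀ x, |f x - g x| ≤ ε := by
  obtain ⟨g, hg⟩ := ContinuousMap.exists_mem_subalgebra_near_continuous_of_separatesPoints
    (gaugeLipschitz ρ) (fun x y hxy => by
      obtain ⟨g, hg, hc, hne⟩ := hsep x y hxy
      exact ⟨g, ⟨⟨g, hg⟩, hc, rfl⟩, hne⟩) f hf ε hε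
  obtain ⟨c, hc⟩ := g.2
  refine ⟨g.1, g.1.continuous, ⟨|c|, abs_nonneg c, fun x y => (hc x y).trans
    (mul_le_mul_of_nonneg_right (le_abs_self c) (hρ x y))⟩, fun x => ?_⟩
  rw [abs_sub_comm]
  exact (hg x).le

lemma exists_lipschitz_field_near [CompactSpace X] {d : ℕ} {ρ : X → X → ℝ}
    (hρ : ∀ x y, 0 ≤ ρ x y)
    (hsep : ∀ x y, x ≠ y → ∃ g : X → ℝ, Continuous g ∧ (∃ c : ℝ, ∀ x y, |g x - g y| ≤ c * ρ x y) ∧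
      g x ≠ g y) {A : X → Mat d} (hA : IsField A) {ε : ℝ} (hε : 0 < ε) :
    ∃ B : X → Mat d, IsField B ∧
      (∃ c : ℝ, 0 ≤ c ∧ ∀ x y v, quad (B x) v - quad (B y) v ≤ c * ρ x y * (v ⬝ᵥ v)) ∧
      ∀ x v, |quad (A x) v - quad (B x) v| ≤ ε * (v ⬝ᵥ v) := by
  -- Passing from entries to quadratic forms loses a factor d.
  have hε' : 0 < ε / (d + 1) := by positivity
  choose g hg hc hnear using fun i j =>
    exists_gaugeLipschitz_near hρ hsep (hA.continuous_entry i j) hε'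
  choose c hc0 hc using hc
  set c' := ∑ i, ∑ j, c i j with hc'
  have hcle : ∀ i j, c i j ≤ c' := fun i j =>
    (Finset.single_le_sum (f := fun j => c i j) (fun _ _ => hc0 _ _) (Finset.mem_univ j)).trans
      (Finset.single_le_sum (f := fun i => ∑ j, c i j)
        (fun _ _ => Finset.sum_nonneg fun _ _ => hc0 _ _) (Finset.mem_univ i))
  have hc'0 : 0 ≤ c' := Finset.sum_nonneg fun _ _ => Finset.sum_nonneg fun _ _ => hc0 _ _
  -- The entries are approximated independently, so symmetry has to be restored.
  let B : X → Mat d := fun x => Matrix.of fun i j => (g i j x + g j i x) / 2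
  refine ⟨B, ⟨?_, fun x => ?_⟩, ⟨c' * d, by positivity, fun x y v => ?_⟩, fun x v => ?_⟩
  · exact continuous_matrix fun i j => ((hg i j).add (hg j i)).div_const 2
  · ext i j
    simp only [B, Matrix.transpose_apply, Matrix.of_apply]
    ring
  · rw [← quad_sub]
    have := abs_quad_le_of_entry (A := B x - B y) (c := c' * ρ x y)
      (mul_nonneg hc'0 (hρ x y)) (fun i j => ?_) v
    · refine (le_abs_self _).trans (this.trans (le_of_eq (by ring)))
    · have h1 := abs_le.1 ((hc i j x y).trans (mul_le_mul_of_nonneg_right (hcle i j) (hρ x y)))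
      have h2 := abs_le.1 ((hc j i x y).trans (mul_le_mul_of_nonneg_right (hcle j i) (hρ x y)))
      simp only [B, Matrix.sub_apply, Matrix.of_apply]
      rw [abs_le]
      constructor <;> linarith [h1.1, h1.2, h2.1, h2.2]
  · rw [← quad_sub]
    have := abs_quad_le_of_entry (A := A x - B x) (c := ε / (d + 1)) hε'.le (fun i j => ?_) v
    · refine this.trans (mul_le_mul_of_nonneg_right ?_ (dotProduct_self_nonneg' v))
      rw [div_mul_eq_mul_div, div_le_iff₀ (by positivity)]
      nlinarith
    · have h1 := abs_le.1 (hnear i j x)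
      have h2 := abs_le.1 (hnear j i x)
      have h3 := (hA.isSymm x).apply i j
      simp only [B, Matrix.sub_apply, Matrix.of_apply]
      rw [abs_le]
      constructor <;> linarith [h1.1, h1.2, h2.1, h2.2]

/-- The constant a makes the field non-negative, and c/K more makes its form at least (c/K)|v|². A
variation of cρ|v|² is then at most Kρ times the form. Thus every Lipschitz field is a difference of
two elements of the cone. -/
lemma inCone_add_const {d : ℕ} {ρ : X → X → ℝ} (hρ : ∀ x y, 0 ≤ ρ x y) {K : ℝ} (hK : 0 < K)
    {B : X → Mat d} (hB : IsField B) {a c : ℝ} (hc : 0 ≤ c)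
    (ha : ∀ x v, |quad (B x) v| ≤ a * (v ⬝ᵥ v))
    (hL : ∀ x y v, quad (B x) v - quad (B y) v ≤ c * ρ x y * (v ⬝ᵥ v)) :
    InCone ρ K (B + (a + c / K) • (1 : X → Mat d)) := by
  have hq : ∀ x v, quad ((B + (a + c / K) • (1 : X → Mat d)) x) v
      = quad (B x) v + (a + c / K) * (v ⬝ᵥ v) := fun x v => by
    rw [Pi.add_apply, Pi.smul_apply, quad_add, quad_smul, Pi.one_apply, quad_one]
  have hlow : ∀ x v, c / K * (v ⬝ᵥ v) ≤ quad (B x) v + (a + c / K) * (v ⬝ᵥ v) := fun x v => by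
    linarith [(abs_le.1 (ha x v)).1]
  have hcK : 0 ≤ c / K := div_nonneg hc hK.le
  refine ⟨hB.add (isField_one.smul _), fun x v => ?_, fun x y v => ?_⟩
  · rw [hq]
    exact (mul_nonneg hcK (dotProduct_self_nonneg' v)).trans (hlow x v)
  · rw [hq, hq]
    have hv := dotProduct_self_nonneg' v
    have h1 := Real.add_one_le_exp (K * ρ x y)
    have h2 := hlow y v
    have h3 : 0 ≤ K * ρ x y := mul_nonneg hK.le (hρ x y)
    have h4 : K * ρ x y * (c / K * (v ⬝ᵥ v)) = c * ρ x y * (v ⬝ᵥ v) := by field_simp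
    have h5 := mul_le_mul_of_nonneg_left h2 h3
    have h6 : 0 ≤ quad (B y) v + (a + c / K) * (v ⬝ᵥ v) := (mul_nonneg hcK hv).trans h2
    nlinarith [mul_le_mul_of_nonneg_right h1 h6, hL x y v]

end Approx

/-! ### Averages of all continuous fields -/

namespace Cocycle.IsContracting

variable {X : Type*} [TopologicalSpace X] {ι : Type*} [Fintype ι] {d : ℕ} {C : Cocycle X ι d}
  {ρ : X → X → ℝ} {θ b ω K : ℝ} (h : C.IsContracting ρ θ b ω K)
include h

lemma exists_hasAvg [CompactSpace X]
    (hsep : ∀ x y, x ≠ y → ∃ g : X → ℝ, Continuous g ∧ (∃ c : ℝ, ∀ x y, |g x - g y| ≤ c * ρ x y) ∧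
      g x ≠ g y) {A : X → Mat d} (hA : IsField A) : ∃ a, C.HasAvg A a := by
  have hK : 0 < K := by
    have := h.gap
    have := mul_nonneg h.K_nonneg h.theta_nonneg
    linarith
  refine h.exists_hasAvg_of_approx fun ε hε => ?_
  obtain ⟨B, hB, ⟨c, hc, hL⟩, hnear⟩ := exists_lipschitz_field_near h.nonneg hsep hA hε
  obtain ⟨a, -, ha⟩ := hB.exists_bound
  obtain ⟨a', ha'⟩ := h.exists_hasAvg_of_inCone (inCone_add_const h.nonneg hK hB hc ha hL)
  have hB' := ha'.sub (hasAvg_one.smul (a + c / K))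
  rw [add_sub_cancel_right] at hB'
  exact ⟨B, ⟨_, hB'⟩, hnear⟩

end Cocycle.IsContracting

/-- `β` and `Q` are the leading eigenvalue and eigenfunction of the Ruelle operator, and the
normalised iterates of the operator converge uniformly to the projection `A ↦ ℓ A • Q`. -/
structure Cocycle.IsPerron {X : Type*} [TopologicalSpace X] {ι : Type*} [Fintype ι] {d : ℕ}
    (C : Cocycle X ι d) (β : ℝ) (Q : X → Mat d) (ℓ : (X → Mat d) → ℝ) : Prop where
  pos : 0 < β
  isField : IsField Q
  lower : ∃ c > 0, ∀ x v, c * (v ⬝ᵥ v) ≤ quad (Q x) v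
  eigen : C.op Q = β • Q
  apply_one : ℓ 1 = 1
  apply_eigen : ℓ Q = 1
  add : ∀ A B, IsField A → IsField B → ℓ (A + B) = ℓ A + ℓ B
  smul : ∀ (c : ℝ) A, IsField A → ℓ (c • A) = c * ℓ A
  mono : ∀ A B, IsField A → IsField B → (∀ x v, quad (A x) v ≤ quad (B x) v) → ℓ A ≤ ℓ B
  apply_op : ∀ A, IsField A → ℓ (C.op A) = β * ℓ A
  tendsto : ∀ A, IsField A → ∀ ε > 0, ∀ᶠ k in atTop, ∀ x v,
    |quad (C.op^[k] A x) v - β ^ k * ℓ A * quad (Q x) v| ≤ ε * β ^ k * (v ⬝ᵥ v)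

lemma continuous_quad {d : ℕ} (v : Fin d → ℝ) : Continuous fun A : Mat d => quad A v := by
  unfold quad
  exact continuous_const.dotProduct (continuous_id.matrix_mulVec continuous_const)

/-! ### The leading eigenfield and the spectral gap -/

namespace Cocycle.IsContracting

variable {X : Type*} [TopologicalSpace X] {ι : Type*} [Fintype ι] {d : ℕ} {C : Cocycle X ι d}
  {ρ : X → X → ℝ} {θ b ω K : ℝ} (h : C.IsContracting ρ θ b ω K)
include h

/-- If the averages of all fields exist, the normalised iterates of the identity converge. -/
lemma exists_eigenfield {ℓ : (X → Mat d) → ℝ} (hℓ : ∀ A, IsField A → C.HasAvg A (ℓ A)) :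
    0 < ℓ (C.op 1) ∧ ∃ Q : X → Mat d, IsField Q ∧ (∃ c > 0, ∀ x v, c * (v ⬝ᵥ v) ≤ quad (Q x) v) ∧
      C.op Q = ℓ (C.op 1) • Q ∧
      (∃ c > 0, ∀ k x v, quad (C.op^[k] 1 x) v ≤ c * ℓ (C.op 1) ^ k * (v ⬝ᵥ v)) ∧
      (∀ ε > 0, ∀ᶠ k in atTop, ∀ x v,
        |quad (C.op^[k] 1 x) v - ℓ (C.op 1) ^ k * quad (Q x) v| ≤ ε * ℓ (C.op 1) ^ k * (v ⬝ᵥ v)) := by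
  set β := ℓ (C.op 1) with hβ
  have hd : (0 : ℝ) < d := by exact_mod_cast h.pos_dim
  have hn : (0 : ℝ) < Fintype.card ι := by exact_mod_cast h.card_pos
  have hb := pow_pos h.b_pos 2
  have hE := Real.exp_pos K
  have hPc : ∀ k, InCone ρ K (C.op^[k] (1 : X → Mat d)) := h.inCone_iterate_op h.inCone_one
  have hPℓ : ∀ k, C.HasAvg (C.op^[k] 1) (ℓ (C.op^[k] 1)) := fun k => hℓ _ (hPc k).toIsField
  have hpow : ∀ k, ℓ (C.op^[k] 1) = β ^ k := by
    intro k
    induction k with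
    | zero => exact h.hasAvg_unique (hPℓ 0) hasAvg_one
    | succ k ih =>
      have := h.hasAvg_op (hPℓ k)
        (by simpa only [Function.iterate_succ_apply'] using hPℓ (k + 1)) (hPℓ 1)
      simpa only [Function.iterate_succ_apply', ih, pow_succ', Function.iterate_zero, id_eq]
        using this
  -- The averages are monotone, so taking averages in `op_lower`, and then in `op_upper`, shows that
  -- tr Lᵏ1 has exactly the order of βᵏ, at every point.
  have hP1 : ∀ k z, b ^ 2 * (C.op^[k] 1 z).trace ≤ Real.exp K * β ^ (k + 1) := by
    intro k z
    have h1 := h.hasAvg_mono (hasAvg_one.smul (b ^ 2 * (C.op^[k] 1 z).trace))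
      ((hPℓ (k + 1)).smul (Real.exp K)) (fun x v => by
        rw [Pi.smul_apply, Pi.smul_apply, quad_smul, quad_smul, Pi.one_apply, quad_one,
          Function.iterate_succ_apply']
        exact h.op_lower (hPc k) x z v)
    rwa [mul_one, hpow] at h1
  have hP2 : ∀ k z, β ^ (k + 1) ≤ Fintype.card ι * Real.exp K * (C.op^[k] 1 z).trace := by
    intro k z
    have h1 := h.hasAvg_mono (hPℓ (k + 1))
      (hasAvg_one.smul (Fintype.card ι * Real.exp K * (C.op^[k] 1 z).trace)) (fun x v => by
        rw [Pi.smul_apply, quad_smul, Pi.one_apply, quad_one, Function.iterate_succ_apply']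
        exact h.op_upper (hPc k) x z v)
    rwa [mul_one, hpow] at h1
  obtain ⟨z⟩ := h.nonempty
  have hβ0 : 0 < β := by
    have h1 := hP1 0 z
    have h2 := mul_pos hb (h.trace_one_pos 0 z)
    rw [zero_add, pow_one] at h1
    exact pos_of_mul_pos_right (h2.trans_le h1) hE.le
  refine ⟨hβ0, ?_⟩
  set c₁ : ℝ := Real.exp K * β / b ^ 2 with hc₁
  have hc₁0 : 0 < c₁ := by positivity
  have htr : ∀ k x, (C.op^[k] 1 x).trace ≤ c₁ * β ^ k := fun k x => by
    rw [hc₁, div_mul_eq_mul_div, le_div_iff₀ hb]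
    have := hP1 k x
    rw [pow_succ β k] at this
    linarith
  have hup : ∀ k x v, quad (C.op^[k] 1 x) v ≤ c₁ * β ^ k * (v ⬝ᵥ v) := fun k x v =>
    (quad_le_trace ((hPc k).posSemidef x) v).trans
      (mul_le_mul_of_nonneg_right (htr k x) (dotProduct_self_nonneg' v))
  obtain ⟨σ, c, hσ0, hσ1, hc, hs⟩ := h.exists_avg
  set q : ℝ := 1 - σ with hq
  have hq0 : 0 < q := by linarith
  set c₃ : ℝ := c * c₁ * c₁ with hc₃
  let R : ℕ → X → Mat d := fun k => (β ^ k)⁻¹ • C.op^[k] 1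
  have hRf : ∀ k, IsField (R k) := fun k => (hPc k).toIsField.smul _
  have hR : ∀ k x v, quad (R k x) v = (β ^ k)⁻¹ * quad (C.op^[k] 1 x) v := fun k x v => by
    simp only [R, Pi.smul_apply, quad_smul]
  -- The estimate of `exists_avg` for the field Lʲ1, of average βʲ. Its trace is at most c₁βʲ, so
  -- after division by the power of β the bound no longer depends on j and the normalised iterates
  -- are uniformly Cauchy.
  have hdist : ∀ j l x v, |quad (R (l + 1 + j) x) v - quad (R (l + 1) x) v|
      ≤ c₃ * q ^ l * (v ⬝ᵥ v) := by
    intro j l x v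
    obtain ⟨a, ha, hbd⟩ := hs _ (hPc j)
    have haj : a = β ^ j := (h.hasAvg_unique ha (hPℓ j)).trans (hpow j)
    have h1 := hbd z l x v
    rw [haj, ← Function.iterate_add_apply] at h1
    have hβj := pow_pos hβ0 (l + 1 + j)
    have e : quad (R (l + 1 + j) x) v - quad (R (l + 1) x) v
        = (β ^ (l + 1 + j))⁻¹ *
          (quad (C.op^[l + 1 + j] 1 x) v - β ^ j * quad (C.op^[l + 1] 1 x) v) := by
      rw [hR, hR, pow_add β (l + 1) j]
      field_simp
    rw [e, abs_mul, abs_of_pos (inv_pos.2 hβj), ← div_eq_inv_mul, div_le_iff₀ hβj]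
    refine h1.trans ?_
    have h2 := hup (l + 1) x v
    have h3 : q ^ l * (c * (C.op^[j] 1 z).trace) ≤ q ^ l * (c * (c₁ * β ^ j)) := by
      have := htr j z
      gcongr
    refine (mul_le_mul h3 h2 ((hPc (l + 1)).nonneg x v) (by positivity)).trans (le_of_eq ?_)
    rw [pow_add β (l + 1) j, hc₃]
    ring
  have hentry : ∀ j l x i i', |R (l + 1 + j) x i i' - R (l + 1) x i i'| ≤ 3 * (c₃ * q ^ l) := by
    intro j l x i i'
    refine abs_entry_le_of_quad (A := R (l + 1 + j) x - R (l + 1) x) ?_ (fun v => ?_) i i'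
    · exact ((hRf _).isSymm x).sub ((hRf _).isSymm x)
    · rw [quad_sub]
      exact hdist j l x v
  have hql : Tendsto (fun l : ℕ => q ^ l) atTop (𝓝 0) :=
    tendsto_pow_atTop_nhds_zero_of_lt_one hq0.le (by linarith)
  have hql' : ∀ a : ℝ, Tendsto (fun l : ℕ => a * q ^ l) atTop (𝓝 0) := fun a => by
    simpa using hql.const_mul a
  have hlim : ∀ x i i', ∃ y, Tendsto (fun k => R k x i i') atTop (𝓝 y) := by
    intro x i i'
    refine cauchySeq_tendsto_of_complete (Metric.cauchySeq_iff'.2 fun ε hε => ?_)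
    obtain ⟨l, hl⟩ := ((hql' (3 * c₃)).eventually (gt_mem_nhds hε)).exists
    refine ⟨l + 1, fun k hk => ?_⟩
    obtain ⟨j, rfl⟩ := Nat.exists_eq_add_of_le hk
    rw [Real.dist_eq]
    refine (hentry j l x i i').trans_lt ?_
    rwa [← mul_assoc]
  choose Q hQ using hlim
  have hQm : ∀ x, Tendsto (fun k => R k x) atTop (𝓝 (Matrix.of (Q x))) := fun x =>
    tendsto_pi_nhds.2 fun i => tendsto_pi_nhds.2 fun i' => hQ x i i'
  have hQq : ∀ x v, Tendsto (fun k => quad (R k x) v) atTop (𝓝 (quad (Matrix.of (Q x)) v)) :=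
    fun x v => ((continuous_quad v).tendsto _).comp (hQm x)
  have hQd : ∀ l x v, |quad (R (l + 1) x) v - quad (Matrix.of (Q x)) v|
      ≤ c₃ * q ^ l * (v ⬝ᵥ v) := by
    intro l x v
    rw [abs_sub_comm]
    refine le_of_tendsto ((((hQq x v).comp (tendsto_add_atTop_nat (l + 1))).sub_const _).abs)
      (Eventually.of_forall fun j => ?_)
    rw [Function.comp_apply, add_comm]
    exact hdist j l x v
  have hQe : ∀ l x i i', |R (l + 1) x i i' - Q x i i'| ≤ 3 * c₃ * q ^ l := by
    intro l x i i'
    rw [abs_sub_comm, mul_assoc]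
    refine le_of_tendsto ((((hQ x i i').comp (tendsto_add_atTop_nat (l + 1))).sub_const _).abs)
      (Eventually.of_forall fun j => ?_)
    rw [Function.comp_apply, add_comm]
    exact hentry j l x i i'
  refine ⟨fun x => Matrix.of (Q x), ⟨?_, fun x => ?_⟩, ?_, ?_, ⟨c₁, hc₁0, hup⟩, ?_⟩
  · refine continuous_matrix fun i i' => ?_
    have hu : TendstoUniformly (fun l x => R (l + 1) x i i') (fun x => Q x i i') atTop := by
      refine Metric.tendstoUniformly_iff.2 fun ε hε => ?_
      filter_upwards [(hql' (3 * c₃)).eventually (gt_mem_nhds hε)] with l hl x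
      rw [dist_comm, Real.dist_eq]
      exact (hQe l x i i').trans_lt hl
    exact hu.continuous (Frequently.of_forall fun l => (hRf (l + 1)).continuous_entry i i')
  · ext i i'
    exact tendsto_nhds_unique ((hQ x i' i).congr fun k => ((hRf k).isSymm x).apply i i') (hQ x i i')
  · refine ⟨b ^ 2 / Real.exp K * (β / (Fintype.card ι * Real.exp K)) / β, by positivity,
      fun x v => ?_⟩
    refine ge_of_tendsto ((hQq x v).comp (tendsto_add_atTop_nat 1))
      (Eventually.of_forall fun k => ?_)
    rw [Function.comp_apply, hR, Function.iterate_succ_apply']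
    have h1 := h.op_lower (hPc k) x x v
    have h2 := hP2 k x
    have hβk := pow_pos hβ0 k
    have hv := dotProduct_self_nonneg' v
    have h3 : b ^ 2 * (β ^ (k + 1) / (Fintype.card ι * Real.exp K)) * (v ⬝ᵥ v)
        ≤ Real.exp K * quad (C.op (C.op^[k] 1) x) v := by
      refine le_trans ?_ h1
      gcongr
      rw [div_le_iff₀ (by positivity)]
      linarith
    rw [← div_eq_inv_mul, le_div_iff₀ (pow_pos hβ0 _)]
    refine le_of_mul_le_mul_left ((le_of_eq ?_).trans h3) hE
    field_simp
  · funext x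
    have h1 : Tendsto (fun k => C.op (R k) x) atTop (𝓝 (C.op (fun x => Matrix.of (Q x)) x)) := by
      refine tendsto_finsetSum _ fun i _ => ?_
      have hc : Continuous fun M : Mat d => (C.D i x)ᵀ * M * C.D i x :=
        (continuous_const.matrix_mul continuous_id).matrix_mul continuous_const
      exact (hc.tendsto _).comp (hQm (C.s i x))
    refine tendsto_nhds_unique h1 ?_
    refine (((hQm x).comp (tendsto_add_atTop_nat 1)).const_smul β).congr fun k => ?_
    simp only [R, Function.comp_apply, Function.iterate_succ_apply', op_smul, Pi.smul_apply,
      smul_smul, pow_succ]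
    congr 1
    have := pow_pos hβ0 k
    field_simp
  · intro ε hε
    obtain ⟨N, hN⟩ := eventually_atTop.1 ((hql' c₃).eventually (gt_mem_nhds hε))
    refine eventually_atTop.2 ⟨N + 1, fun k hk x v => ?_⟩
    obtain ⟨l, rfl⟩ := Nat.exists_eq_add_of_le' (Nat.le_of_add_left_le hk)
    have hβk := pow_pos hβ0 (l + 1)
    have e : quad (C.op^[l + 1] 1 x) v - β ^ (l + 1) * quad (Matrix.of (Q x)) v
        = β ^ (l + 1) * (quad (R (l + 1) x) v - quad (Matrix.of (Q x)) v) := by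
      rw [hR]
      field_simp
    rw [e, abs_mul, abs_of_pos hβk]
    have h1 := (hQd l x v).trans (mul_le_mul_of_nonneg_right (hN l (by omega)).le
      (dotProduct_self_nonneg' v))
    calc _ ≤ β ^ (l + 1) * (ε * (v ⬝ᵥ v)) := mul_le_mul_of_nonneg_left h1 hβk.le
      _ = _ := by ring

theorem exists_isPerron {ℓ : (X → Mat d) → ℝ} (hℓ : ∀ A, IsField A → C.HasAvg A (ℓ A)) :
    ∃ β Q, C.IsPerron β Q ℓ := by
  obtain ⟨hβ0, Q, hQ, hlow, heig, ⟨c, hc, hup⟩, hconv⟩ := h.exists_eigenfield hℓ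
  set β := ℓ (C.op 1) with hβ
  have htend : ∀ A, IsField A → ∀ ε > 0, ∀ᶠ k in atTop, ∀ x v,
      |quad (C.op^[k] A x) v - β ^ k * ℓ A * quad (Q x) v| ≤ ε * β ^ k * (v ⬝ᵥ v) := by
    intro A hA ε hε
    filter_upwards [hℓ A hA (ε / (2 * c)) (by positivity),
      hconv (ε / (2 * (|ℓ A| + 1))) (by positivity)] with k h1 h2 x v
    have hβk := pow_pos hβ0 k
    have hv := dotProduct_self_nonneg' v
    have e1 : |quad (C.op^[k] A x) v - ℓ A * quad (C.op^[k] 1 x) v|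
        ≤ ε / 2 * (β ^ k * (v ⬝ᵥ v)) := by
      refine (h1 x v).trans ((mul_le_mul_of_nonneg_left (hup k x v) (by positivity)).trans
        (le_of_eq ?_))
      field_simp
    have e2 : |ℓ A| * |quad (C.op^[k] 1 x) v - β ^ k * quad (Q x) v|
        ≤ ε / 2 * (β ^ k * (v ⬝ᵥ v)) := by
      calc _ ≤ (|ℓ A| + 1) * (ε / (2 * (|ℓ A| + 1)) * β ^ k * (v ⬝ᵥ v)) :=
            mul_le_mul (by linarith) (h2 x v) (abs_nonneg _) (by positivity)
        _ = _ := by field_simp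
    have e3 : quad (C.op^[k] A x) v - β ^ k * ℓ A * quad (Q x) v
        = (quad (C.op^[k] A x) v - ℓ A * quad (C.op^[k] 1 x) v)
          + ℓ A * (quad (C.op^[k] 1 x) v - β ^ k * quad (Q x) v) := by ring
    rw [e3]
    refine (abs_add_le _ _).trans ?_
    rw [abs_mul]
    linarith
  obtain ⟨z⟩ := h.nonempty
  refine ⟨β, Q, hβ0, hQ, hlow, heig, h.hasAvg_unique (hℓ _ isField_one) hasAvg_one, ?_, ?_, ?_, ?_,
    ?_, htend⟩
  -- On Q the convergence reads |1 - ℓ(Q)| Q ≤ ε for every ε, and Q is positive on a basis vector,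
  -- which exists because d > 0.
  · have hit : ∀ k, C.op^[k] Q = β ^ k • Q := by
      intro k
      induction k with
      | zero => simp
      | succ k ih => rw [Function.iterate_succ_apply', ih, C.op_smul, heig, smul_smul, pow_succ]
    set v : Fin d → ℝ := Pi.single ⟨0, h.pos_dim⟩ 1 with hv
    have hvv : v ⬝ᵥ v = 1 := by simp [hv]
    obtain ⟨c', hc', hlow⟩ := hlow
    have hq : 0 < quad (Q z) v := by
      have := hlow z v
      rw [hvv] at this
      linarith
    have h0 : |1 - ℓ Q| * quad (Q z) v ≤ 0 := by
      refine le_of_forall_pos_le_add fun ε hε => ?_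
      obtain ⟨k, hk⟩ := (htend Q hQ ε hε).exists
      have h1 := hk z v
      have hβk := pow_pos hβ0 k
      rw [hit, Pi.smul_apply, quad_smul, hvv] at h1
      have e : β ^ k * quad (Q z) v - β ^ k * ℓ Q * quad (Q z) v
          = β ^ k * ((1 - ℓ Q) * quad (Q z) v) := by ring
      rw [e, abs_mul, abs_mul, abs_of_pos hβk, abs_of_pos hq] at h1
      refine le_of_mul_le_mul_left ?_ hβk
      linarith
    have h1 : |1 - ℓ Q| ≤ 0 := le_of_mul_le_mul_right (by simpa using h0) hq
    have := abs_nonpos_iff.1 h1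
    linarith
  · exact fun A B hA hB => h.hasAvg_unique (hℓ _ (hA.add hB)) ((hℓ A hA).add (hℓ B hB))
  · exact fun c A hA => h.hasAvg_unique (hℓ _ (hA.smul c)) ((hℓ A hA).smul c)
  · exact fun A B hA hB hAB => h.hasAvg_mono (hℓ A hA) (hℓ B hB) hAB
  · exact fun A hA => h.hasAvg_op (hℓ A hA) (hℓ _ (C.isField_op hA)) (hℓ _ (C.isField_op isField_one))

end Cocycle.IsContracting

lemma exists_norm_le_of_entry (d : ℕ) : ∃ C : ℝ≥0, ∀ (M : Mat d) (c : ℝ),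
    (∀ i j, |M i j| ≤ c) → ‖M‖ ≤ C * c := by
  refine ⟨∑ i : Fin d, ∑ j : Fin d, ‖(Matrix.single i j 1 : Mat d)‖₊, fun M c hM => ?_⟩
  have hM' : M = ∑ i : Fin d, ∑ j : Fin d, M i j • (Matrix.single i j 1 : Mat d) := by
    conv_lhs => rw [Matrix.matrix_eq_sum_single M]
    simp [Matrix.smul_single]
  push_cast
  rw [Finset.sum_mul]
  calc ‖M‖ = ‖∑ i : Fin d, ∑ j : Fin d, M i j • (Matrix.single i j 1 : Mat d)‖ := by rw [← hM']
    _ ≤ _ := by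
      refine (norm_sum_le _ _).trans (Finset.sum_le_sum fun i _ => ?_)
      rw [Finset.sum_mul]
      refine (norm_sum_le _ _).trans (Finset.sum_le_sum fun j _ => ?_)
      rw [norm_smul, mul_comm]
      exact mul_le_mul_of_nonneg_left (hM i j) (norm_nonneg _)

/-- A bounded measurable matrix field. -/
structure IsBdd {X : Type*} [MeasurableSpace X] {d : ℕ} (A : X → Mat d) : Prop where
  measurable : ∀ i j, Measurable fun x => A x i j
  bounded : ∃ c : ℝ, ∀ x i j, |A x i j| ≤ c

/-! ### Bounded Borel matrix fields -/

section IsBdd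

variable {X : Type*} [MeasurableSpace X] {d : ℕ} {A B : X → Mat d}

lemma IsBdd.exists_nonneg (hA : IsBdd A) : ∃ c : ℝ, 0 ≤ c ∧ ∀ x i j, |A x i j| ≤ c := by
  obtain ⟨c, hc⟩ := hA.2
  exact ⟨|c|, abs_nonneg c, fun x i j => (hc x i j).trans (le_abs_self c)⟩

lemma IsBdd.stronglyMeasurable (hA : IsBdd A) : StronglyMeasurable A := by
  have hA' : A = fun x => ∑ i : Fin d, ∑ j : Fin d, A x i j • (Matrix.single i j 1 : Mat d) := by
    funext x
    conv_lhs => rw [Matrix.matrix_eq_sum_single (A x)]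
    simp [Matrix.smul_single]
  rw [hA']
  exact Finset.stronglyMeasurable_fun_sum _ fun i _ => Finset.stronglyMeasurable_fun_sum _
    fun j _ => (hA.1 i j).stronglyMeasurable.smul_const _

lemma IsBdd.exists_norm_le (hA : IsBdd A) : ∃ c : ℝ, ∀ x, ‖A x‖ ≤ c := by
  obtain ⟨C, hC⟩ := exists_norm_le_of_entry d
  obtain ⟨c, hc⟩ := hA.2
  exact ⟨C * c, fun x => hC _ _ (hc x)⟩

lemma IsBdd.add (hA : IsBdd A) (hB : IsBdd B) : IsBdd (A + B) := by
  obtain ⟨a, ha⟩ := hA.2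
  obtain ⟨b, hb⟩ := hB.2
  exact ⟨fun i j => (hA.1 i j).add (hB.1 i j), a + b, fun x i j =>
    (abs_add_le _ _).trans (add_le_add (ha x i j) (hb x i j))⟩

lemma IsBdd.smul_fun {f : X → ℝ} (hf : Measurable f) {c : ℝ} (hc : ∀ x, |f x| ≤ c)
    (hA : IsBdd A) : IsBdd (fun x => f x • A x) := by
  obtain ⟨a, ha0, ha⟩ := hA.exists_nonneg
  refine ⟨fun i j => hf.mul (hA.1 i j), c * a, fun x i j => ?_⟩
  rw [Matrix.smul_apply, smul_eq_mul, abs_mul]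
  exact mul_le_mul (hc x) (ha x i j) (abs_nonneg _) ((abs_nonneg _).trans (hc x))

lemma IsBdd.smul (c : ℝ) (hA : IsBdd A) : IsBdd (c • A) :=
  hA.smul_fun (f := fun _ => c) measurable_const (fun _ => le_rfl)

lemma IsBdd.sub (hA : IsBdd A) (hB : IsBdd B) : IsBdd (A - B) := by
  have := hA.add (hB.smul (-1))
  rwa [neg_one_smul, ← sub_eq_add_neg] at this

lemma isBdd_const (M : Mat d) : IsBdd (fun _ : X => M) :=
  ⟨fun _ _ => measurable_const, ∑ i, ∑ j, |M i j|, fun _ i j =>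
    (Finset.single_le_sum (f := fun j => |M i j|) (fun _ _ => abs_nonneg _)
      (Finset.mem_univ j)).trans
    (Finset.single_le_sum (f := fun i => ∑ j, |M i j|)
      (fun _ _ => Finset.sum_nonneg fun _ _ => abs_nonneg _) (Finset.mem_univ i))⟩

lemma IsBdd.sum {ι : Type*} (s : Finset ι) {A : ι → X → Mat d} (hA : ∀ i ∈ s, IsBdd (A i)) :
    IsBdd (fun x => ∑ i ∈ s, A i x) := by
  classical
  induction s using Finset.induction_on with
  | empty => simpa using isBdd_const (X := X) (0 : Mat d)
  | insert i s hi ih =>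
    simp only [Finset.sum_insert hi]
    exact (hA i (Finset.mem_insert_self i s)).add
      (ih fun j hj => hA j (Finset.mem_insert_of_mem hj))

lemma IsBdd.transpose (hA : IsBdd A) : IsBdd (fun x => (A x)ᵀ) := by
  obtain ⟨a, ha⟩ := hA.2
  exact ⟨fun i j => hA.1 j i, a, fun x i j => ha x j i⟩

lemma IsBdd.mul (hA : IsBdd A) (hB : IsBdd B) : IsBdd (fun x => A x * B x) := by
  obtain ⟨a, ha0, ha⟩ := hA.exists_nonneg
  obtain ⟨b, hb0, hb⟩ := hB.exists_nonneg
  refine ⟨fun i j => ?_, d * (a * b), fun x i j => ?_⟩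
  · simp only [Matrix.mul_apply]
    exact Finset.measurable_fun_sum _ fun k _ => (hA.1 i k).mul (hB.1 k j)
  · rw [Matrix.mul_apply]
    refine (Finset.abs_sum_le_sum_abs _ _).trans ?_
    calc ∑ k, |A x i k * B x k j| ≤ ∑ _k : Fin d, a * b := Finset.sum_le_sum fun k _ => by
          rw [abs_mul]
          exact mul_le_mul (ha x i k) (hb x k j) (abs_nonneg _) ha0
      _ = _ := by simp

lemma IsBdd.comp {Y : Type*} [MeasurableSpace Y] {s : Y → X} (hs : Measurable s) (hA : IsBdd A) :
    IsBdd (fun y => A (s y)) := by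
  obtain ⟨a, ha⟩ := hA.2
  exact ⟨fun i j => (hA.1 i j).comp hs, a, fun y i j => ha _ i j⟩

lemma IsBdd.indicator {s : Set X} (hs : MeasurableSet s) (hA : IsBdd A) :
    IsBdd (s.indicator A) := by
  have : s.indicator A = fun x => s.indicator (fun _ => (1 : ℝ)) x • A x := by
    funext x
    by_cases hx : x ∈ s <;> simp [hx]
  rw [this]
  refine hA.smul_fun (c := 1) (measurable_const.indicator hs) fun x => ?_
  by_cases hx : x ∈ s <;> simp [hx]

lemma isBdd_of_continuous [TopologicalSpace X] [CompactSpace X] [OpensMeasurableSpace X]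
    (hA : Continuous A) : IsBdd A := by
  have hc : ∀ i j, Continuous fun x => A x i j := fun i j => (continuous_apply_apply i j).comp hA
  have h : ∀ i j, ∃ c : ℝ, ∀ x, |A x i j| ≤ c := fun i j => by
    obtain ⟨c, hc⟩ := isCompact_univ.exists_bound_of_continuousOn (hc i j).continuousOn
    exact ⟨c, fun x => hc x trivial⟩
  choose c hc' using h
  refine ⟨fun i j => (hc i j).measurable, ∑ i, ∑ j, |c i j|, fun x i j => ?_⟩
  refine ((hc' i j x).trans (le_abs_self _)).trans ?_
  exact (Finset.single_le_sum (f := fun j => |c i j|) (fun _ _ => abs_nonneg _)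
      (Finset.mem_univ j)).trans
    (Finset.single_le_sum (f := fun i => ∑ j, |c i j|)
      (fun _ _ => Finset.sum_nonneg fun _ _ => abs_nonneg _) (Finset.mem_univ i))

end IsBdd

/-! ### Integration against positive semidefinite matrix measures -/

section HsIntegral

variable {X : Type*} [MeasurableSpace X] {d : ℕ} {τ : MatMeasure X d}

/-- The entries of a positive semidefinite matrix are bounded by its trace, so the variation of τ is
dominated by that of the signed measure tr τ, which is finite. Bounded fields are therefore
integrable. -/
lemma isFiniteMeasure_variation (hτ : ∀ B, MeasurableSet B → (τ B).PosSemidef) :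
    IsFiniteMeasure τ.variation := by
  have hc : Continuous (Matrix.traceAddMonoidHom (Fin d) ℝ) := Continuous.matrix_trace continuous_id
  let s : SignedMeasure X := VectorMeasure.mapRange τ (Matrix.traceAddMonoidHom (Fin d) ℝ) hc
  obtain ⟨C, hC⟩ := exists_norm_le_of_entry d
  have hle : τ.variation ≤ C • s.totalVariation := by
    refine VectorMeasure.variation_le_of_forall_enorm_le fun B hB => ?_
    have h1 : ‖τ B‖ ≤ C * (τ B).trace := hC _ _ (entry_mul_self_le (hτ B hB))
    have h2 : (τ B).trace ≤ s.totalVariation.real B :=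
      (le_abs_self (s B)).trans (s.norm_le_totalVariation B)
    have h3 : ‖τ B‖ ≤ C * s.totalVariation.real B :=
      h1.trans (mul_le_mul_of_nonneg_left h2 C.2)
    rw [← ofReal_norm, Measure.smul_apply]
    refine (ENNReal.ofReal_le_ofReal h3).trans (le_of_eq ?_)
    rw [ENNReal.ofReal_mul (NNReal.coe_nonneg C), measureReal_def, ENNReal.ofReal_toReal (measure_ne_top _ _)]
    simp [ENNReal.smul_def]
  exact isFiniteMeasure_of_le _ hle

variable {A B : X → Mat d}

lemma hsIntegral_smul (c : ℝ) (A : X → Mat d) : hsIntegral τ (c • A) = c * hsIntegral τ A :=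
  VectorMeasure.integral_fun_smul τ (hs d) c A

lemma hsIntegral_congr_ae (h : A =ᵐ[τ.variation] B) : hsIntegral τ A = hsIntegral τ B :=
  VectorMeasure.integral_congr_ae h

lemma hsIntegral_restrict {s : Set X} (hs : MeasurableSet s) (A : X → Mat d) :
    hsIntegral (τ.restrict s) A = hsIntegral τ (s.indicator A) :=
  (VectorMeasure.integral_indicator hs).symm

variable [IsFiniteMeasure τ.variation]

lemma IsBdd.integrable (hA : IsBdd A) : τ.Integrable A := by
  obtain ⟨c, hc⟩ := hA.exists_norm_le
  exact integrable_of_bounded τ hA.stronglyMeasurable hc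

lemma hsIntegral_add (hA : IsBdd A) (hB : IsBdd B) :
    hsIntegral τ (A + B) = hsIntegral τ A + hsIntegral τ B :=
  VectorMeasure.integral_add hA.integrable hB.integrable

lemma hsIntegral_sub (hA : IsBdd A) (hB : IsBdd B) :
    hsIntegral τ (A - B) = hsIntegral τ A - hsIntegral τ B :=
  VectorMeasure.integral_sub hA.integrable hB.integrable

lemma hsIntegral_sum {ι : Type*} (s : Finset ι) {A : ι → X → Mat d}
    (hA : ∀ i ∈ s, IsBdd (A i)) :
    hsIntegral τ (fun x => ∑ i ∈ s, A i x) = ∑ i ∈ s, hsIntegral τ (A i) :=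
  VectorMeasure.integral_finsetSum s fun i hi => (hA i hi).integrable

lemma hsIntegral_indicator_const {s : Set X} (hs' : MeasurableSet s) (M : Mat d) :
    hsIntegral τ (s.indicator fun _ => M) = hs d M (τ s) :=
  VectorMeasure.integral_indicator_const M hs'

lemma hsIntegral_tendsto {F : ℕ → X → Mat d} (hF : ∀ n, IsBdd (F n)) {c : ℝ}
    (hc : ∀ n x, ‖F n x‖ ≤ c) (hlim : ∀ x, Tendsto (fun n => F n x) atTop (𝓝 (A x))) :
    Tendsto (fun n => hsIntegral τ (F n)) atTop (𝓝 (hsIntegral τ A)) :=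
  VectorMeasure.tendsto_integral_filter_of_norm_le_const
    (Eventually.of_forall fun n => (hF n).stronglyMeasurable.aestronglyMeasurable)
    ⟨c, Eventually.of_forall fun n => Eventually.of_forall fun x => hc n x⟩
    (Eventually.of_forall hlim)

lemma secondCountableTopology_mat (d : ℕ) :
    @SecondCountableTopology (Mat d) (PseudoMetricSpace.toUniformSpace.toTopologicalSpace) :=
  have : ProperSpace (Mat d) := FiniteDimensional.proper_real (Mat d)
  secondCountable_of_proper

lemma hsIntegral_nonneg (hτ : ∀ B, MeasurableSet B → (τ B).PosSemidef) (hA : IsBdd A)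
    (hpos : ∀ x, (A x).PosSemidef) : 0 ≤ hsIntegral τ A := by
  have := secondCountableTopology_mat d
  obtain ⟨c, hc⟩ := hA.exists_norm_le
  exact integral_nonneg_of_mem τ (hs d) hA.stronglyMeasurable hc (s := {M | M.PosSemidef})
    Matrix.PosSemidef.zero hpos fun M hM t ht => hs_nonneg hM (hτ t ht)

lemma hsIntegral_mono (hτ : ∀ B, MeasurableSet B → (τ B).PosSemidef) (hA : IsBdd A)
    (hB : IsBdd B) (hAs : ∀ x, (A x).IsSymm) (hBs : ∀ x, (B x).IsSymm)
    (h : ∀ x v, quad (A x) v ≤ quad (B x) v) : hsIntegral τ A ≤ hsIntegral τ B := by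
  have := hsIntegral_nonneg hτ (hB.sub hA) fun x =>
    (posSemidef_iff_quad _).2 ⟨(hBs x).sub (hAs x), fun v => by
      rw [Pi.sub_apply, quad_sub]; exact sub_nonneg.2 (h x v)⟩
  rw [hsIntegral_sub hB hA] at this
  linarith

lemma isBdd_one : IsBdd (1 : X → Mat d) := isBdd_const 1

lemma abs_hsIntegral_le (hτ : ∀ B, MeasurableSet B → (τ B).PosSemidef) (hA : IsBdd A)
    (hAs : ∀ x, (A x).IsSymm) {ε : ℝ} (h : ∀ x v, |quad (A x) v| ≤ ε * (v ⬝ᵥ v)) :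
    |hsIntegral τ A| ≤ ε * hsIntegral τ 1 := by
  have h1 := hsIntegral_mono hτ hA (isBdd_one.smul ε) hAs
    (fun x => Matrix.isSymm_one.smul ε) fun x v => by
      rw [Pi.smul_apply, quad_smul, Pi.one_apply, quad_one]
      exact (le_abs_self _).trans (h x v)
  have h2 := hsIntegral_mono hτ (isBdd_one.smul (-ε)) hA
    (fun x => Matrix.isSymm_one.smul (-ε)) hAs fun x v => by
      rw [Pi.smul_apply, quad_smul, Pi.one_apply, quad_one, neg_mul]
      exact neg_le_of_abs_le (h x v)
  rw [hsIntegral_smul] at h1 h2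
  exact abs_le.2 ⟨by linarith, h1⟩

lemma kusuokaMeasure_real (hτ : ∀ B, MeasurableSet B → (τ B).PosSemidef) (hA : IsBdd A)
    (hpos : ∀ x, (A x).PosSemidef) {s : Set X} (hs : MeasurableSet s) :
    (kusuokaMeasure A τ).real s = hsIntegral τ (s.indicator A) := by
  set μ : SignedMeasure X := τ.withDensity A (Kusuoka.hs d) with hμ
  have happ : ∀ t, MeasurableSet t → μ t = hsIntegral τ (t.indicator A) := fun t ht => by
    rw [hμ, VectorMeasure.withDensity_apply hA.integrable]
    exact hsIntegral_restrict ht A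
  have hnn : 0 ≤[Set.univ] μ := by
    rw [VectorMeasure.le_restrict_univ_iff_le]
    intro t ht
    rw [happ t ht]
    refine hsIntegral_nonneg hτ (hA.indicator ht) fun x => ?_
    by_cases hx : x ∈ t
    · simpa [hx] using hpos x
    · simpa [hx] using Matrix.PosSemidef.zero
  let m := μ.toMeasureOfZeroLE Set.univ MeasurableSet.univ hnn
  -- The density measure is non-negative, so by uniqueness its Jordan decomposition has zero
  -- negative part.
  let j : JordanDecomposition X := ⟨m, 0, Measure.MutuallySingular.zero_right⟩
  have hj : μ.toJordanDecomposition = j := by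
    refine SignedMeasure.toJordanDecomposition_eq ?_
    simp [j, m, JordanDecomposition.toSignedMeasure, μ.toMeasureOfZeroLE_toSignedMeasure hnn]
  have hk : kusuokaMeasure A τ = m := by
    change μ.toJordanDecomposition.posPart = m
    rw [hj]
  rw [hk, SignedMeasure.toMeasureOfZeroLE_real_apply _ hnn _ hs, Set.univ_inter, happ s hs]

instance (A : X → Mat d) (τ : MatMeasure X d) : IsFiniteMeasure (kusuokaMeasure A τ) := by
  unfold kusuokaMeasure; infer_instance

lemma integral_kusuokaMeasure (hτ : ∀ B, MeasurableSet B → (τ B).PosSemidef) (hA : IsBdd A)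
    (hpos : ∀ x, (A x).PosSemidef) {f : X → ℝ} (hf : Measurable f) {c : ℝ}
    (hc : ∀ x, |f x| ≤ c) :
    ∫ x, f x ∂(kusuokaMeasure A τ) = hsIntegral τ (fun x => f x • A x) := by
  set κ := kusuokaMeasure A τ with hκ
  have hbdd : ∀ g : SimpleFunc X ℝ, ∃ c, ∀ x, |g x| ≤ c := fun g => by
    obtain ⟨c, hc⟩ := g.exists_forall_norm_le
    exact ⟨c, hc⟩
  have hB : ∀ g : SimpleFunc X ℝ, IsBdd fun x => g x • A x := fun g => by
    obtain ⟨c, hc⟩ := hbdd g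
    exact hA.smul_fun g.measurable hc
  have hsimple : ∀ g : SimpleFunc X ℝ, ∫ x, g x ∂κ = hsIntegral τ (fun x => g x • A x) := by
    intro g
    induction g using SimpleFunc.induction with
    | const a hs =>
      rename_i s
      have e : ∀ x, (SimpleFunc.piecewise s hs (SimpleFunc.const X a) (SimpleFunc.const X 0)) x
          = s.indicator (fun _ => a) x := fun x => by
        by_cases hx : x ∈ s <;> simp [hx]
      simp only [e]
      rw [integral_indicator hs, setIntegral_const, smul_eq_mul, kusuokaMeasure_real hτ hA hpos hs,
        mul_comm, ← hsIntegral_smul]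
      congr 1
      funext x
      by_cases hx : x ∈ s <;> simp [hx]
    | add _ hf hg =>
      rename_i f g _
      have e : (fun x => (f + g) x • A x) = (fun x => f x • A x) + fun x => g x • A x := by
        funext x
        simp [add_smul]
      rw [e, hsIntegral_add (hB f) (hB g), ← hf, ← hg, ← integral_add]
      · rfl
      · exact SimpleFunc.integrable_of_isFiniteMeasure f
      · exact SimpleFunc.integrable_of_isFiniteMeasure g
  let g : ℕ → SimpleFunc X ℝ := fun n => SimpleFunc.approxOn f hf Set.univ 0 (Set.mem_univ _) n
  have hg : ∀ x, Tendsto (fun n => g n x) atTop (𝓝 (f x)) := fun x =>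
    SimpleFunc.tendsto_approxOn hf (Set.mem_univ _) (by simp)
  have hgb : ∀ n x, |g n x| ≤ c + c := fun n x =>
    (SimpleFunc.norm_approxOn_zero_le hf (Set.mem_univ _) x n).trans (add_le_add (hc x) (hc x))
  have h1 : Tendsto (fun n => ∫ x, g n x ∂κ) atTop (𝓝 (∫ x, f x ∂κ)) :=
    tendsto_integral_of_dominated_convergence (fun _ => c + c)
      (fun n => (g n).aestronglyMeasurable) (integrable_const _)
      (fun n => Eventually.of_forall (hgb n)) (Eventually.of_forall hg)
  obtain ⟨a, ha⟩ := hA.exists_norm_le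
  have h2 : Tendsto (fun n => hsIntegral τ (fun x => g n x • A x)) atTop
      (𝓝 (hsIntegral τ (fun x => f x • A x))) := by
    refine hsIntegral_tendsto (fun n => hB (g n)) (c := (c + c) * a) (fun n x => ?_)
      fun x => (hg x).smul_const (A x)
    rw [norm_smul]
    exact mul_le_mul (hgb n x) (ha x) (norm_nonneg _) ((abs_nonneg _).trans (hgb n x))
  exact tendsto_nhds_unique h1 (h2.congr fun n => (hsimple (g n)).symm)

end HsIntegral

lemma IsField.fun_smul_const {X : Type*} [TopologicalSpace X] {d : ℕ} {f : X → ℝ} (hf : Continuous f) {M : Mat d} (hM : M.IsSymm) :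
    IsField fun x => f x • M :=
  ⟨hf.smul continuous_const, fun x => hM.smul (f x)⟩

/-! ### Riesz representation by matrix measures -/

section Riesz

variable {X : Type*} [TopologicalSpace X] [MeasurableSpace X] [BorelSpace X]

/-- The terms with negative coefficients are moved to the other side, so that uniqueness for finite
positive measures applies. -/
lemma real_eq_sum_of_integral_eq [CompactSpace X] [HasOuterApproxClosed X] {κ : Type*}
    [Fintype κ] {ν : Measure X} [IsFiniteMeasure ν] {μ : κ → Measure X}
    [∀ k, IsFiniteMeasure (μ k)] {c : κ → ℝ}
    (h : ∀ f : X → ℝ, Continuous f → ∫ x, f x ∂ν = ∑ k, c k * ∫ x, f x ∂(μ k)) (B : Set X) :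
    ν.real B = ∑ k, c k * (μ k).real B := by
  have hint : ∀ (m : Measure X) [IsFiniteMeasure m] (f : X → ℝ), Continuous f →
      Integrable f m := fun m _ f hf => hf.integrable_of_hasCompactSupport
        (HasCompactSupport.of_compactSpace f)
  have hc : ∀ k, c k = (c k).toNNReal - (-c k).toNNReal := fun k => by
    rcases le_total 0 (c k) with h0 | h0
    · rw [Real.coe_toNNReal _ h0, Real.toNNReal_of_nonpos (neg_nonpos.2 h0)]; simp
    · rw [Real.coe_toNNReal _ (neg_nonneg.2 h0), Real.toNNReal_of_nonpos h0]; simp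
  have hmeas : ν + ∑ k, (-c k).toNNReal • μ k = ∑ k, (c k).toNNReal • μ k := by
    refine ext_of_forall_integral_eq_of_IsFiniteMeasure fun f => ?_
    have hf := f.continuous
    rw [integral_add_measure (hint _ _ hf) (hint _ _ hf),
      integral_finsetSum_measure fun k _ => hint _ _ hf,
      integral_finsetSum_measure fun k _ => hint _ _ hf, h f hf, ← Finset.sum_add_distrib]
    refine Finset.sum_congr rfl fun k _ => ?_
    rw [integral_smul_nnreal_measure, integral_smul_nnreal_measure, NNReal.smul_def,
      NNReal.smul_def, smul_eq_mul, smul_eq_mul]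
    nth_rewrite 1 [hc k]
    ring
  have hreal : ∀ m : κ → Measure X, (∀ k, IsFiniteMeasure (m k)) →
      (∑ k, m k).real B = ∑ k, (m k).real B := fun m _ => by
    simp only [measureReal_def, Measure.coe_finsetSum, Finset.sum_apply]
    exact ENNReal.toReal_sum fun k _ => measure_ne_top _ _
  have := congrArg (fun m : Measure X => m.real B) hmeas
  beta_reduce at this
  rw [measureReal_add_apply, hreal _ fun k => inferInstance, hreal _ fun k => inferInstance] at this
  have hsm : ∀ (r : ℝ≥0) (m : Measure X), (r • m).real B = r * m.real B := fun r m => by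
    rw [measureReal_def, Measure.smul_apply, ENNReal.smul_def, smul_eq_mul, ENNReal.toReal_mul]
    rfl
  simp only [hsm] at this
  rw [eq_sub_of_add_eq this, ← Finset.sum_sub_distrib]
  refine Finset.sum_congr rfl fun k _ => ?_
  nth_rewrite 3 [hc k]
  ring

variable {d : ℕ}

/-- The vectors `e_i + e_j`, `e_i`, `e_j` used for polarisation. -/
def polarVec (k : Fin d × Fin d × Fin 3) : Fin d → ℝ :=
  ![Pi.single k.1 1 + Pi.single k.2.1 1, Pi.single k.1 1, Pi.single k.2.1 1] k.2.2

/-- The signs of the polarisation identity. -/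
def polarSign (k : Fin d × Fin d × Fin 3) : ℝ := ![1, -1, -1] k.2.2

lemma eq_sum_polar {M : Mat d} (hM : M.IsSymm) :
    M = ∑ k : Fin d × Fin d × Fin 3, (M k.1 k.2.1 / 2 * polarSign k) •
      Matrix.vecMulVec (polarVec k) (polarVec k) := by
  conv_lhs => rw [eq_sum_vecMulVec hM]
  rw [Fintype.sum_prod_type]
  refine Finset.sum_congr rfl fun i _ => ?_
  rw [Fintype.sum_prod_type]
  refine Finset.sum_congr rfl fun j _ => ?_
  rw [Fin.sum_univ_three]
  simp only [polarVec, polarSign, smul_sub]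
  simp [sub_eq_add_neg]

lemma isSymm_vecMulVec (v : Fin d → ℝ) : (Matrix.vecMulVec v v).IsSymm := by
  ext i j
  simp [Matrix.vecMulVec_apply, mul_comm]

lemma quad_vecMulVec (v w : Fin d → ℝ) : quad (Matrix.vecMulVec v v) w = (v ⬝ᵥ w) ^ 2 := by
  rw [quad, Matrix.vecMulVec_mulVec, dotProduct_smul]
  simp [dotProduct_comm w v, sq]

lemma posSemidef_vecMulVec (v : Fin d → ℝ) : (Matrix.vecMulVec v v).PosSemidef :=
  (posSemidef_iff_quad _).2 ⟨isSymm_vecMulVec v, fun w => by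
    rw [quad_vecMulVec]; positivity⟩

/-- The symmetric matrices dual to those of the polarisation identity. -/
def polarDual (k : Fin d × Fin d × Fin 3) : Mat d :=
  (polarSign k / 4) • (Matrix.single k.1 k.2.1 1 + Matrix.single k.2.1 k.1 1)

lemma isSymm_polarDual (k : Fin d × Fin d × Fin 3) : (polarDual k).IsSymm := by
  simp [Matrix.IsSymm, polarDual, add_comm]

lemma quad_polarDual (k : Fin d × Fin d × Fin 3) (v : Fin d → ℝ) :
    quad (polarDual k) v = v k.1 * v k.2.1 / 2 * polarSign k := by
  have h : ∀ i j : Fin d, quad (Matrix.single i j 1) v = v i * v j := fun i j => by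
    simp [quad, Matrix.single_mulVec, Function.update_apply, dotProduct]
  rw [polarDual, quad_smul, quad_add, h, h]
  ring

variable {ℓ : (X → Mat d) → ℝ}

theorem exists_measure_quad [CompactSpace X] [T2Space X]
    (hadd : ∀ A B, IsField A → IsField B → ℓ (A + B) = ℓ A + ℓ B)
    (hsmul : ∀ (c : ℝ) A, IsField A → ℓ (c • A) = c * ℓ A)
    (hmono : ∀ A B, IsField A → IsField B → (∀ x v, quad (A x) v ≤ quad (B x) v) → ℓ A ≤ ℓ B)
    (v : Fin d → ℝ) :
    ∃ μ : Measure X, IsFiniteMeasure μ ∧ ∀ f : X → ℝ, Continuous f →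
      ∫ x, f x ∂μ = ℓ fun x => f x • Matrix.vecMulVec v v := by
  have hV := isSymm_vecMulVec v
  let Λ₀ : CompactlySupportedContinuousMap X ℝ →ₗ[ℝ] ℝ :=
    { toFun := fun f => ℓ fun x => f x • Matrix.vecMulVec v v
      map_add' := fun f g => by
        refine Eq.trans ?_ (hadd _ _ (IsField.fun_smul_const f.continuous hV)
          (IsField.fun_smul_const g.continuous hV))
        congr 1
        funext x
        exact add_smul _ _ _
      map_smul' := fun c f => by
        refine Eq.trans ?_ (hsmul c _ (IsField.fun_smul_const f.continuous hV))
        congr 1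
        funext x
        exact mul_smul _ _ _ }
  let Λ : CompactlySupportedContinuousMap X ℝ →ₚ[ℝ] ℝ := PositiveLinearMap.mk₀ Λ₀ fun f hf => by
    have h0 : ℓ (fun x => (0 : ℝ) • Matrix.vecMulVec v v) = 0 := by
      have := hsmul 0 (fun _ => Matrix.vecMulVec v v) (isField_const hV)
      rwa [zero_mul] at this
    rw [← h0]
    refine hmono _ _ (IsField.fun_smul_const continuous_const hV)
      (IsField.fun_smul_const f.continuous hV) fun x w => ?_
    rw [quad_smul, quad_smul, quad_vecMulVec]
    exact mul_le_mul_of_nonneg_right (hf x) (sq_nonneg _)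
  refine ⟨RealRMK.rieszMeasure Λ, inferInstance, fun f hf => ?_⟩
  exact RealRMK.integral_rieszMeasure Λ ⟨⟨f, hf⟩, HasCompactSupport.of_compactSpace f⟩

/-- The scalar measures μ_v representing f ↦ ℓ(f vvᵗ) depend quadratically on v, since vvᵗ does.
They are thus the quadratic forms of a single matrix measure, whose positivity is that of the μ_v.
-/
theorem exists_matMeasure [CompactSpace X] [T2Space X] [HasOuterApproxClosed X]
    (hadd : ∀ A B, IsField A → IsField B → ℓ (A + B) = ℓ A + ℓ B)
    (hsmul : ∀ (c : ℝ) A, IsField A → ℓ (c • A) = c * ℓ A)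
    (hmono : ∀ A B, IsField A → IsField B → (∀ x v, quad (A x) v ≤ quad (B x) v) → ℓ A ≤ ℓ B) :
    ∃ τ : MatMeasure X d, (∀ B, MeasurableSet B → (τ B).PosSemidef) ∧
      ∀ A, IsField A → hsIntegral τ A = ℓ A := by
  choose μ hμ hμi using exists_measure_quad hadd hsmul hmono
  have hsum : ∀ {κ : Type} (s : Finset κ) (A : κ → X → Mat d), (∀ k, IsField (A k)) →
      IsField (fun x => ∑ k ∈ s, A k x) ∧ ℓ (fun x => ∑ k ∈ s, A k x) = ∑ k ∈ s, ℓ (A k) := by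
    classical
    intro κ s A hA
    induction s using Finset.induction_on with
    | empty =>
      refine ⟨isField_const Matrix.isSymm_zero, ?_⟩
      have := hsmul 0 (1 : X → Mat d) isField_one
      rw [zero_smul, zero_mul] at this
      exact this
    | insert k s hk ih =>
      simp only [Finset.sum_insert hk]
      exact ⟨(hA k).add ih.1, by rw [← ih.2]; exact hadd _ _ (hA k) ih.1⟩
  have hquad : ∀ (v : Fin d → ℝ) (B : Set X), (μ v).real B =
      ∑ k : Fin d × Fin d × Fin 3, (v k.1 * v k.2.1 / 2 * polarSign k) *
        (μ (polarVec k)).real B := by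
    intro v B
    refine real_eq_sum_of_integral_eq (fun f hf => ?_) B
    have hfk : ∀ k : Fin d × Fin d × Fin 3,
        IsField fun x => f x • Matrix.vecMulVec (polarVec k) (polarVec k) := fun k =>
      IsField.fun_smul_const hf (isSymm_vecMulVec _)
    rw [hμi v f hf]
    calc ℓ (fun x => f x • Matrix.vecMulVec v v)
        = ℓ (fun x => ∑ k : Fin d × Fin d × Fin 3, (v k.1 * v k.2.1 / 2 * polarSign k) •
            (f x • Matrix.vecMulVec (polarVec k) (polarVec k))) := by
          congr 1
          funext x
          conv_lhs => rw [eq_sum_polar (isSymm_vecMulVec v)]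
          rw [Finset.smul_sum]
          exact Finset.sum_congr rfl fun k _ => by
            rw [smul_comm, Matrix.vecMulVec_apply]
      _ = _ := by
          rw [(hsum Finset.univ (fun k x => (v k.1 * v k.2.1 / 2 * polarSign k) •
            (f x • Matrix.vecMulVec (polarVec k) (polarVec k))) fun k => (hfk k).smul _).2]
          refine Finset.sum_congr rfl fun k _ => ?_
          rw [hμi _ f hf]
          exact hsmul _ _ (hfk k)
  let e : (k : Fin d × Fin d × Fin 3) → ℝ →L[ℝ] Mat d := fun k =>
    (ContinuousLinearMap.id ℝ ℝ).smulRight (polarDual k)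
  -- The dual matrices are chosen so that the form of τ at v is the polarisation formula `hquad` for
  -- μ_v.
  let τ : MatMeasure X d := ∑ k : Fin d × Fin d × Fin 3,
    VectorMeasure.mapRange (μ (polarVec k)).toSignedMeasure ((e k : ℝ →+ Mat d)) (e k).continuous
  have happ : ∀ B, MeasurableSet B → τ B = ∑ k, (μ (polarVec k)).real B • polarDual k := by
    intro B hB
    simp only [τ, FunLike.coe_sum, Finset.sum_apply]
    refine Finset.sum_congr rfl fun k _ => ?_
    change e k ((μ (polarVec k)).toSignedMeasure B) = _
    rw [Measure.toSignedMeasure_apply_measurable hB]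
    rfl
  have hq : ∀ B, MeasurableSet B → ∀ v, quad (τ B) v = (μ v).real B := fun B hB v => by
    rw [happ B hB, quad_sum, hquad v B]
    exact Finset.sum_congr rfl fun k _ => by rw [quad_smul, quad_polarDual, mul_comm]
  have hpos : ∀ B, MeasurableSet B → (τ B).PosSemidef := fun B hB => by
    refine (posSemidef_iff_quad _).2 ⟨?_, fun v => ?_⟩
    · rw [happ B hB]
      exact Matrix.IsSymm.ext fun i j => by
        simp only [Matrix.sum_apply, Matrix.smul_apply, (isSymm_polarDual _).apply i j]
    · rw [hq B hB v]
      exact measureReal_nonneg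
  have := isFiniteMeasure_variation hpos
  have hκ : ∀ v, kusuokaMeasure (fun _ => Matrix.vecMulVec v v) τ = μ v := fun v => by
    ext B hB
    rw [← measureReal_eq_measureReal_iff, kusuokaMeasure_real hpos (isBdd_const _)
      (fun _ => posSemidef_vecMulVec v) hB, hsIntegral_indicator_const hB, hs_vecMulVec, hq B hB]
  refine ⟨τ, hpos, fun A hA => ?_⟩
  have hA' : A = fun x => ∑ k : Fin d × Fin d × Fin 3, (A x k.1 k.2.1 / 2 * polarSign k) •
      Matrix.vecMulVec (polarVec k) (polarVec k) := funext fun x => eq_sum_polar (hA.isSymm x)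
  have hcont : ∀ k : Fin d × Fin d × Fin 3,
      Continuous fun x => A x k.1 k.2.1 / 2 * polarSign k := fun k =>
    ((hA.continuous_entry _ _).div_const _).mul_const _
  have hf : ∀ k : Fin d × Fin d × Fin 3, IsField fun x => (A x k.1 k.2.1 / 2 * polarSign k) •
      Matrix.vecMulVec (polarVec k) (polarVec k) := fun k =>
    IsField.fun_smul_const (hcont k) (isSymm_vecMulVec _)
  rw [hA', (hsum Finset.univ _ hf).2,
    hsIntegral_sum Finset.univ fun k _ => isBdd_of_continuous (hf k).continuous]
  refine Finset.sum_congr rfl fun k _ => ?_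
  obtain ⟨c, hc⟩ := isCompact_univ.exists_bound_of_continuousOn (hcont k).continuousOn
  rw [← hμi _ _ (hcont k), ← hκ (polarVec k), integral_kusuokaMeasure hpos (isBdd_const _)
    (fun _ => posSemidef_vecMulVec _) (hcont k).measurable fun x => hc x (Set.mem_univ x)]

end Riesz

theorem Cocycle.IsPerron.exists_isGibbs {X : Type*} [TopologicalSpace X] [MeasurableSpace X]
    [BorelSpace X] [CompactSpace X] [T2Space X] [HasOuterApproxClosed X] {ι : Type*} [Fintype ι]
    {d : ℕ} {C : Cocycle X ι d} {β : ℝ} {Q : X → Mat d} {ℓ : (X → Mat d) → ℝ}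
    (h : C.IsPerron β Q ℓ) : ∃ τ, IsGibbs C.op β Q τ := by
  obtain ⟨τ, hpos, hτ⟩ := exists_matMeasure h.add h.smul h.mono
  obtain ⟨c, hc, hlow⟩ := h.lower
  refine ⟨τ, h.pos, h.isField.continuous, fun x => ?_, h.eigen, hpos, ?_, fun A hA hAs => ?_⟩
  · refine (posDef_iff_quad _).2 ⟨h.isField.isSymm x, fun v hv => ?_⟩
    refine lt_of_lt_of_le (mul_pos hc ?_) (hlow x v)
    exact lt_of_le_of_ne (dotProduct_self_nonneg' v)
      (Ne.symm fun h0 => hv (dotProduct_self_eq_zero.1 h0))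
  · rw [hτ Q h.isField, h.apply_eigen]
  · rw [hτ _ (C.isField_op ⟨hA, hAs⟩), hτ A ⟨hA, hAs⟩, h.apply_op A ⟨hA, hAs⟩]

lemma IsField.isBdd {X : Type*} [TopologicalSpace X] [MeasurableSpace X] [OpensMeasurableSpace X]
    [CompactSpace X] {d : ℕ} {A : X → Mat d} (hA : IsField A) : IsBdd A :=
  isBdd_of_continuous hA.continuous

/-! ### Every Gibbs triple gives the Perron projection -/

namespace IsGibbs

variable {X : Type*} [TopologicalSpace X] [MeasurableSpace X] {d : ℕ}

lemma isField {L : (X → Mat d) → X → Mat d} {β : ℝ} {Q : X → Mat d} {τ : MatMeasure X d}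
    (g : IsGibbs L β Q τ) : IsField Q :=
  ⟨g.continuous, fun x => ((posDef_iff_quad _).1 (g.posDef x)).1⟩

variable {ι : Type*} [Fintype ι]
  {C : Cocycle X ι d} {β : ℝ} {Q : X → Mat d} {τ : MatMeasure X d} (g : IsGibbs C.op β Q τ)

include g

lemma hsIntegral_iterate {A : X → Mat d} (hA : IsField A) (k : ℕ) :
    hsIntegral τ (C.op^[k] A) = β ^ k * hsIntegral τ A := by
  induction k with
  | zero => simp
  | succ k ih =>
    have hk := C.isField_iterate_op hA k
    rw [Function.iterate_succ_apply', g.adjoint _ hk.continuous hk.isSymm, ih, pow_succ]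
    ring

variable [BorelSpace X] [CompactSpace X]

lemma hsIntegral_one_pos : 0 < hsIntegral τ 1 := by
  have := isFiniteMeasure_variation g.posSemidef
  obtain ⟨c, hc0, hc⟩ := g.isField.isBdd.exists_nonneg
  have h1 : |hsIntegral τ Q| ≤ c * d * hsIntegral τ 1 :=
    abs_hsIntegral_le g.posSemidef g.isField.isBdd g.isField.isSymm fun x v =>
      abs_quad_le_of_entry hc0 (hc x) v
  rw [g.normalized, abs_one] at h1
  by_contra hn
  have := mul_nonpos_of_nonneg_of_nonpos (mul_nonneg hc0 (Nat.cast_nonneg d)) (not_lt.1 hn)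
  linarith

/-- Under the spectral gap, the iterates of the operator converge to the projection given by any
Gibbs triple. -/
theorem tendsto_of_isPerron {β₀ : ℝ} {Q₀ : X → Mat d} {ℓ : (X → Mat d) → ℝ}
    (h : C.IsPerron β₀ Q₀ ℓ) {A : X → Mat d} (hA : IsField A) {ε : ℝ} (hε : 0 < ε) :
    ∀ᶠ k in atTop, ∀ x v,
      |quad (C.op^[k] A x) v - β ^ k * hsIntegral τ A * quad (Q x) v| ≤
        ε * β ^ k * (v ⬝ᵥ v) := by
  have := isFiniteMeasure_variation g.posSemidef
  have hβ₀ := h.pos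
  have h1 := g.hsIntegral_one_pos
  -- The uniform Perron convergence integrated against τ, which is an eigenvector of the adjoint for
  -- β.
  have hlim : ∀ A, IsField A → Tendsto (fun k : ℕ => (β / β₀) ^ k * hsIntegral τ A) atTop
      (𝓝 (ℓ A * hsIntegral τ Q₀)) := by
    intro A hA
    rw [Metric.tendsto_atTop']
    intro ε hε
    obtain ⟨K, hK⟩ := eventually_atTop.1 (h.tendsto A hA (ε / (2 * hsIntegral τ 1)) (by positivity))
    refine ⟨K, fun k hk => ?_⟩
    have hF : IsField ((C.op^[k] A) - (β₀ ^ k * ℓ A) • Q₀) :=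
      (C.isField_iterate_op hA k).sub (h.isField.smul _)
    have key := abs_hsIntegral_le g.posSemidef hF.isBdd hF.isSymm
      (ε := ε / (2 * hsIntegral τ 1) * β₀ ^ k) fun x v => by
        rw [Pi.sub_apply, Pi.smul_apply, quad_sub, quad_smul]
        exact hK k hk.le x v
    rw [hsIntegral_sub (C.isField_iterate_op hA k).isBdd (h.isField.smul _).isBdd,
      hsIntegral_smul, g.hsIntegral_iterate hA] at key
    have hp : 0 < β₀ ^ k := pow_pos hβ₀ k
    rw [Real.dist_eq]
    have e : (β / β₀) ^ k * hsIntegral τ A - ℓ A * hsIntegral τ Q₀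
        = (β ^ k * hsIntegral τ A - β₀ ^ k * ℓ A * hsIntegral τ Q₀) / β₀ ^ k := by
      rw [div_pow]
      field_simp
    rw [e, abs_div, abs_of_pos hp, div_lt_iff₀ hp]
    refine key.trans_lt ?_
    have e2 : ε / (2 * hsIntegral τ 1) * β₀ ^ k * hsIntegral τ 1 = ε / 2 * β₀ ^ k := by
      field_simp
    rw [e2]
    exact mul_lt_mul_of_pos_right (half_lt_self hε) hp
  have hQ₀pos : 0 < hsIntegral τ Q₀ := by
    obtain ⟨c, hc, hlow⟩ := h.lower
    have := hsIntegral_mono g.posSemidef (isBdd_one.smul c) h.isField.isBdd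
      (fun x => Matrix.isSymm_one.smul c) h.isField.isSymm fun x v => by
        rw [Pi.smul_apply, quad_smul, Pi.one_apply, quad_one]
        exact hlow x v
    rw [hsIntegral_smul] at this
    exact lt_of_lt_of_le (mul_pos hc h1) this
  -- For A = 1 the limit is ∫ Q₀ dτ > 0, and a geometric sequence with a nonzero limit has ratio 1.
  have hβ : β = β₀ := by
    have l1 := hlim 1 isField_one
    rw [h.apply_one, one_mul] at l1
    have l2 := l1.comp (tendsto_add_atTop_nat 1)
    have l3 := l1.const_mul (β / β₀)
    have := tendsto_nhds_unique (l3.congr fun k => by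
      simp only [Function.comp, pow_succ]; ring) l2
    exact (div_eq_one_iff_eq hβ₀.ne').1 (mul_right_cancel₀ hQ₀pos.ne' (this.trans (one_mul _).symm))
  subst hβ
  have hint : ∀ A, IsField A → hsIntegral τ A = ℓ A * hsIntegral τ Q₀ := fun A hA => by
    refine tendsto_nhds_unique ?_ (hlim A hA)
    simp [div_self hβ₀.ne']
  have hiter : ∀ k, C.op^[k] Q = β ^ k • Q := fun k => by
    induction k with
    | zero => simp
    | succ k ih =>
      rw [Function.iterate_succ_apply', ih, C.op_smul, g.eigen, smul_smul, pow_succ]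
  have hQ : ∀ x v, quad (Q x) v = ℓ Q * quad (Q₀ x) v := by
    intro x v
    refine eq_of_abs_sub_le_all fun δ hδ => ?_
    have hv := dotProduct_self_nonneg' v
    obtain ⟨k, hk⟩ := (h.tendsto Q g.isField (δ / (1 + v ⬝ᵥ v)) (by positivity)).exists
    have hk := hk x v
    have hp : 0 < β ^ k := pow_pos hβ₀ k
    rw [hiter, Pi.smul_apply, quad_smul] at hk
    have e : β ^ k * quad (Q x) v - β ^ k * ℓ Q * quad (Q₀ x) v
        = (quad (Q x) v - ℓ Q * quad (Q₀ x) v) * β ^ k := by ring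
    rw [e, abs_mul, abs_of_pos hp, mul_right_comm] at hk
    refine (le_of_mul_le_mul_right hk hp).trans ?_
    rw [div_mul_eq_mul_div, div_le_iff₀ (by positivity)]
    nlinarith
  -- Q is ℓ(Q) times Q₀ and τ is ∫ Q₀ dτ times ℓ; the normalisation makes the two factors cancel in
  -- the projection.
  have hn : ℓ Q * hsIntegral τ Q₀ = 1 := by rw [← hint Q g.isField, g.normalized]
  filter_upwards [h.tendsto A hA ε hε] with k hk x v
  have e : β ^ k * hsIntegral τ A * quad (Q x) v = β ^ k * ℓ A * quad (Q₀ x) v := by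
    rw [hint A hA, hQ]
    linear_combination (β ^ k * ℓ A * quad (Q₀ x) v) * hn
  rw [e]
  exact hk x v

end IsGibbs

lemma IsField.exists_posSemidef_add {X : Type*} [TopologicalSpace X] [MeasurableSpace X]
    [OpensMeasurableSpace X] [CompactSpace X] {d : ℕ} {A : X → Mat d} (hA : IsField A) :
    ∃ c : ℝ, ∀ x, ((A + c • (1 : X → Mat d)) x).PosSemidef := by
  obtain ⟨c, hc0, hc⟩ := hA.isBdd.exists_nonneg
  refine ⟨c * d, fun x => (posSemidef_iff_quad _).2
    ⟨(hA.add (isField_one.smul _)).isSymm x, fun v => ?_⟩⟩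
  have := (abs_le.1 (abs_quad_le_of_entry hc0 (hc x) v)).1
  rw [Pi.add_apply, quad_add, Pi.smul_apply, quad_smul, Pi.one_apply, quad_one]
  linarith

namespace IsGibbs

variable {X : Type*} [TopologicalSpace X] [MeasurableSpace X] [BorelSpace X] [CompactSpace X]
  {d : ℕ} {ι : Type*} [Fintype ι] {C : Cocycle X ι d} {β : ℝ} {Q : X → Mat d}
  {τ : MatMeasure X d} (g : IsGibbs C.op β Q τ)

include g

/-- The adjoint identity for the products of bounded Borel functions and continuous positive
fields. -/
lemma adjoint_smul_of_posSemidef [HasOuterApproxClosed X] {A : X → Mat d} (hA : IsField A)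
    (hpos : ∀ x, (A x).PosSemidef) {f : X → ℝ} (hf : Measurable f) {c : ℝ}
    (hc : ∀ x, |f x| ≤ c) :
    hsIntegral τ (C.op fun x => f x • A x) = β * hsIntegral τ fun x => f x • A x := by
  have := isFiniteMeasure_variation g.posSemidef
  let A' : ι → X → Mat d := fun i x => (C.D i x)ᵀ * A (C.s i x) * C.D i x
  have hA' : ∀ i, IsBdd (A' i) := fun i => isBdd_of_continuous
    (((C.continuous_D i).matrix_transpose.matrix_mul
      (hA.continuous.comp (C.continuous_s i))).matrix_mul (C.continuous_D i))
  have hA'pos : ∀ i x, (A' i x).PosSemidef := fun i x => by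
    refine (posSemidef_iff_quad _).2 ⟨?_, fun v => ?_⟩
    · simp only [A', Matrix.IsSymm, Matrix.transpose_mul, Matrix.transpose_transpose,
        (hA.isSymm _).eq, Matrix.mul_assoc]
    · rw [quad_conj]
      exact ((posSemidef_iff_quad _).1 (hpos _)).2 _
  have hs : ∀ i, Measurable (C.s i) := fun i => (C.continuous_s i).measurable
  -- For a fixed positive A both sides are integrals of f against finite positive measures. These
  -- agree on continuous f by hypothesis, hence on Borel f.
  let m₁ : Measure X := ∑ i, (kusuokaMeasure (A' i) τ).map (C.s i)
  let m₂ : Measure X := β.toNNReal • kusuokaMeasure A τ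
  have hint : ∀ (m : Measure X) [IsFiniteMeasure m] (f : X → ℝ) (c : ℝ), Measurable f →
      (∀ x, |f x| ≤ c) → Integrable f m := fun m _ f c hf hc =>
    Integrable.of_bound hf.aestronglyMeasurable c (Eventually.of_forall hc)
  have h₁ : ∀ (f : X → ℝ) (c : ℝ), Measurable f → (∀ x, |f x| ≤ c) →
      ∫ x, f x ∂m₁ = hsIntegral τ (C.op fun x => f x • A x) := by
    intro f c hf hc
    rw [integral_finsetSum_measure fun i _ => hint _ f c hf hc]
    have e : (C.op fun x => f x • A x) = fun x => ∑ i, f (C.s i x) • A' i x := by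
      funext x
      simp [Cocycle.op, A']
    rw [e, hsIntegral_sum Finset.univ fun i _ =>
      (hA' i).smul_fun (f := fun x => f (C.s i x)) (hf.comp (hs i)) fun x => hc _]
    refine Finset.sum_congr rfl fun i _ => ?_
    rw [integral_map (hs i).aemeasurable hf.aestronglyMeasurable,
      integral_kusuokaMeasure g.posSemidef (hA' i) (hA'pos i) (f := fun x => f (C.s i x))
        (hf.comp (hs i)) fun x => hc _]
  have h₂ : ∀ (f : X → ℝ) (c : ℝ), Measurable f → (∀ x, |f x| ≤ c) →
      ∫ x, f x ∂m₂ = β * hsIntegral τ fun x => f x • A x := by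
    intro f c hf hc
    rw [integral_smul_nnreal_measure, integral_kusuokaMeasure g.posSemidef hA.isBdd hpos hf hc,
      NNReal.smul_def, Real.coe_toNNReal _ g.pos.le, smul_eq_mul]
  have hm : m₁ = m₂ := by
    refine ext_of_forall_integral_eq_of_IsFiniteMeasure fun f => ?_
    have hfc : ∀ x, |f x| ≤ ‖f‖ := f.norm_coe_le_norm
    have hfm : Measurable f := f.continuous.measurable
    rw [h₁ f _ hfm hfc, h₂ f _ hfm hfc]
    have hfA := hA.smul_fun f.continuous
    exact g.adjoint _ hfA.continuous hfA.isSymm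
  rw [← h₁ f c hf hc, ← h₂ f c hf hc, hm]

/-- The adjoint identity for the products of bounded Borel functions and continuous fields. -/
lemma adjoint_smul [HasOuterApproxClosed X] {A : X → Mat d} (hA : IsField A) {f : X → ℝ}
    (hf : Measurable f) {c : ℝ} (hc : ∀ x, |f x| ≤ c) :
    hsIntegral τ (C.op fun x => f x • A x) = β * hsIntegral τ fun x => f x • A x := by
  have := isFiniteMeasure_variation g.posSemidef
  -- A is the difference of the positive fields A + t·1 and t·1.
  obtain ⟨t, ht⟩ := hA.exists_posSemidef_add
  have h1 : IsField (t • (1 : X → Mat d)) := isField_one.smul t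
  have hB := hA.add h1
  have e1 := g.adjoint_smul_of_posSemidef hB ht hf hc
  have e2 := g.adjoint_smul_of_posSemidef (isField_one (X := X) (d := d))
    (fun x => Matrix.PosSemidef.one) hf hc
  have es : (fun x => f x • A x) = (fun x => f x • (A + t • (1 : X → Mat d)) x)
      - t • fun x => f x • (1 : X → Mat d) x := by
    funext x
    simp only [Pi.sub_apply, Pi.add_apply, Pi.smul_apply, smul_add, smul_comm t (f x)]
    abel
  have b1 := hB.isBdd.smul_fun hf hc
  have b2 := (isBdd_one (X := X) (d := d)).smul_fun hf hc
  have hop : ∀ B : X → Mat d, IsBdd B → IsBdd (C.op B) := fun B hB =>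
    IsBdd.sum Finset.univ fun i _ =>
      ((isBdd_of_continuous (C.continuous_D i)).transpose.mul
        (hB.comp (C.continuous_s i).measurable)).mul (isBdd_of_continuous (C.continuous_D i))
  rw [es, C.op_sub, C.op_smul, hsIntegral_sub (hop _ b1) ((hop _ b2).smul t), hsIntegral_smul,
    hsIntegral_sub b1 (b2.smul t), hsIntegral_smul, e1, e2]
  ring

/-! ### Decorrelation, mixing and ergodicity -/

section Dynamics

variable [HasOuterApproxClosed X] {T : X → X} (hT : Measurable T)
  (hTs : ∀ᵐ x ∂τ.variation, ∀ i, T (C.s i x) = x)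

include hT hTs

/-- Where T inverts all branches, L(f∘T · A) = f · LA. The adjoint identity is needed for the
function f∘Tˡ⁺¹, which in general is only Borel. -/
lemma hsIntegral_comp_iterate {A : X → Mat d} (hA : IsField A) {f : X → ℝ} (hf : Measurable f)
    {c : ℝ} (hc : ∀ x, |f x| ≤ c) (l : ℕ) :
    β ^ l * hsIntegral τ (fun x => f (T^[l] x) • A x)
      = hsIntegral τ fun x => f x • C.op^[l] A x := by
  induction l generalizing A with
  | zero => simp
  | succ l ih =>
    rw [pow_succ, mul_assoc,
      ← g.adjoint_smul hA (f := fun x => f (T^[l + 1] x)) (hf.comp (hT.iterate (l + 1)))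
        (fun x => hc _),
      Function.iterate_succ_apply, ← ih (C.isField_op hA)]
    congr 1
    refine hsIntegral_congr_ae (hTs.mono fun x hx => ?_)
    simp [Cocycle.op, Function.iterate_succ_apply, hx, Finset.smul_sum]

/-- Asymptotic decorrelation for bounded Borel functions. -/
theorem decorrelation
    (hgap : ∀ A, IsField A → ∀ ε > 0, ∀ᶠ k in atTop, ∀ x v,
      |quad (C.op^[k] A x) v - β ^ k * hsIntegral τ A * quad (Q x) v| ≤ ε * β ^ k * (v ⬝ᵥ v))
    {A : X → Mat d} (hA : IsField A) {f : X → ℝ} (hf : Measurable f) {c : ℝ}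
    (hc : ∀ x, |f x| ≤ c) :
    Tendsto (fun l : ℕ => hsIntegral τ fun x => f (T^[l] x) • A x) atTop
      (𝓝 ((hsIntegral τ fun x => f x • Q x) * hsIntegral τ A)) := by
  have := isFiniteMeasure_variation g.posSemidef
  have h1 := g.hsIntegral_one_pos
  rw [Metric.tendsto_atTop']
  intro ε hε
  have hM : 0 < |c| + 1 := by positivity
  set δ : ℝ := ε / (2 * ((|c| + 1) * hsIntegral τ 1)) with hδ
  have hδ0 : 0 < δ := by positivity
  obtain ⟨K, hK⟩ := eventually_atTop.1 (hgap A hA δ hδ0)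
  refine ⟨K, fun l hl => ?_⟩
  have hp : 0 < β ^ l := pow_pos g.pos l
  set B : X → Mat d := C.op^[l] A - (β ^ l * hsIntegral τ A) • Q with hB
  have hBf : IsField B := (C.isField_iterate_op hA l).sub (g.isField.smul _)
  have key := abs_hsIntegral_le g.posSemidef (hBf.isBdd.smul_fun hf hc)
    (fun x => (hBf.isSymm x).smul (f x)) (ε := (|c| + 1) * (δ * β ^ l)) fun x v => by
      rw [quad_smul, abs_mul, mul_assoc]
      refine mul_le_mul ((hc x).trans ((le_abs_self c).trans (by linarith))) ?_ (abs_nonneg _)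
        hM.le
      rw [hB, Pi.sub_apply, Pi.smul_apply, quad_sub, quad_smul]
      exact hK l hl.le x v
  have e : (fun x => f x • B x) = (fun x => f x • C.op^[l] A x)
      - (β ^ l * hsIntegral τ A) • fun x => f x • Q x := by
    funext x
    simp only [hB, Pi.sub_apply, Pi.smul_apply, smul_sub, smul_comm (f x)]
  rw [e, hsIntegral_sub ((C.isField_iterate_op hA l).isBdd.smul_fun hf hc)
    ((g.isField.isBdd.smul_fun hf hc).smul _), hsIntegral_smul,
    ← g.hsIntegral_comp_iterate hT hTs hA hf hc l] at key
  set I := hsIntegral τ fun x => f (T^[l] x) • A x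
  set J := hsIntegral τ fun x => f x • Q x
  have e2 : β ^ l * I - β ^ l * hsIntegral τ A * J = β ^ l * (I - J * hsIntegral τ A) := by ring
  rw [e2, abs_mul, abs_of_pos hp] at key
  have e3 : (|c| + 1) * (δ * β ^ l) * hsIntegral τ 1 = β ^ l * (ε / 2) := by
    rw [hδ]
    field_simp
  rw [e3] at key
  rw [Real.dist_eq]
  exact (le_of_mul_le_mul_left key hp).trans_lt (half_lt_self hε)

theorem gibbsDynamics [TopologicalSpace.PseudoMetrizableSpace X]
    (hgap : ∀ A, IsField A → ∀ ε > 0, ∀ᶠ k in atTop, ∀ x v,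
      |quad (C.op^[k] A x) v - β ^ k * hsIntegral τ A * quad (Q x) v| ≤ ε * β ^ k * (v ⬝ᵥ v)) :
    GibbsDynamics T Q τ := by
  have := isFiniteMeasure_variation g.posSemidef
  have hQ := g.isField
  have hQp : ∀ x, (Q x).PosSemidef := fun x => (g.posDef x).posSemidef
  set κ := kusuokaMeasure Q τ with hκ
  have hκi : ∀ (f : X → ℝ) (c : ℝ), Measurable f → (∀ x, |f x| ≤ c) →
      ∫ x, f x ∂κ = hsIntegral τ fun x => f x • Q x := fun f c hf hc =>
    integral_kusuokaMeasure g.posSemidef hQ.isBdd hQp hf hc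
  have hprob : IsProbabilityMeasure κ := by
    have h1 : κ.real Set.univ = 1 := by
      rw [hκ, kusuokaMeasure_real g.posSemidef hQ.isBdd hQp MeasurableSet.univ,
        Set.indicator_univ, g.normalized]
    exact ⟨by rw [← ENNReal.toReal_eq_one_iff]; exact h1⟩
  have hind : ∀ (B : Set X) (x : X), |B.indicator (fun _ => (1 : ℝ)) x| ≤ 1 := fun B x => by
    by_cases hx : x ∈ B <;> simp [hx]
  have hinv : MeasurePreserving T κ κ := by
    refine ⟨hT, Measure.ext fun B hB => ?_⟩
    rw [Measure.map_apply hT hB, ← measureReal_eq_measureReal_iff]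
    have hm : Measurable (B.indicator fun _ => (1 : ℝ)) := measurable_const.indicator hB
    -- Invariance is the transfer identity for l = 1 and A = Q, since LQ = βQ.
    have e := g.hsIntegral_comp_iterate hT hTs hQ hm (hind B) 1
    simp only [pow_one, Function.iterate_one, g.eigen] at e
    have e' : (fun x => B.indicator (fun _ => (1 : ℝ)) x • (β • Q) x)
        = β • fun x => B.indicator (fun _ => (1 : ℝ)) x • Q x := by
      funext x
      simp only [Pi.smul_apply, smul_comm β]
    rw [e', hsIntegral_smul] at e
    have e2 := mul_left_cancel₀ g.pos.ne' e
    rw [← hκi _ 1 hm (hind B), ← hκi (fun x => B.indicator (fun _ => (1 : ℝ)) (T x)) 1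
      (hm.comp hT) fun x => hind B _] at e2
    have e3 : (fun x => B.indicator (fun _ => (1 : ℝ)) (T x))
        = (T ⁻¹' B).indicator fun _ => (1 : ℝ) := rfl
    rw [e3, integral_indicator_const _ (hT hB), integral_indicator_const _ hB] at e2
    simpa using e2
  have hdec : ∀ (φ : X → ℝ), Continuous φ → ∀ B, MeasurableSet B →
      Tendsto (fun l : ℕ => ∫ x, B.indicator (fun _ => (1 : ℝ)) (T^[l] x) * φ x ∂κ) atTop
        (𝓝 (κ.real B * ∫ x, φ x ∂κ)) := by
    intro φ hφ B hB
    have hm : Measurable (B.indicator fun _ => (1 : ℝ)) := measurable_const.indicator hB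
    obtain ⟨c, hc⟩ := isCompact_univ.exists_bound_of_continuousOn hφ.continuousOn
    have hc : ∀ x, |φ x| ≤ c := fun x => hc x (Set.mem_univ x)
    have := g.decorrelation hT hTs hgap (hQ.smul_fun hφ) hm (hind B)
    rw [← hκi _ 1 hm (hind B), ← hκi φ c hφ.measurable hc, integral_indicator_const _ hB] at this
    simp only [smul_eq_mul, mul_one] at this
    refine this.congr fun l => ?_
    rw [hκi (fun x => B.indicator (fun _ => (1 : ℝ)) (T^[l] x) * φ x) (1 * c) ((hm.comp (hT.iterate l)).mul hφ.measurable) fun x => by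
      rw [abs_mul]
      exact mul_le_mul (hind B _) (hc x) (abs_nonneg _) zero_le_one]
    simp only [smul_smul]
  have hmix : ∀ A B : Set X, MeasurableSet A → MeasurableSet B →
      Tendsto (fun l : ℕ => κ (A ∩ T^[l] ⁻¹' B)) atTop (𝓝 (κ A * κ B)) := by
    intro A B hA hB
    have hreal : Tendsto (fun l : ℕ => κ.real (A ∩ T^[l] ⁻¹' B)) atTop
        (𝓝 (κ.real A * κ.real B)) := by
      rw [Metric.tendsto_atTop']
      intro ε hε
      have hAi : Integrable (A.indicator fun _ => (1 : ℝ)) κ :=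
        (integrable_const _).indicator hA
      -- Only the indicator of A has to be continuous, because it multiplies the field Q; that of B
      -- may stay Borel. The L¹ error is uniform in l, since the other factor is bounded by 1.
      obtain ⟨φ, hφ, hφi⟩ := hAi.exists_boundedContinuous_integral_sub_le
        (show 0 < ε / 4 by positivity)
      have hlim := hdec φ φ.continuous B hB
      rw [Metric.tendsto_atTop'] at hlim
      obtain ⟨K, hK⟩ := hlim (ε / 4) (by positivity)
      refine ⟨K, fun l hl => ?_⟩
      have hm : Measurable fun x => B.indicator (fun _ => (1 : ℝ)) (T^[l] x) :=
        (measurable_const.indicator hB).comp (hT.iterate l)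
      have hdiff : Integrable (fun x => A.indicator (fun _ => (1 : ℝ)) x - φ x) κ := hAi.sub hφi
      have h1 : |∫ x, B.indicator (fun _ => (1 : ℝ)) (T^[l] x) *
          (A.indicator (fun _ => (1 : ℝ)) x - φ x) ∂κ| ≤ ε / 4 := by
        refine (abs_integral_le_integral_abs).trans (le_trans ?_ hφ)
        refine integral_mono (hdiff.bdd_mul hm.aestronglyMeasurable
          (Eventually.of_forall fun x => hind B (T^[l] x))).abs hdiff.norm fun x => ?_
        rw [abs_mul, Real.norm_eq_abs]
        exact mul_le_of_le_one_left (abs_nonneg _) (hind B _)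
      have h2 : κ.real (A ∩ T^[l] ⁻¹' B) = ∫ x, B.indicator (fun _ => (1 : ℝ)) (T^[l] x) *
          A.indicator (fun _ => (1 : ℝ)) x ∂κ := by
        have : (fun x => B.indicator (fun _ => (1 : ℝ)) (T^[l] x) *
            A.indicator (fun _ => (1 : ℝ)) x) = (A ∩ T^[l] ⁻¹' B).indicator fun _ => (1 : ℝ) := by
          funext x
          by_cases hx : x ∈ A <;> by_cases hy : T^[l] x ∈ B <;> simp [hx, hy]
        rw [this, integral_indicator_const _ (hA.inter (hT.iterate l hB))]
        simp
      have h3 : |κ.real A - ∫ x, φ x ∂κ| ≤ ε / 4 := by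
        have : κ.real A = ∫ x, A.indicator (fun _ => (1 : ℝ)) x ∂κ := by
          rw [integral_indicator_const _ hA]
          simp
        rw [this, ← integral_sub hAi hφi]
        exact (abs_integral_le_integral_abs).trans hφ
      have h4 := hK l hl
      rw [Real.dist_eq] at h4 ⊢
      have h5 : κ.real B ≤ 1 := measureReal_le_one
      have h6 : (0 : ℝ) ≤ κ.real B := measureReal_nonneg
      have h7 : ∫ x, B.indicator (fun _ => (1 : ℝ)) (T^[l] x) *
          (A.indicator (fun _ => (1 : ℝ)) x - φ x) ∂κ = κ.real (A ∩ T^[l] ⁻¹' B)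
            - ∫ x, B.indicator (fun _ => (1 : ℝ)) (T^[l] x) * φ x ∂κ := by
        rw [h2, ← integral_sub]
        · simp only [mul_sub]
        · exact hAi.bdd_mul hm.aestronglyMeasurable
            (Eventually.of_forall fun x => hind B (T^[l] x))
        · exact hφi.bdd_mul hm.aestronglyMeasurable
            (Eventually.of_forall fun x => hind B (T^[l] x))
      rw [h7] at h1
      have h8 : |κ.real B * (κ.real A - ∫ x, φ x ∂κ)| ≤ ε / 4 := by
        rw [abs_mul, abs_of_nonneg h6]
        exact (mul_le_of_le_one_left (abs_nonneg _) h5).trans h3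
      rw [abs_le] at h1 h8
      rw [abs_lt] at h4 ⊢
      constructor <;> nlinarith [h1.1, h1.2, h4.1, h4.2, h8.1, h8.2]
    rw [← ENNReal.tendsto_toReal_iff (fun l => measure_ne_top _ _)
      (ENNReal.mul_ne_top (measure_ne_top _ _) (measure_ne_top _ _)), ENNReal.toReal_mul]
    exact hreal
  refine ⟨fun f A hf hA hAs => ?_, hprob, fun B hB => ?_, hinv, ⟨hinv, hmix⟩, hinv, ⟨?_⟩⟩
  · obtain ⟨c, hc⟩ := isCompact_univ.exists_bound_of_continuousOn hf.continuousOn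
    exact g.decorrelation hT hTs hgap ⟨hA, hAs⟩ hf.measurable fun x => hc x (Set.mem_univ x)
  · rw [hsIntegral_restrict hB]
    exact kusuokaMeasure_real g.posSemidef hQ.isBdd hQp hB
  · intro B hB hTB
    have hit : ∀ l, T^[l] ⁻¹' B = B := fun l => by
      induction l with
      | zero => rfl
      | succ l ih => rw [Function.iterate_succ, Set.preimage_comp, ih, hTB]
    have h1 := hmix B B hB hB
    simp only [hit, Set.inter_self] at h1
    -- Mixing of an invariant set with itself leaves only the measures 0 and 1.
    have h2 : κ B = κ B * κ B := tendsto_nhds_unique tendsto_const_nhds h1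
    rw [Filter.eventuallyConst_set']
    by_cases h0 : κ B = 0
    · exact Or.inl (ae_eq_empty.2 h0)
    · right
      rw [ae_eq_univ, prob_compl_eq_zero_iff hB]
      have h3 : κ B * 1 = κ B * κ B := by rw [mul_one]; exact h2
      exact ((ENNReal.mul_right_inj h0 (measure_ne_top _ _)).1 h3).symm

end Dynamics

end IsGibbs

/-- Existence of a Gibbs triple, and the dynamical properties of all of them, for a contracting
cocycle. -/
theorem Cocycle.IsContracting.exists_isGibbs_and_gibbsDynamics {X : Type*} [TopologicalSpace X]
    [MeasurableSpace X] [BorelSpace X] [CompactSpace X] [T2Space X]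
    [TopologicalSpace.PseudoMetrizableSpace X] {ι : Type*} [Fintype ι] {d : ℕ}
    {C : Cocycle X ι d} {ρ : X → X → ℝ} {θ b ω K : ℝ} (h : C.IsContracting ρ θ b ω K)
    (hsep : ∀ x y, x ≠ y → ∃ g : X → ℝ, Continuous g ∧ (∃ c : ℝ, ∀ x y, |g x - g y| ≤ c * ρ x y) ∧
      g x ≠ g y) :
    (∃ β Q τ, IsGibbs C.op β Q τ) ∧ ∀ β Q τ, IsGibbs C.op β Q τ → ∀ T : X → X, Measurable T →
      (∀ᵐ x ∂τ.variation, ∀ i, T (C.s i x) = x) → GibbsDynamics T Q τ := by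
  have hex : ∀ A : X → Mat d, ∃ a, IsField A → C.HasAvg A a := fun A => by
    by_cases hA : IsField A
    · obtain ⟨a, ha⟩ := h.exists_hasAvg hsep hA
      exact ⟨a, fun _ => ha⟩
    · exact ⟨0, fun h => absurd h hA⟩
  choose ℓ hℓ using hex
  obtain ⟨β₀, Q₀, hP⟩ := h.exists_isPerron hℓ
  obtain ⟨τ₀, h₀⟩ := hP.exists_isGibbs
  exact ⟨⟨β₀, Q₀, τ₀, h₀⟩, fun β Q τ g T hT hTs =>
    g.gibbsDynamics hT hTs fun A hA ε hε => g.tendsto_of_isPerron hP hA hε⟩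

lemma dotProduct_self_ofLp {d : ℕ} (v : E d) :
    WithLp.ofLp v ⬝ᵥ WithLp.ofLp v = ‖v‖ ^ 2 := by
  rw [EuclideanSpace.real_norm_sq_eq]
  simp [dotProduct, sq]

lemma dotProduct_self_toLp {d : ℕ} (v : Fin d → ℝ) : v ⬝ᵥ v = ‖WithLp.toLp 2 v‖ ^ 2 :=
  dotProduct_self_ofLp (WithLp.toLp 2 v)

/-! ### Jacobians of the iterated function system and the choice of constants -/

namespace IFS

variable {d n : ℕ} {ν₀ η : ℝ≥0} (S : IFS d n ν₀ η)

lemma jac_mulVec (i : Fin n) (x : E d) (v : Fin d → ℝ) :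
    S.jac i x *ᵥ v = WithLp.ofLp (fderiv ℝ (S.ψ i) x (WithLp.toLp 2 v)) := by
  have hv : WithLp.toLp 2 v = ∑ l, v l • (EuclideanSpace.single l (1 : ℝ)) := by
    ext k
    simp [Finset.sum_apply, Pi.single_apply]
  funext k
  conv_rhs => rw [hv, map_sum]
  simp [Matrix.mulVec, dotProduct, jac, mul_comm]

lemma continuous_jac (i : Fin n) : Continuous (S.jac i) :=
  continuous_matrix fun k _ =>
    (PiLp.continuous_apply 2 _ k).comp
      (((S.contDiff i).continuous_fderiv one_ne_zero).clm_apply continuous_const)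

lemma norm_fderiv_le (i : Fin n) (x : E d) : ‖fderiv ℝ (S.ψ i) x‖ ≤ η :=
  norm_fderiv_le_of_lipschitz ℝ (S.lipschitz i)

/-- The chain rule for ψ_i⁻¹ ∘ ψ_i = id. -/
lemma jac_mulVec_ne_zero (i : Fin n) (x : E d) {v : Fin d → ℝ} (hv : v ≠ 0) :
    S.jac i x *ᵥ v ≠ 0 := by
  intro h0
  rw [jac_mulVec] at h0
  have h1 : fderiv ℝ (S.ψ i) x (WithLp.toLp 2 v) = 0 := by
    ext k
    exact congrFun h0 k
  have hf : HasFDerivAt (S.ψ i) (fderiv ℝ (S.ψ i) x) x :=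
    ((S.contDiff i).differentiable one_ne_zero x).hasFDerivAt
  have hg : HasFDerivAt (S.ψ i).symm (fderiv ℝ (S.ψ i).symm (S.ψ i x)) (S.ψ i x) :=
    ((S.contDiff_symm i).differentiable one_ne_zero _).hasFDerivAt
  have hc := hg.comp x hf
  have hid : (S.ψ i).symm ∘ S.ψ i = id := by
    funext y
    simp
  rw [hid] at hc
  have := congrArg (fun L : E d →L[ℝ] E d => L (WithLp.toLp 2 v)) (hc.unique (hasFDerivAt_id x))
  simp only [ContinuousLinearMap.comp_apply, h1, map_zero, ContinuousLinearMap.id_apply] at this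
  apply hv
  funext k
  exact (congrArg (fun w : E d => w k) this).symm

/-- A contraction rate that works both for the fractal and for the space of sequences. -/
def rate (ν₀ η : ℝ≥0) : ℝ := max ((η : ℝ) ^ (ν₀ : ℝ)) (1 / 2)

/-- The aperture of the invariant cones. -/
def aperture (ν₀ η : ℝ≥0) : ℝ := 3 / (1 - rate ν₀ η)

/-- A bound on the Hölder constants of the Jacobians that ensures the spectral gap. -/
def holderBound (n : ℕ) (ν₀ η : ℝ≥0) (b : ℝ) : ℝ :=
  b / (1 + 2 * n * Real.exp (aperture ν₀ η))

lemma holderBound_pos (n : ℕ) (ν₀ η : ℝ≥0) {b : ℝ} (hb : 0 < b) : 0 < holderBound n ν₀ η b := by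
  unfold holderBound
  positivity

/-- With M = 2n exp(aperture) the left side is b²M/(1 + M)². -/
lemma holderBound_small (n : ℕ) (ν₀ η : ℝ≥0) (b : ℝ) :
    2 * holderBound n ν₀ η b ^ 2 * n * Real.exp (aperture ν₀ η) ≤ b ^ 2 := by
  set M : ℝ := 2 * n * Real.exp (aperture ν₀ η) with hM
  have hM0 : 0 ≤ M := by positivity
  have e : 2 * holderBound n ν₀ η b ^ 2 * n * Real.exp (aperture ν₀ η)
      = b ^ 2 * (M / (1 + M) ^ 2) := by
    rw [holderBound, ← hM, div_pow, hM]
    ring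
  rw [e]
  refine mul_le_of_le_one_right (sq_nonneg b) ?_
  rw [div_le_one (by positivity)]
  nlinarith

/-- This is the role of the value 1/2 in the rate: η is allowed to vanish, while separating
functions on sequences require division by powers of the rate. -/
lemma rate_pos (ν₀ η : ℝ≥0) : 0 < rate ν₀ η := lt_max_of_lt_right (by norm_num)

lemma rpow_le_rate (ν₀ η : ℝ≥0) : (η : ℝ) ^ (ν₀ : ℝ) ≤ rate ν₀ η := le_max_left _ _

include S in
lemma rate_lt_one (hν₀ : 0 < ν₀) : rate ν₀ η < 1 :=
  max_lt (Real.rpow_lt_one η.2 (by exact_mod_cast S.η_lt_one) (by exact_mod_cast hν₀))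
    (by norm_num)

/-- The map p sends a point of the base to the point of the fractal where the Jacobians are taken:
the identity on the fractal, the coding map on sequences. The gauge only has to dominate the
distance to the power ν₀ of these points. -/
lemma isContracting {X : Type*} [TopologicalSpace X] [Nonempty X] {C : Cocycle X (Fin n) d}
    {b : ℝ} (hd : 0 < d) (hν₀ : 0 < ν₀) (hb : 0 < b) (hS : S.Nondegenerate b) {ω : ℝ≥0}
    (hω : (ω : ℝ) = holderBound n ν₀ η b)
    (hH : ∀ i, HolderOnWith ω ν₀ (fderiv ℝ (S.ψ i)) S.G) {p : X → S.G}
    (hD : ∀ i x, C.D i x = S.jac i (p x)) {ρ : X → X → ℝ} (h1 : ∀ x y, ρ x y ≤ 1)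
    (hsymm : ∀ x y, ρ x y = ρ y x) (hcontr : ∀ i x y, ρ (C.s i x) (C.s i y) ≤ rate ν₀ η * ρ x y)
    (hρ : ∀ x y, dist (p x) (p y) ^ (ν₀ : ℝ) ≤ ρ x y) :
    C.IsContracting ρ (rate ν₀ η) b ω (aperture ν₀ η) := by
  have hθ := S.rate_lt_one hν₀
  refine ⟨hd, inferInstance, fun x y => (Real.rpow_nonneg dist_nonneg _).trans (hρ x y), h1, hsymm,
    hcontr, (rate_pos _ _).le, hb, fun x v w => ?_, fun i x v => ?_, fun i x y v => ?_, ?_, ?_, ?_⟩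
  · obtain ⟨i, hi⟩ := hS (p x) (p x).2 (WithLp.toLp 2 v) (WithLp.toLp 2 w)
    refine ⟨i, ?_⟩
    rw [hD, jac_mulVec, dotProduct_self_toLp, dotProduct_self_toLp]
    have e : (fderiv ℝ (S.ψ i) (p x) (WithLp.toLp 2 v)).ofLp ⬝ᵥ w
        = inner ℝ (fderiv ℝ (S.ψ i) (p x) (WithLp.toLp 2 v)) (WithLp.toLp 2 w) := by
      simp [EuclideanSpace.inner_eq_star_dotProduct, dotProduct_comm]
    rw [e, ← sq_abs (inner ℝ _ _), ← mul_pow, ← mul_pow]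
    exact pow_le_pow_left₀ (by positivity) hi 2
  · rw [hD, jac_mulVec, dotProduct_self_ofLp, dotProduct_self_toLp]
    refine pow_le_pow_left₀ (norm_nonneg _) ?_ 2
    refine (ContinuousLinearMap.le_opNorm _ _).trans (mul_le_of_le_one_left (norm_nonneg _) ?_)
    exact (S.norm_fderiv_le i _).trans (by exact_mod_cast S.η_lt_one.le)
  · rw [hD, hD, Matrix.sub_mulVec, jac_mulVec, jac_mulVec, ← WithLp.ofLp_sub,
      dotProduct_self_ofLp, dotProduct_self_toLp, ← mul_pow, ← mul_pow]
    refine pow_le_pow_left₀ (norm_nonneg _) ?_ 2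
    rw [← sub_apply]
    refine (ContinuousLinearMap.le_opNorm _ _).trans
      (mul_le_mul_of_nonneg_right ?_ (norm_nonneg _))
    rw [← dist_eq_norm]
    exact ((hH i).dist_le (p x).2 (p y).2).trans (mul_le_mul_of_nonneg_left (hρ x y) ω.2)
  · exact div_nonneg (by norm_num) (sub_nonneg.2 hθ.le)
  -- Any numerator above 2 in the aperture would leave a gap between Kθ + 2 and K.
  · have h3 : aperture ν₀ η * (1 - rate ν₀ η) = 3 := div_mul_cancel₀ _ (sub_pos.2 hθ).ne'
    linarith
  · rw [hω, Fintype.card_fin]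
    exact holderBound_small n ν₀ η b

/-! ### The coding map -/

lemma word_congr {x y : ℕ → Fin n} {l : ℕ} (h : ∀ k < l, x k = y k) : S.word x l = S.word y l := by
  induction l with
  | zero => rfl
  | succ l ih =>
    rw [word, word, ih fun k hk => h k (hk.trans l.lt_succ_self), h l l.lt_succ_self]

lemma word_cons (i : Fin n) (x : ℕ → Fin n) (l : ℕ) :
    S.word (cons i x) (l + 1) = S.ψ i ∘ S.word x l := by
  induction l with
  | zero => rfl
  | succ l ih =>
    rw [word, ih]
    rfl

lemma Φ_mem (x : ℕ → Fin n) (l : ℕ) : (S.Φ x : E d) ∈ S.word x l '' S.G := by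
  have : (S.Φ x : E d) ∈ ⋂ l, S.word x l '' S.G := by rw [S.coding_eq]; rfl
  exact Set.mem_iInter.1 this l

lemma eq_Φ {x : ℕ → Fin n} {y : S.G} (h : ∀ l, (y : E d) ∈ S.word x l '' S.G) : y = S.Φ x := by
  have : (y : E d) ∈ ⋂ l, S.word x l '' S.G := Set.mem_iInter.2 h
  rw [S.coding_eq] at this
  exact Subtype.ext this

lemma Φ_cons (i : Fin n) (x : ℕ → Fin n) : S.Φ (cons i x) = S.ψG i (S.Φ x) := by
  refine (S.eq_Φ fun l => ?_).symm
  cases l with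
  | zero => exact ⟨_, (S.ψG i (S.Φ x)).2, rfl⟩
  | succ l =>
    rw [word_cons, Set.image_comp]
    exact ⟨_, S.Φ_mem x l, rfl⟩

lemma dist_Φ_le {x y : ℕ → Fin n} {l : ℕ} (h : ∀ k < l, x k = y k) :
    dist (S.Φ x) (S.Φ y) ≤ (η : ℝ) ^ l := by
  obtain ⟨u, hu, hu'⟩ := S.Φ_mem x l
  obtain ⟨v, hv, hv'⟩ := S.Φ_mem y l
  rw [Subtype.dist_eq, ← hu', ← hv', S.word_congr h]
  calc _ ≤ ((η ^ l : ℝ≥0) : ℝ) * dist u v := (S.word_lipschitz y l).dist_le_mul u v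
    _ ≤ (η : ℝ) ^ l * 1 := by
      push_cast
      gcongr
      exact (Metric.dist_le_diam_of_mem S.isCompact.isBounded hu hv).trans S.diam_le
    _ = _ := mul_one _

lemma continuous_Φ : Continuous S.Φ := by
  rw [continuous_iff_continuousAt]
  intro x
  rw [ContinuousAt, Metric.tendsto_nhds]
  intro ε hε
  obtain ⟨l, hl⟩ := exists_pow_lt_of_lt_one hε (show (η : ℝ) < 1 by exact_mod_cast S.η_lt_one)
  have hev : ∀ᶠ y in 𝓝 x, ∀ k ∈ Finset.range l, y k = x k :=
    (Filter.eventually_all_finset _).2 fun k _ =>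
      (continuous_apply k).continuousAt.eventually
        ((isOpen_discrete {x k}).mem_nhds rfl)
  filter_upwards [hev] with y hy
  exact (S.dist_Φ_le fun k hk => hy k (Finset.mem_range.2 hk)).trans_lt hl

lemma Φ_surjective : Function.Surjective S.Φ := by
  intro x
  let pre : S.G → S.G := fun y => ⟨(S.ψ (S.branch y)).symm y, S.symm_branch_mem y⟩
  -- The code of x is its itinerary under a fixed choice of inverse branches.
  refine ⟨fun k => S.branch (pre^[k] x), (S.eq_Φ fun l => ⟨(pre^[l] x : S.G), (pre^[l] x).2, ?_⟩).symm⟩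
  induction l with
  | zero => rfl
  | succ l ih =>
    rw [word, Function.comp_apply, Function.iterate_succ_apply']
    simpa [pre] using ih

/-! ### The space of sequences -/

lemma shift_cons (i : Fin n) (x : ℕ → Fin n) : shift (cons i x) = x := rfl

lemma continuous_cons (i : Fin n) : Continuous (cons i) :=
  continuous_pi fun k => by
    cases k with
    | zero => exact continuous_const
    | succ k => exact continuous_apply k

lemma measurable_shift : Measurable (shift (n := n)) :=
  measurable_pi_lambda _ fun k => measurable_pi_apply (k + 1)

/-- The cocycle of the Jacobians over the space of sequences. -/
def cocycleSigma : Cocycle (ℕ → Fin n) (Fin n) d where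
  s := cons
  D i x := S.jac i (S.Φ x)
  continuous_s := continuous_cons
  continuous_D i := (S.continuous_jac i).comp (continuous_subtype_val.comp S.continuous_Φ)

open scoped Classical in
/-- The distance on the space of sequences for which words of length `l` have diameter `θ ^ l`. -/
def seqDist (θ : ℝ) (x y : ℕ → Fin n) : ℝ := if x = y then 0 else θ ^ PiNat.firstDiff x y

lemma seqDist_of_ne (θ : ℝ) {x y : ℕ → Fin n} (h : x ≠ y) :
    seqDist θ x y = θ ^ PiNat.firstDiff x y := if_neg h

lemma seqDist_self (θ : ℝ) (x : ℕ → Fin n) : seqDist θ x x = 0 := if_pos rfl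

lemma seqDist_cons (θ : ℝ) (i : Fin n) (x y : ℕ → Fin n) :
    seqDist θ (cons i x) (cons i y) = θ * seqDist θ x y := by
  by_cases hxy : x = y
  · simp [hxy, seqDist_self]
  · have hne : cons i x ≠ cons i y := fun h => hxy (congrArg shift h)
    have hfd : PiNat.firstDiff (cons i x) (cons i y) = PiNat.firstDiff x y + 1 := by
      refine le_antisymm ?_ ?_
      · by_contra hlt
        exact PiNat.apply_firstDiff_ne hxy
          (PiNat.apply_eq_of_lt_firstDiff (x := cons i x) (y := cons i y) (not_le.1 hlt))
      · by_contra hlt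
        apply PiNat.apply_firstDiff_ne hne
        have hle := Nat.lt_succ_iff.1 (not_le.1 hlt)
        generalize PiNat.firstDiff (cons i x) (cons i y) = m at hle
        cases m with
        | zero => rfl
        | succ m => exact PiNat.apply_eq_of_lt_firstDiff (x := x) (y := y) hle
    rw [seqDist_of_ne θ hne, seqDist_of_ne θ hxy, hfd, pow_succ']

lemma exists_separating_seqDist {θ : ℝ} (h0 : 0 < θ) (h1 : θ ≤ 1) {x y : ℕ → Fin n} (hxy : x ≠ y) :
    ∃ g : (ℕ → Fin n) → ℝ, Continuous g ∧
      (∃ c : ℝ, ∀ z w, |g z - g w| ≤ c * seqDist θ z w) ∧ g x ≠ g y := by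
  set m := PiNat.firstDiff x y with hm
  -- A function of the coordinate m alone varies only between sequences that differ at or before m,
  -- whose gauge is at least θᵐ.
  let χ : Fin n → ℝ := fun i => if i = x m then 1 else 0
  refine ⟨fun z => χ (z m), (continuous_of_discreteTopology (f := χ)).comp (continuous_apply m),
    ⟨(θ ^ m)⁻¹, fun z w => ?_⟩, ?_⟩
  · have hp : 0 < θ ^ m := pow_pos h0 m
    by_cases hzw : z m = w m
    · simp only [hzw, sub_self, abs_zero]
      refine mul_nonneg (inv_nonneg.2 hp.le) ?_
      unfold seqDist
      split_ifs
      · exact le_rfl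
      · exact (pow_pos h0 _).le
    · have hne : z ≠ w := fun h => hzw (by rw [h])
      have hle : PiNat.firstDiff z w ≤ m := by
        by_contra hlt
        exact hzw (PiNat.apply_eq_of_lt_firstDiff (not_le.1 hlt))
      rw [seqDist_of_ne θ hne]
      calc |χ (z m) - χ (w m)| ≤ 1 := by
            simp only [χ]
            split_ifs <;> simp
        _ = (θ ^ m)⁻¹ * θ ^ m := (inv_mul_cancel₀ hp.ne').symm
        _ ≤ _ := mul_le_mul_of_nonneg_left (pow_le_pow_of_le_one h0.le h1 hle)
            (inv_nonneg.2 hp.le)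
  · have : y m ≠ x m := (PiNat.apply_firstDiff_ne hxy).symm
    simp [χ, this]

lemma isContracting_cocycleSigma {b : ℝ} (hd : 0 < d) (hν₀ : 0 < ν₀) (hb : 0 < b)
    (hS : S.Nondegenerate b) {ω : ℝ≥0} (hω : (ω : ℝ) = holderBound n ν₀ η b)
    (hH : ∀ i, HolderOnWith ω ν₀ (fderiv ℝ (S.ψ i)) S.G) :
    S.cocycleSigma.IsContracting (seqDist (rate ν₀ η)) (rate ν₀ η) b ω (aperture ν₀ η) := by
  have hθ := S.rate_lt_one hν₀
  have hθ0 := rate_pos ν₀ η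
  have : Nonempty (ℕ → Fin n) :=
    ⟨(S.Φ_surjective ⟨_, S.nonempty.some_mem⟩).choose⟩
  refine S.isContracting (p := S.Φ) hd hν₀ hb hS hω hH (fun _ _ => rfl) (fun x y => ?_)
    (fun x y => ?_) (fun i x y => (seqDist_cons _ i x y).le) (fun x y => ?_)
  · unfold seqDist
    split_ifs
    · exact zero_le_one
    · exact pow_le_one₀ hθ0.le hθ.le
  · by_cases hxy : x = y
    · rw [hxy]
    · rw [seqDist_of_ne _ hxy, seqDist_of_ne _ (Ne.symm hxy), PiNat.firstDiff_comm]
  · by_cases hxy : x = y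
    · rw [hxy, seqDist_self, dist_self, Real.zero_rpow (by exact_mod_cast hν₀.ne')]
    · rw [seqDist_of_ne _ hxy]
      have h1 := S.dist_Φ_le fun k hk => PiNat.apply_eq_of_lt_firstDiff (x := x) (y := y) hk
      calc _ ≤ ((η : ℝ) ^ PiNat.firstDiff x y) ^ (ν₀ : ℝ) :=
            Real.rpow_le_rpow dist_nonneg h1 ν₀.2
        _ = ((η : ℝ) ^ (ν₀ : ℝ)) ^ PiNat.firstDiff x y := by
            rw [← Real.rpow_natCast, ← Real.rpow_natCast, ← Real.rpow_mul (NNReal.coe_nonneg η),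
              ← Real.rpow_mul (NNReal.coe_nonneg η), mul_comm]
        _ ≤ _ := pow_le_pow_left₀ (Real.rpow_nonneg η.2 _) (rpow_le_rate ν₀ η) _

theorem gibbs_sigma {b : ℝ} (hd : 0 < d) (hν₀ : 0 < ν₀) (hb : 0 < b)
    (hS : S.Nondegenerate b) {ω : ℝ≥0} (hω : (ω : ℝ) = holderBound n ν₀ η b)
    (hH : ∀ i, HolderOnWith ω ν₀ (fderiv ℝ (S.ψ i)) S.G) :
    (∃ β Q τ, IsGibbs S.ruelleSigma β Q τ) ∧
      ∀ β Q τ, IsGibbs S.ruelleSigma β Q τ → GibbsDynamics shift Q τ := by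
  obtain ⟨hex, hall⟩ :=
    (S.isContracting_cocycleSigma hd hν₀ hb hS hω hH).exists_isGibbs_and_gibbsDynamics
      fun x y hxy => exists_separating_seqDist (rate_pos ν₀ η) (S.rate_lt_one hν₀).le hxy
  exact ⟨hex, fun β Q τ g => hall β Q τ g shift measurable_shift
    (Eventually.of_forall fun x i => shift_cons i x)⟩

/-! ### The fractal -/

/-- The cocycle of the Jacobians over the fractal. -/
def cocycleG : Cocycle S.G (Fin n) d where
  s := S.ψG
  D i x := S.jac i x
  continuous_s i := (S.contracting i).toLipschitzWith.continuous
  continuous_D i := (S.continuous_jac i).comp continuous_subtype_val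

lemma dist_le_one (x y : S.G) : dist x y ≤ 1 :=
  (Metric.dist_le_diam_of_mem S.isCompact.isBounded x.2 y.2).trans S.diam_le

lemma isContracting_cocycleG {b : ℝ} (hd : 0 < d) (hν₀ : 0 < ν₀) (hb : 0 < b)
    (hS : S.Nondegenerate b) {ω : ℝ≥0} (hω : (ω : ℝ) = holderBound n ν₀ η b)
    (hH : ∀ i, HolderOnWith ω ν₀ (fderiv ℝ (S.ψ i)) S.G) :
    S.cocycleG.IsContracting (fun x y => dist x y ^ (ν₀ : ℝ)) (rate ν₀ η) b ω
      (aperture ν₀ η) := by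
  have : Nonempty S.G := S.nonempty.to_subtype
  refine S.isContracting (p := id) hd hν₀ hb hS hω hH (fun _ _ => rfl)
    (fun x y => Real.rpow_le_one dist_nonneg (S.dist_le_one x y) ν₀.2)
    (fun x y => by rw [dist_comm]) (fun i x y => ?_) fun x y => le_rfl
  calc _ ≤ ((η : ℝ) * dist x y) ^ (ν₀ : ℝ) := Real.rpow_le_rpow dist_nonneg
        ((S.contracting i).toLipschitzWith.dist_le_mul x y) ν₀.2
    _ = (η : ℝ) ^ (ν₀ : ℝ) * dist x y ^ (ν₀ : ℝ) := Real.mul_rpow η.2 dist_nonneg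
    _ ≤ _ := mul_le_mul_of_nonneg_right (rpow_le_rate ν₀ η) (Real.rpow_nonneg dist_nonneg _)

/-- Distance functions separate; they are Lipschitz for the gauge because distances are at most 1
and ν₀ ≤ 1, so that t ≤ t^ν₀. -/
lemma exists_separating_dist (hν₀' : ν₀ ≤ 1) {x y : S.G} (hxy : x ≠ y) :
    ∃ g : S.G → ℝ, Continuous g ∧
      (∃ c : ℝ, ∀ z w, |g z - g w| ≤ c * dist z w ^ (ν₀ : ℝ)) ∧ g x ≠ g y := by
  refine ⟨fun z => dist z x, continuous_id.dist continuous_const, ⟨1, fun z w => ?_⟩, ?_⟩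
  · rw [one_mul]
    refine (abs_dist_sub_le z w x).trans ?_
    rcases eq_or_lt_of_le (dist_nonneg (x := z) (y := w)) with h0 | h0
    · rw [← h0]
      exact Real.rpow_nonneg le_rfl _
    · conv_lhs => rw [← Real.rpow_one (dist z w)]
      exact Real.rpow_le_rpow_of_exponent_ge h0 (S.dist_le_one z w) (by exact_mod_cast hν₀')
  · beta_reduce
    rw [dist_self]
    exact (dist_pos.2 hxy.symm).ne

end IFS

/-! ### Atoms of positive semidefinite matrix measures -/

section Atoms

variable {X : Type*} [MeasurableSpace X] {d : ℕ} {τ : MatMeasure X d}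

lemma variation_le_trace (hτ : ∀ B, MeasurableSet B → (τ B).PosSemidef) :
    ∃ C : ℝ≥0, τ.variation ≤ C • kusuokaMeasure 1 τ := by
  have := isFiniteMeasure_variation hτ
  obtain ⟨C, hC⟩ := exists_norm_le_of_entry d
  refine ⟨C, VectorMeasure.variation_le_of_forall_enorm_le fun B hB => ?_⟩
  have h1 : ‖τ B‖ ≤ C * (kusuokaMeasure 1 τ).real B := by
    rw [kusuokaMeasure_real hτ isBdd_one (fun _ => Matrix.PosSemidef.one) hB]
    have h2 : hsIntegral τ (B.indicator 1) = (τ B).trace := by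
      have := hsIntegral_indicator_const (τ := τ) hB 1
      rw [hs_apply, Matrix.transpose_one, Matrix.one_mul] at this
      exact this
    rw [h2]
    exact hC _ _ (entry_mul_self_le (hτ B hB))
  rw [← ofReal_norm, Measure.smul_apply]
  refine (ENNReal.ofReal_le_ofReal h1).trans (le_of_eq ?_)
  rw [ENNReal.ofReal_mul (NNReal.coe_nonneg C), measureReal_def,
    ENNReal.ofReal_toReal (measure_ne_top _ _)]
  simp [ENNReal.smul_def]

lemma variation_singleton_eq_zero [MeasurableSingletonClass X]
    (hτ : ∀ B, MeasurableSet B → (τ B).PosSemidef) {x : X} (hx : τ {x} = 0) :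
    τ.variation {x} = 0 := by
  have := isFiniteMeasure_variation hτ
  obtain ⟨C, hC⟩ := variation_le_trace hτ
  have h0 : kusuokaMeasure 1 τ {x} = 0 := by
    rw [← measureReal_eq_zero_iff, kusuokaMeasure_real hτ isBdd_one (fun _ => Matrix.PosSemidef.one)
      (measurableSet_singleton x)]
    have := hsIntegral_indicator_const (τ := τ) (measurableSet_singleton x) 1
    rw [hx, map_zero] at this
    exact this
  refine le_antisymm ((hC {x}).trans ?_) bot_le
  rw [Measure.smul_apply, h0, smul_zero]

/-- A non-negative field dominates its restriction to a point, so an integral bounds the mass of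
each atom. -/
lemma hs_singleton_le_hsIntegral [MeasurableSingletonClass X]
    (hτ : ∀ B, MeasurableSet B → (τ B).PosSemidef) {A : X → Mat d} (hA : IsBdd A)
    (hAs : ∀ y, (A y).IsSymm) (hpos : ∀ y v, 0 ≤ quad (A y) v) {M : Mat d} (hM : M.IsSymm) {x : X}
    (hle : ∀ v, quad M v ≤ quad (A x) v) : hs d M (τ {x}) ≤ hsIntegral τ A := by
  classical
  have := isFiniteMeasure_variation hτ
  rw [← hsIntegral_indicator_const (measurableSet_singleton x) M]
  refine hsIntegral_mono hτ ((isBdd_const M).indicator (measurableSet_singleton x)) hA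
    (fun y => ?_) hAs fun y v => ?_
  · by_cases hy : y = x
    · simpa [hy] using hM
    · simp [hy]
  · by_cases hy : y = x
    · simpa [hy] using hle v
    · simpa [hy, quad_zero] using hpos y v

end Atoms

/-! ### Absence of atoms at the postcritical points -/

namespace IFS

variable {d n : ℕ} {ν₀ η : ℝ≥0} (S : IFS d n ν₀ η)

/-- The points of the fractal coded by the postcritical sequences. -/
def postcriticalPts : Set S.G :=
  S.Φ '' ⋃ (j : ℕ) (_ : 1 ≤ j), shift^[j] '' (S.Φ ⁻¹' (Subtype.val ⁻¹' S.overlap))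

lemma finite_postcriticalPts (h : S.IsPCF) : S.postcriticalPts.Finite := h.postcritical.image _

/-- If v codes x, then iv codes ψ_i x, and its first shift is v. -/
lemma mem_postcriticalPts_of_mem_overlap {i : Fin n} {x : S.G}
    (h : (S.ψG i x : E d) ∈ S.overlap) : x ∈ S.postcriticalPts := by
  obtain ⟨v, rfl⟩ := S.Φ_surjective x
  refine ⟨v, Set.mem_iUnion₂.2 ⟨1, le_rfl, cons i v, ?_, shift_cons i v⟩, rfl⟩
  rw [Set.mem_preimage, Set.mem_preimage, Φ_cons]
  exact h

lemma injective_ψG (i : Fin n) : Function.Injective (S.ψG i) := fun _ _ h =>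
  Subtype.ext ((S.ψ i).injective (congrArg Subtype.val h))

lemma cons_shift (w : ℕ → Fin n) : cons (w 0) (shift w) = w := by
  funext k
  cases k <;> rfl

/-- Take a postcritical code of ψ_i x. If it begins with i, its shift codes x and is again
postcritical; otherwise ψ_i x lies in two cells, hence in the overlap. -/
lemma mem_postcriticalPts_of_ψG_mem {i : Fin n} {x : S.G} (h : S.ψG i x ∈ S.postcriticalPts) :
    x ∈ S.postcriticalPts := by
  obtain ⟨w, hw, hwx⟩ := h
  have hw' := S.Φ_cons (w 0) (shift w)
  rw [cons_shift, hwx] at hw'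
  by_cases hi : w 0 = i
  · rw [hi] at hw'
    obtain ⟨j, hj, u, hu, rfl⟩ := Set.mem_iUnion₂.1 hw
    refine ⟨shift (shift^[j] u), Set.mem_iUnion₂.2 ⟨j + 1, hj.trans j.le_succ, u, hu, ?_⟩,
      (S.injective_ψG i hw').symm⟩
    rw [Function.iterate_succ_apply']
  · refine S.mem_postcriticalPts_of_mem_overlap (i := i) (Set.mem_iUnion₂.2 ⟨w 0, i,
      Set.mem_iUnion.2 ⟨hi, ?_, ⟨x, x.2, rfl⟩⟩⟩)
    rw [hw']
    exact ⟨_, (S.Φ (shift w)).2, rfl⟩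

/-- There is no finite invariant set of postcritical points. -/
lemma eq_empty_of_mapsTo (h : S.IsPCF) {P : Set S.G} (hP : P ⊆ S.postcriticalPts)
    (hmaps : ∀ i, Set.MapsTo (S.ψG i) P P) : P = ∅ := by
  by_contra hne
  have hne := Set.nonempty_iff_ne_empty.2 hne
  have hfin : P.Finite := (S.finite_postcriticalPts h).subset hP
  have hfin' : Finite P := hfin.to_subtype
  -- Each ψ_i is injective on the finite set P, hence permutes it. A pair at maximal distance is
  -- then the image of a pair that is no further apart, which for a strict contraction forces
  -- distance zero.
  have hsurj : ∀ i, ∀ p ∈ P, ∃ q ∈ P, S.ψG i q = p := fun i p hp => by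
    have hinj : Function.Injective ((hmaps i).restrict (S.ψG i) P P) :=
      (hmaps i).restrict_inj.2 (S.injective_ψG i).injOn
    obtain ⟨q, hq⟩ := Finite.surjective_of_injective hinj ⟨p, hp⟩
    exact ⟨q, q.2, congrArg Subtype.val hq⟩
  obtain ⟨i⟩ : Nonempty (Fin n) := ⟨S.branch hne.some⟩
  have hsub : P.Subsingleton := by
    obtain ⟨⟨p, q⟩, ⟨hp, hq⟩, hmax⟩ := Set.exists_max_image (P ×ˢ P)
      (fun z : S.G × S.G => dist z.1 z.2) (hfin.prod hfin) (hne.prod hne)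
    obtain ⟨p', hp', rfl⟩ := hsurj i p hp
    obtain ⟨q', hq', rfl⟩ := hsurj i q hq
    have h1 := (S.contracting i).toLipschitzWith.dist_le_mul p' q'
    have h2 := hmax (p', q') ⟨hp', hq'⟩
    have h3 : (η : ℝ) < 1 := by exact_mod_cast S.η_lt_one
    have h4 : dist (S.ψG i p') (S.ψG i q') ≤ 0 := by
      have h5 : (η : ℝ) * dist p' q' ≤ η * dist (S.ψG i p') (S.ψG i q') :=
        mul_le_mul_of_nonneg_left h2 η.2
      nlinarith [dist_nonneg (x := S.ψG i p') (y := S.ψG i q')]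
    intro y hy z hz
    exact dist_le_zero.1 ((hmax (y, z) ⟨hy, hz⟩).trans h4)
  obtain ⟨a, ha⟩ := hne
  have hfix : ∀ i, S.ψG i a = a := fun i => hsub (hmaps i ha) ha
  have hword : ∀ w l, S.word w l (a : E d) = a := fun w l => by
    induction l with
    | zero => rfl
    | succ l ih =>
      rw [word, Function.comp_apply, show S.ψ (w l) (a : E d) = a from congrArg Subtype.val (hfix _),
        ih]
  have hΦ : ∀ w, S.Φ w = a := fun w => (S.eq_Φ fun l => ⟨a, a.2, hword w l⟩).symm
  obtain ⟨w, hw, -⟩ := hP ha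
  obtain ⟨j, hj, u, hu, -⟩ := Set.mem_iUnion₂.1 hw
  -- All sequences code the common fixed point a. One of them codes an overlap point, so a is in the
  -- overlap, and each sequence is the shift of one that codes an overlap point.
  have hov : (a : E d) ∈ S.overlap := by
    rw [← hΦ u]
    exact hu
  obtain ⟨k, l, hkl⟩ := Set.mem_iUnion₂.1 hov
  obtain ⟨hkl, -⟩ := Set.mem_iUnion.1 hkl
  have hnt : Nontrivial (Fin n) := ⟨k, l, hkl⟩
  refine Set.infinite_univ (α := ℕ → Fin n) (h.postcritical.subset fun v _ => ?_)
  refine Set.mem_iUnion₂.2 ⟨1, le_rfl, cons k v, ?_, shift_cons k v⟩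
  rw [Set.mem_preimage, hΦ]
  exact hov

variable {S} {β : ℝ} {Q : S.G → Mat d} {τ : MatMeasure S.G d}

/-- A Gibbs measure has no atoms at the postcritical points. -/
lemma apply_singleton_eq_zero (h : S.IsPCF) (g : IsGibbs S.ruelleG β Q τ) {x : S.G}
    (hx : x ∈ S.postcriticalPts) : τ {x} = 0 := by
  classical
  have g : IsGibbs S.cocycleG.op β Q τ := g
  have : CompactSpace S.G := isCompact_iff_compactSpace.1 S.isCompact
  have hfinm := isFiniteMeasure_variation g.posSemidef
  set P := S.postcriticalPts with hPdef
  have hPm : MeasurableSet P := (S.finite_postcriticalPts h).measurableSet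
  let M : Fin n → S.G → Mat d := fun i y => (S.jac i y)ᵀ * Q (S.ψG i y) * S.jac i y
  have hMs : ∀ i y, (M i y).IsSymm := fun i y => by
    simp only [M, Matrix.IsSymm, Matrix.transpose_mul, Matrix.transpose_transpose,
      (g.isField.isSymm _).eq, Matrix.mul_assoc]
  have hMpos : ∀ i y, (M i y).PosDef := fun i y => by
    refine (posDef_iff_quad _).2 ⟨hMs i y, fun v hv => ?_⟩
    rw [quad_conj]
    exact ((posDef_iff_quad _).1 (g.posDef _)).2 _ (S.jac_mulVec_ne_zero i y hv)
  have hMnn : ∀ i y v, 0 ≤ quad (M i y) v := fun i y =>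
    ((posSemidef_iff_quad _).1 (hMpos i y).posSemidef).2
  have hMb : ∀ i, IsBdd (M i) := fun i => isBdd_of_continuous
    (((S.cocycleG.continuous_D i).matrix_transpose.matrix_mul
      (g.isField.continuous.comp (S.cocycleG.continuous_s i))).matrix_mul
        (S.cocycleG.continuous_D i))
  have hop : ∀ f : S.G → ℝ, S.cocycleG.op (fun y => f y • Q y)
      = fun y => ∑ i, f (S.ψG i y) • M i y := fun f => by
    funext y
    simp [Cocycle.op, cocycleG, M]
  have hψm : ∀ i, Measurable (S.ψG i) := fun i => (S.cocycleG.continuous_s i).measurable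
  have hind : ∀ (B : Set S.G) (y : S.G), |B.indicator (fun _ => (1 : ℝ)) y| ≤ 1 := fun B y => by
    by_cases hy : y ∈ B <;> simp [hy]
  have hind0 : ∀ (B : Set S.G) (y : S.G), 0 ≤ B.indicator (fun _ => (1 : ℝ)) y := fun B y =>
    Set.indicator_nonneg (fun _ _ => zero_le_one) y
  have hbdd : ∀ B : Set S.G, MeasurableSet B →
      IsBdd fun y => ∑ i, B.indicator (fun _ => (1 : ℝ)) (S.ψG i y) • M i y := fun B hB =>
    IsBdd.sum Finset.univ fun i _ =>
      (hMb i).smul_fun (f := fun y => B.indicator (fun _ => (1 : ℝ)) (S.ψG i y))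
        ((measurable_const.indicator hB).comp (hψm i)) fun y => hind B _
  have hadj : ∀ B : Set S.G, MeasurableSet B →
      hsIntegral τ (fun y => ∑ i, B.indicator (fun _ => (1 : ℝ)) (S.ψG i y) • M i y)
        = β * hsIntegral τ fun y => B.indicator (fun _ => (1 : ℝ)) y • Q y := fun B hB => by
    rw [← hop]
    exact g.adjoint_smul g.isField (measurable_const.indicator hB) (hind B)
  have hzero : ∀ i y, hs d (M i y) (τ {y}) ≤ 0 → τ {y} = 0 := fun i y hle =>
    eq_zero_of_hs_eq_zero (hMpos i y) (g.posSemidef _ (measurableSet_singleton y))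
      (le_antisymm hle (hs_nonneg (hMpos i y).posSemidef
        (g.posSemidef _ (measurableSet_singleton y))))
  have hterm : ∀ (c : Fin n → ℝ) (y : S.G) (v : Fin d → ℝ), (∀ j, 0 ≤ c j) →
      ∀ j ∈ Finset.univ, 0 ≤ quad (c j • M j y) v := fun c y v hc j _ => by
    rw [quad_smul]
    exact mul_nonneg (hc j) (hMnn j y v)
  -- Conservation of mass: P contains its preimages under the branches, so βQ·1_P - L(1_P Q) is a
  -- non-negative field, and its integral is zero. A mass at a point of P that some branch sends out
  -- of P would make this integral positive.
  have hstay : ∀ i, ∀ y ∈ P, τ {y} ≠ 0 → S.ψG i y ∈ P := by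
    intro i y hy hτy
    by_contra hni
    apply hτy
    refine hzero i y ?_
    let c : S.G → Fin n → ℝ := fun z j =>
      P.indicator (fun _ => (1 : ℝ)) z - P.indicator (fun _ => (1 : ℝ)) (S.ψG j z)
    have hc : ∀ z j, 0 ≤ c z j := fun z j => by
      by_cases hz : z ∈ P
      · have := le_of_abs_le (hind P (S.ψG j z))
        simp only [c, Set.indicator_of_mem hz]
        linarith
      · have : S.ψG j z ∉ P := fun hj => hz (S.mem_postcriticalPts_of_ψG_mem hj)
        simp [c, hz, this]
    have hQb := g.isField.isBdd.smul_fun (measurable_const.indicator hPm) (hind P)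
    have e : (fun z => ∑ j, c z j • M j z)
        = (β • fun z => P.indicator (fun _ => (1 : ℝ)) z • Q z)
          - fun z => ∑ j, P.indicator (fun _ => (1 : ℝ)) (S.ψG j z) • M j z := by
      funext z
      have hz : β • Q z = ∑ j, M j z := (congrFun g.eigen z).symm
      simp only [Pi.sub_apply, Pi.smul_apply, smul_comm β, hz, Finset.smul_sum, c, sub_smul,
        Finset.sum_sub_distrib]
    have hint : hsIntegral τ (fun z => ∑ j, c z j • M j z) = 0 := by
      rw [e, hsIntegral_sub (hQb.smul β) (hbdd P hPm), hsIntegral_smul, hadj P hPm, sub_self]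
    rw [← hint]
    refine hs_singleton_le_hsIntegral g.posSemidef (by rw [e]; exact (hQb.smul β).sub (hbdd P hPm))
      (fun z => ?_) (fun z v => ?_) (hMs i y) fun v => ?_
    · exact Matrix.IsSymm.ext fun k l => by
        simp only [Matrix.sum_apply, Matrix.smul_apply, (hMs _ z).apply k l]
    · rw [quad_sum]
      exact Finset.sum_nonneg (hterm _ z v (hc z))
    · rw [quad_sum]
      refine le_trans (le_of_eq ?_) (Finset.single_le_sum (hterm _ y v (hc y)) (Finset.mem_univ i))
      simp [c, hy, hni]
  -- By the adjoint identity for the indicator of ψ_i y times Q, the mass at ψ_i y controls the mass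
  -- at y, through a matrix that is positive definite because the Jacobian is injective.
  have hcharge : ∀ i y, τ {y} ≠ 0 → τ {S.ψG i y} ≠ 0 := by
    intro i y hτy h0
    apply hτy
    refine hzero i y ?_
    set B : Set S.G := {S.ψG i y} with hB
    have hBm : MeasurableSet B := measurableSet_singleton _
    have e : (fun z => B.indicator (fun _ => (1 : ℝ)) z • Q z)
        = B.indicator fun _ => Q (S.ψG i y) := by
      funext z
      by_cases hz : z = S.ψG i y <;> simp [hB, hz]
    have hint : hsIntegral τ (fun z => ∑ j, B.indicator (fun _ => (1 : ℝ)) (S.ψG j z) • M j z)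
        = 0 := by
      rw [hadj B hBm, e, hsIntegral_indicator_const hBm, h0, map_zero, mul_zero]
    rw [← hint]
    refine hs_singleton_le_hsIntegral g.posSemidef (hbdd B hBm)
      (fun z => ?_) (fun z v => ?_) (hMs i y) fun v => ?_
    · exact Matrix.IsSymm.ext fun k l => by
        simp only [Matrix.sum_apply, Matrix.smul_apply, (hMs _ z).apply k l]
    · rw [quad_sum]
      exact Finset.sum_nonneg (hterm _ z v fun j => hind0 B _)
    · rw [quad_sum]
      refine le_trans (le_of_eq ?_) (Finset.single_le_sum (hterm _ y v fun j => hind0 B _)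
        (Finset.mem_univ i))
      simp [hB]
  have hempty := S.eq_empty_of_mapsTo h (P := {y | y ∈ P ∧ τ {y} ≠ 0}) (fun y hy => hy.1)
    fun i y hy => ⟨hstay i y hy.1 hy.2, hcharge i y hy.2⟩
  by_contra hne
  exact (Set.eq_empty_iff_forall_notMem.1 hempty x) ⟨hx, hne⟩

lemma variation_postcriticalPts (h : S.IsPCF) (g : IsGibbs S.ruelleG β Q τ) :
    τ.variation S.postcriticalPts = 0 := by
  rw [← Set.biUnion_of_singleton S.postcriticalPts,
    measure_biUnion_null_iff (S.finite_postcriticalPts h).countable]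
  exact fun x hx => variation_singleton_eq_zero g.posSemidef (apply_singleton_eq_zero h g hx)

variable (S)

lemma finite_overlap (h : S.IsPCF) : S.overlap.Finite :=
  Set.finite_iUnion fun i => Set.finite_iUnion fun j => Set.finite_iUnion fun hij =>
    h.finite_inter i j hij

/-- The arbitrary values of F sit on a finite set, where they cannot spoil measurability. Elsewhere
F is given by finitely many continuous inverses on compact cells. -/
lemma measurable_F (h : S.IsPCF) (c : S.G → Fin n) : Measurable (S.F c) := by
  set O : Set S.G := Subtype.val ⁻¹' S.overlap
  have hO : O.Finite := (S.finite_overlap h).preimage Subtype.val_injective.injOn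
  have hG : MeasurableSet S.G := S.isCompact.isClosed.measurableSet
  refine measurable_of_measurable_on_compl_finite O hO fun B hB => ?_
  have hB' : MeasurableSet (Subtype.val '' B : Set (E d)) :=
    (MeasurableEmbedding.subtype_coe hG).measurableSet_image.2 hB
  have e : (Oᶜ.domRestrict (S.F c)) ⁻¹' B = Subtype.val ⁻¹' (Subtype.val ⁻¹'
      (⋃ i, (S.ψ i '' S.G) ∩ (S.ψ i).symm ⁻¹' (Subtype.val '' B)) : Set S.G) := by
    ext ⟨x, hx⟩
    simp only [Set.mem_preimage, Set.mem_iUnion, Set.mem_inter_iff]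
    constructor
    · intro hxB
      obtain ⟨i, hi⟩ := S.exists_branch x
      exact ⟨i, hi, ⟨_, hxB, S.F_apply c hx hi⟩⟩
    · rintro ⟨i, hi, y, hy, hyx⟩
      have : S.F c x = y := Subtype.ext ((S.F_apply c hx hi).trans hyx.symm)
      change S.F c x ∈ B
      rwa [this]
  rw [e]
  refine measurable_subtype_coe (measurable_subtype_coe (MeasurableSet.iUnion fun i => ?_))
  exact (S.isCompact.image (S.lipschitz i).continuous).isClosed.measurableSet.inter
    ((S.contDiff_symm i).continuous.measurable hB')

lemma F_ψG (c : S.G → Fin n) {x : S.G} (hx : x ∉ S.postcriticalPts) (i : Fin n) :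
    S.F c (S.ψG i x) = x := by
  have hov : (S.ψG i x : E d) ∉ S.overlap := fun hov =>
    hx (S.mem_postcriticalPts_of_mem_overlap hov)
  refine Subtype.ext ((S.F_apply c hov ⟨x, x.2, rfl⟩).trans ?_)
  simp [ψG]

theorem gibbs_G {b : ℝ} (hd : 0 < d) (hν₀ : 0 < ν₀) (hν₀' : ν₀ ≤ 1) (hb : 0 < b) (h : S.IsPCF)
    (hS : S.Nondegenerate b) {ω : ℝ≥0} (hω : (ω : ℝ) = holderBound n ν₀ η b)
    (hH : ∀ i, HolderOnWith ω ν₀ (fderiv ℝ (S.ψ i)) S.G) :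
    (∃ β Q τ, IsGibbs S.ruelleG β Q τ) ∧
      ∀ β Q τ, IsGibbs S.ruelleG β Q τ → ∀ c : S.G → Fin n, GibbsDynamics (S.F c) Q τ := by
  have : CompactSpace S.G := isCompact_iff_compactSpace.1 S.isCompact
  obtain ⟨hex, hall⟩ :=
    (S.isContracting_cocycleG hd hν₀ hb hS hω hH).exists_isGibbs_and_gibbsDynamics
      fun x y hxy => S.exists_separating_dist hν₀' hxy
  refine ⟨hex, fun β Q τ g c => hall β Q τ g (S.F c) (S.measurable_F h c) ?_⟩
  filter_upwards [measure_eq_zero_iff_ae_notMem.1 (variation_postcriticalPts h g)] with x hx i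
  exact S.F_ψG c hx i

end IFS

end Kusuoka

end

theorem lemma4p8 (d n : ℕ) (hd : 0 < d) (ν₀ η : ℝ≥0) (hν₀ : 0 < ν₀) (hν₀' : ν₀ ≤ 1)
    (b : ℝ) (hb : 0 < b) :
    ∃ ω : ℝ≥0, 0 < ω ∧ ∀ S : Kusuoka.IFS d n ν₀ η, S.IsPCF → S.Nondegenerate b →
      (∀ i, HolderOnWith ω ν₀ (fderiv ℝ (S.ψ i)) S.G) →
      -- the case of the fractal `G` with the expanding map `F`
      ((∃ β Q τ, Kusuoka.IsGibbs S.ruelleG β Q τ) ∧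
        ∀ β Q τ, Kusuoka.IsGibbs S.ruelleG β Q τ →
          ∀ c : S.G → Fin n, Kusuoka.GibbsDynamics (S.F c) Q τ) ∧
      -- the case of the space of sequences with the shift
      ((∃ β Q τ, Kusuoka.IsGibbs S.ruelleSigma β Q τ) ∧
        ∀ β Q τ, Kusuoka.IsGibbs S.ruelleSigma β Q τ →
          Kusuoka.GibbsDynamics Kusuoka.IFS.shift Q τ) := by
  have hpos := Kusuoka.IFS.holderBound_pos n ν₀ η hb
  refine ⟨⟨_, hpos.le⟩, hpos, fun S h hS hH => ⟨?_, ?_⟩⟩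
  · exact S.gibbs_G hd hν₀ hν₀' hb h hS rfl hH
  · exact S.gibbs_sigma hd hν₀ hb hS rfl hH
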